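/- **Notation.** Let $d\ge 0$ be an integer. * $\Sigma_1(\mathbf R^d)$ is the Gelfand–Shilov space of all $f\in C^\infty(\mathbf R^d)$ such that for every $h>0$ there is $C>0$ with $|x^\beta\partial^\alpha f(x)|\le C\,h^{|\alpha+\beta|}\alpha!\,\beta!$ for all $\alpha,\beta\in\mathbf N^d$, $x\in\mathbf R^d$, with the projective limit topology of the corresponding seminorms; $\Sigma_1'(\mathbf R^d)$ is its topological dual, and $\Sigma_1(\mathbf R^d)\subseteq\Sigma_1'(\mathbf R^d)$ through $\langle f,\psi\rangle=\int f\psi\,dx$. * For $\phi\in\Sigma_1(\mathbf R^d)$ and $f\in\Sigma_1'(\mathbf R^d)$, the short-time Fourier transform is $$V_\phi f(x,\xi)=(2\pi)^{-d/2}\big\langle f,\ \overline{\phi(\cdot-x)}\,e^{-i\langle\cdot,\xi\rangle}\big\rangle ,\qquad x,\xi\in\mathbf R^d .$$ * A weight on $\mathbf R^{2d}$ is a function $\omega>0$ with $\omega,1/\omega\in L^\infty_{\rm loc}(\mathbf R^{2d})$; it is moderate, $\omega\in\mathscr P_E(\mathbf R^{2d})$, if there are a weight $v$ and $C\ge1$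 with $\omega(z+w)\le C\omega(z)v(w)$ for all $z,w\in\mathbf R^{2d}$. * For $p,q\in(0,\infty)$, $\omega\in\mathscr P_E(\mathbf R^{2d})$ and a window $\phi\in\Sigma_1(\mathbf R^d)\setminus\{0\}$, the modulation space $M^{p,q}_{(\omega)}(\mathbf R^d)$ consists of all $f\in\Sigma_1'(\mathbf R^d)$ with $$\|f\|_{M^{p,q}_{(\omega)}}=\Big(\int_{\mathbf R^d}\Big(\int_{\mathbf R^d}|V_\phi f(x,\xi)\,\omega(x,\xi)|^p\,dx\Big)^{q/p}d\xi\Big)^{1/q}<\infty ,$$ with the topology defined by this quasi-norm. **Theorem.** Let $p_j,q_j\in(0,\infty)$ and $\omega_j\in\mathscr P_E(\mathbf R^{2d})$, $j=0,1,2$, be such that $$\frac1{p_0}\le\frac1{p_1}+\frac1{p_2}-\max\Big(1,\frac1{p_1},\frac1{p_2}\Big),\qquad \frac1{q_0}\le\frac1{q_1}+\frac1{q_2},$$ $$\omega_0(x_1+x_2,\xi)\le\omega_1(x_1,\xi)\,\omega_2(x_2,\xi),\qquad x_1,x_2,\xi\in\mathbf R^d ,$$ and let the three spaces $M^{p_j,q_j}_{(\omega_j)}(\mathbf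 R^d)$ be defined by arbitrary windows $\phi_j\in\Sigma_1(\mathbf R^d)\setminus\{0\}$. Then the convolution $(f_1,f_2)\mapsto f_1*f_2$, $(f_1*f_2)(x)=\int f_1(y)f_2(x-y)\,dy$, from $\Sigma_1(\mathbf R^d)\times\Sigma_1(\mathbf R^d)$ to $\Sigma_1(\mathbf R^d)$ extends uniquely to a continuous map from $M^{p_1,q_1}_{(\omega_1)}(\mathbf R^d)\times M^{p_2,q_2}_{(\omega_2)}(\mathbf R^d)$ to $M^{p_0,q_0}_{(\omega_0)}(\mathbf R^d)$. The extension, still denoted $*$, is bilinear, and there is a constant $C$, independent of $f_1,f_2$, such that $$\|f_1*f_2\|_{M^{p_0,q_0}_{(\omega_0)}}\le C\,\|f_1\|_{M^{p_1,q_1}_{(\omega_1)}}\|f_2\|_{M^{p_2,q_2}_{(\omega_2)}},\qquad f_j\in M^{p_j,q_j}_{(\omega_j)}(\mathbf R^d),\ j=1,2 .$$ -/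

import Mathlib

open MeasureTheory
open scoped ENNReal NNReal

/-- The Euclidean space `ℝ^d`. -/
abbrev Rd (d : ℕ) : Type := EuclideanSpace ℝ (Fin d)

/-! ### The Gelfand–Shilov space `Σ₁(ℝ^d)` of Beurling type -/

/-- `f` belongs to `Σ₁(ℝ^d)`: `f` is smooth and, for every `h > 0`, there is a constant `C` with
`|x|^k |f^{(n)}(x)| ≤ C h^{k+n} k! n!` for all `k, n, x`, where `|f^{(n)}(x)|` is the norm of the
`n`-th total derivative. Since `α! ≤ |α|! ≤ d^{|α|} α!` and `|x|^k ≤ d^k max_j |x_j|^k`,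
and since `h > 0` is arbitrary, this is
the same as requiring `|x^β ∂^α f(x)| ≤ C h^{|α+β|} α! β!` for all multi-indices `α, β`, every `h`
and some `C = C_h`. -/
def IsGelfandShilov {d : ℕ} (f : Rd d → ℂ) : Prop :=
  ContDiff ℝ (⊤ : ℕ∞) f ∧ ∀ h : ℝ, 0 < h → ∃ C : ℝ, ∀ (k n : ℕ) (x : Rd d),
    ‖x‖ ^ k * ‖iteratedFDeriv ℝ n f x‖ ≤ C * (h ^ (k + n) * (k.factorial * n.factorial))

theorem IsGelfandShilov.zero {d : ℕ} : IsGelfandShilov (0 : Rd d → ℂ) := by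
  refine ⟨contDiff_const, fun h hh => ⟨0, fun k n x => ?_⟩⟩
  have : (0 : Rd d → ℂ) = fun _ => 0 := rfl
  simp [this]

theorem IsGelfandShilov.add {d : ℕ} {f g : Rd d → ℂ} (hf : IsGelfandShilov f)
    (hg : IsGelfandShilov g) : IsGelfandShilov (f + g) := by
  refine ⟨hf.1.add hg.1, fun h hh => ?_⟩
  obtain ⟨C, hC⟩ := hf.2 h hh
  obtain ⟨D, hD⟩ := hg.2 h hh
  refine ⟨C + D, fun k n x => ?_⟩
  rw [iteratedFDeriv_add_apply (hf.1.contDiffAt.of_le (by exact_mod_cast le_top))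
    (hg.1.contDiffAt.of_le (by exact_mod_cast le_top))]
  calc ‖x‖ ^ k * ‖iteratedFDeriv ℝ n f x + iteratedFDeriv ℝ n g x‖
      ≤ ‖x‖ ^ k * (‖iteratedFDeriv ℝ n f x‖ + ‖iteratedFDeriv ℝ n g x‖) := by
        gcongr; exact norm_add_le _ _
    _ ≤ _ := by rw [mul_add, add_mul]; exact add_le_add (hC k n x) (hD k n x)

theorem IsGelfandShilov.smul {d : ℕ} {f : Rd d → ℂ} (c : ℂ) (hf : IsGelfandShilov f) :
    IsGelfandShilov (c • f) := by
  refine ⟨hf.1.const_smul c, fun h hh => ?_⟩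
  obtain ⟨C, hC⟩ := hf.2 h hh
  refine ⟨‖c‖ * C, fun k n x => ?_⟩
  rw [iteratedFDeriv_const_smul_apply (hf.1.contDiffAt.of_le (by exact_mod_cast le_top)),
    norm_smul, mul_left_comm, mul_assoc]
  exact mul_le_mul_of_nonneg_left (hC k n x) (norm_nonneg c)

/-- `Σ₁(ℝ^d)` as a set of functions, closed under linear combinations. -/
def gelfandShilovSubmodule (d : ℕ) : Submodule ℂ (Rd d → ℂ) where
  carrier := {f | IsGelfandShilov f}
  zero_mem' := IsGelfandShilov.zero
  add_mem' := IsGelfandShilov.add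
  smul_mem' := fun c _ hf => IsGelfandShilov.smul c hf

/-- The Gelfand–Shilov space `Σ₁(ℝ^d)`. Its topology is defined below; it is not the topology of
pointwise convergence. -/
def GelfandShilov (d : ℕ) : Type := gelfandShilovSubmodule d

namespace GelfandShilov

variable {d : ℕ}

noncomputable instance : AddCommGroup (GelfandShilov d) :=
  inferInstanceAs (AddCommGroup (gelfandShilovSubmodule d))

noncomputable instance : Module ℂ (GelfandShilov d) :=
  inferInstanceAs (Module ℂ (gelfandShilovSubmodule d))

instance : CoeFun (GelfandShilov d) (fun _ => Rd d → ℂ) := ⟨fun f => f.1⟩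

theorem add_apply (f g : GelfandShilov d) (x : Rd d) : (f + g) x = f x + g x := rfl

theorem smul_apply (c : ℂ) (f : GelfandShilov d) (x : Rd d) : (c • f) x = c * f x := rfl

/-- The quotients whose supremum over `k, n, x` is the seminorm with parameter `h`. -/
noncomputable def quot (h : ℝ) (f : GelfandShilov d) (i : ℕ × ℕ × Rd d) : ℝ :=
  ‖i.2.2‖ ^ i.1 * ‖iteratedFDeriv ℝ i.2.1 f i.2.2‖ / (h ^ (i.1 + i.2.1) *
    (i.1.factorial * i.2.1.factorial))

theorem quot_bddAbove {h : ℝ} (hh : 0 < h) (f : GelfandShilov d) :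
    BddAbove (Set.range (quot h f)) := by
  obtain ⟨C, hC⟩ := f.2.2 h hh
  refine ⟨C, ?_⟩
  rintro _ ⟨⟨k, n, x⟩, rfl⟩
  exact (div_le_iff₀ (by positivity)).2 (hC k n x)

theorem quot_nonneg {h : ℝ} (hh : 0 < h) (f : GelfandShilov d) (i) : 0 ≤ quot h f i := by
  unfold quot; positivity

/-- The seminorm `f ↦ sup |x|^k |f^{(n)}(x)| / (h^{k+n} k! n!)`, the supremum being over
`k, n, x`. -/
noncomputable def gsSeminorm (d : ℕ) (h : {h : ℝ // 0 < h}) : Seminorm ℂ (GelfandShilov d) :=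
  Seminorm.ofSMulLE (fun f => ⨆ i, quot h.1 f i)
    (by
      have : ∀ i, quot h.1 (0 : GelfandShilov d) i = 0 := by
        intro i
        have h0 : ((0 : GelfandShilov d) : Rd d → ℂ) = fun _ => 0 := rfl
        simp [quot, h0]
      simp [this])
    (by
      intro f g
      refine ciSup_le fun i => ?_
      refine le_trans ?_ (add_le_add (le_ciSup (quot_bddAbove h.2 f) i)
        (le_ciSup (quot_bddAbove h.2 g) i))
      have e : ((f + g : GelfandShilov d) : Rd d → ℂ) = f.1 + g.1 := rfl
      have h2 := h.2
      unfold quot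
      rw [e, iteratedFDeriv_add_apply (f.2.1.contDiffAt.of_le (by exact_mod_cast le_top))
        (g.2.1.contDiffAt.of_le (by exact_mod_cast le_top)), ← add_div, ← mul_add]
      gcongr
      exact norm_add_le _ _)
    (by
      intro c f
      refine ciSup_le fun i => ?_
      refine le_trans (le_of_eq ?_)
        (mul_le_mul_of_nonneg_left (le_ciSup (quot_bddAbove h.2 f) i) (norm_nonneg c))
      have e : ((c • f : GelfandShilov d) : Rd d → ℂ) = c • f.1 := rfl
      unfold quot
      rw [e, iteratedFDeriv_const_smul_apply (f.2.1.contDiffAt.of_le (by exact_mod_cast le_top)),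
        norm_smul]
      ring)

instance : Nonempty {h : ℝ // 0 < h} := ⟨⟨1, one_pos⟩⟩

/-- The projective limit topology of `Σ₁(ℝ^d)`, given by all the seminorms with `h > 0`. -/
noncomputable instance : TopologicalSpace (GelfandShilov d) :=
  SeminormFamily.moduleFilterBasis (𝕜 := ℂ) (gsSeminorm d) |>.topology'

theorem withSeminorms (d : ℕ) : WithSeminorms (gsSeminorm d) := ⟨rfl⟩

theorem bound (h : {h : ℝ // 0 < h}) (f : GelfandShilov d) (k n : ℕ) (x : Rd d) :
    ‖x‖ ^ k * ‖iteratedFDeriv ℝ n f x‖ ≤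
      gsSeminorm d h f * (h.1 ^ (k + n) * (k.factorial * n.factorial)) := by
  have h2 := h.2
  exact (div_le_iff₀ (by positivity)).1 (le_ciSup (quot_bddAbove h.2 f) (k, n, x))

/-- Elements of `Σ₁(ℝ^d)` are Schwartz functions. -/
noncomputable def toSchwartz (f : GelfandShilov d) : SchwartzMap (Rd d) ℂ where
  toFun := f
  smooth' := f.2.1
  decay' := fun k n => ⟨_, fun x => bound ⟨1, one_pos⟩ f k n x⟩

theorem integrable (f : GelfandShilov d) : Integrable (fun x => f x) :=
  f.toSchwartz.integrable

theorem norm_le (f : GelfandShilov d) (x : Rd d) : ‖f x‖ ≤ gsSeminorm d ⟨1, one_pos⟩ f := by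
  simpa using bound ⟨1, one_pos⟩ f 0 0 x

theorem integrable_mul (f g : GelfandShilov d) : Integrable (fun x => f x * g x) :=
  f.integrable.mul_bdd (c := gsSeminorm d ⟨1, one_pos⟩ g) g.2.1.continuous.aestronglyMeasurable
    (Filter.Eventually.of_forall g.norm_le)

/-! ### Translated and modulated windows -/

theorem sum_aux {h a : ℝ} (hh : 0 < h) (ha : 0 ≤ a) (n : ℕ) :
    ∑ i ∈ Finset.range (n + 1), (n.choose i : ℝ) * (h ^ i * i.factorial) * a ^ (n - i)
      ≤ h ^ n * n.factorial * Real.exp (a / h) := by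
  have key : ∀ i ∈ Finset.range (n + 1), (n.choose i : ℝ) * (h ^ i * i.factorial) * a ^ (n - i)
      = h ^ n * n.factorial * ((a / h) ^ (n - i) / (n - i).factorial) := by
    intro i hi
    have hi' : i ≤ n := Nat.lt_succ_iff.1 (Finset.mem_range.1 hi)
    have h1 : (n.choose i : ℝ) * i.factorial * (n - i).factorial = n.factorial := by
      exact_mod_cast Nat.choose_mul_factorial_mul_factorial hi'
    have h2 : h ^ n = h ^ i * h ^ (n - i) := by rw [← pow_add]; congr 1; omega
    rw [← h1, h2, div_pow]
    field_simp
  rw [Finset.sum_congr rfl key, ← Finset.mul_sum]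
  have := Finset.sum_range_reflect (fun i => (a / h) ^ i / (i.factorial : ℝ)) (n + 1)
  simp only [Nat.add_sub_cancel] at this
  rw [this]
  gcongr
  exact Real.sum_le_exp_of_nonneg (by positivity) _

theorem norm_iteratedFDeriv_character_le (ξ y : Rd d) (n : ℕ) :
    ‖iteratedFDeriv ℝ n (fun y : Rd d => Complex.exp (-Complex.I * (inner ℝ ξ y : ℝ))) y‖
      ≤ ‖ξ‖ ^ n := by
  have hc : ContDiff ℝ (⊤ : ℕ∞) (fun t : ℝ => Complex.exp (-Complex.I * (t : ℂ))) :=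
    (contDiff_const.mul Complex.ofRealCLM.contDiff).cexp
  have e : (fun y : Rd d => Complex.exp (-Complex.I * (inner ℝ ξ y : ℝ)))
      = (fun t : ℝ => Complex.exp (-Complex.I * (t : ℂ))) ∘ (innerSL ℝ ξ) := by
    ext y; simp
  have hd : ∀ m : ℕ, iteratedDeriv m (fun t : ℝ => Complex.exp (-Complex.I * (t : ℂ)))
      = fun t : ℝ => (-Complex.I) ^ m * Complex.exp (-Complex.I * (t : ℂ)) := by
    intro m
    induction m with
    | zero => simp
    | succ m ih =>
      rw [iteratedDeriv_succ, ih]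
      ext t
      have h1 : HasDerivAt (fun t : ℝ => -Complex.I * (t : ℂ)) (-Complex.I) t := by
        simpa using (Complex.ofRealCLM.hasDerivAt (x := t)).const_mul (-Complex.I)
      rw [(h1.cexp.const_mul ((-Complex.I) ^ m)).deriv]
      ring
  rw [e, (innerSL ℝ ξ).iteratedFDeriv_comp_right hc y (by exact_mod_cast le_top)]
  refine (ContinuousMultilinearMap.norm_compContinuousLinearMap_le _ _).trans ?_
  rw [norm_iteratedFDeriv_eq_norm_iteratedDeriv, hd]
  have : ‖Complex.exp (-Complex.I * ((innerSL ℝ ξ y : ℝ) : ℂ))‖ = 1 := by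
    rw [Complex.norm_exp]; simp
  rw [norm_mul, this]
  simp

theorem window_mem (φ : GelfandShilov d) (x ξ : Rd d) :
    IsGelfandShilov (fun y : Rd d =>
      (starRingEnd ℂ) (φ (y - x)) * Complex.exp (-Complex.I * (inner ℝ ξ y : ℝ))) := by
  have hs : ContDiff ℝ (⊤ : ℕ∞) (fun y : Rd d => (starRingEnd ℂ) (φ (y - x))) :=
    Complex.conjLIE.contDiff.comp (φ.2.1.comp (contDiff_id.sub contDiff_const))
  have he : ContDiff ℝ (⊤ : ℕ∞) (fun y : Rd d => Complex.exp (-Complex.I * (inner ℝ ξ y : ℝ))) :=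
    (contDiff_const.mul (Complex.ofRealCLM.contDiff.comp (innerSL ℝ ξ).contDiff)).cexp
  refine ⟨hs.mul he, fun h hh => ?_⟩
  set A := gsSeminorm d ⟨h, hh⟩ φ with hA
  have hA0 : 0 ≤ A := apply_nonneg _ _
  have hn : ∀ (i : ℕ) (y : Rd d),
      ‖iteratedFDeriv ℝ i (fun y : Rd d => (starRingEnd ℂ) (φ (y - x))) y‖
        = ‖iteratedFDeriv ℝ i φ (y - x)‖ := by
    intro i y
    have e : (fun y : Rd d => (starRingEnd ℂ) (φ (y - x)))
        = Complex.conjLIE ∘ (fun y => φ (y - x)) := rfl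
    rw [e, LinearIsometryEquiv.norm_iteratedFDeriv_comp_left, iteratedFDeriv_comp_sub]
  -- decay of the translate
  have ht : ∀ (k i : ℕ) (y : Rd d), ‖y‖ ^ k * ‖iteratedFDeriv ℝ i φ (y - x)‖
      ≤ A * (h ^ i * i.factorial) * (h ^ k * k.factorial * Real.exp (‖x‖ / h)) := by
    intro k i y
    have h1 : ‖y‖ ^ k ≤ (‖y - x‖ + ‖x‖) ^ k := by
      gcongr
      simpa using norm_add_le (y - x) x
    calc ‖y‖ ^ k * ‖iteratedFDeriv ℝ i φ (y - x)‖
        ≤ (‖y - x‖ + ‖x‖) ^ k * ‖iteratedFDeriv ℝ i φ (y - x)‖ := by gcongr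
      _ = ∑ j ∈ Finset.range (k + 1), (k.choose j : ℝ) * ‖x‖ ^ (k - j) *
            (‖y - x‖ ^ j * ‖iteratedFDeriv ℝ i φ (y - x)‖) := by
          rw [add_pow, Finset.sum_mul]
          exact Finset.sum_congr rfl fun j _ => by ring
      _ ≤ ∑ j ∈ Finset.range (k + 1), (k.choose j : ℝ) * ‖x‖ ^ (k - j) *
            (A * (h ^ (j + i) * (j.factorial * i.factorial))) := by
          refine Finset.sum_le_sum fun j _ => ?_
          exact mul_le_mul_of_nonneg_left (bound ⟨h, hh⟩ φ j i (y - x)) (by positivity)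
      _ = A * (h ^ i * i.factorial) * ∑ j ∈ Finset.range (k + 1),
            (k.choose j : ℝ) * (h ^ j * j.factorial) * ‖x‖ ^ (k - j) := by
          rw [Finset.mul_sum]
          exact Finset.sum_congr rfl fun j _ => by ring
      _ ≤ _ := by
          gcongr
          exact sum_aux hh (norm_nonneg x) k
  refine ⟨A * Real.exp (‖x‖ / h) * Real.exp (‖ξ‖ / h), fun k n y => ?_⟩
  calc ‖y‖ ^ k * ‖iteratedFDeriv ℝ n (fun y : Rd d =>
        (starRingEnd ℂ) (φ (y - x)) * Complex.exp (-Complex.I * (inner ℝ ξ y : ℝ))) y‖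
      ≤ ‖y‖ ^ k * ∑ i ∈ Finset.range (n + 1), (n.choose i : ℝ) *
          ‖iteratedFDeriv ℝ i (fun y : Rd d => (starRingEnd ℂ) (φ (y - x))) y‖ *
          ‖iteratedFDeriv ℝ (n - i)
            (fun y : Rd d => Complex.exp (-Complex.I * (inner ℝ ξ y : ℝ))) y‖ := by
        gcongr
        exact norm_iteratedFDeriv_mul_le hs he y (by exact_mod_cast le_top)
    _ ≤ ‖y‖ ^ k * ∑ i ∈ Finset.range (n + 1), (n.choose i : ℝ) *
          ‖iteratedFDeriv ℝ i φ (y - x)‖ * ‖ξ‖ ^ (n - i) := by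
        gcongr with i hi
        · exact (hn i y).le
        · exact norm_iteratedFDeriv_character_le ξ y _
    _ = ∑ i ∈ Finset.range (n + 1), (n.choose i : ℝ) * ‖ξ‖ ^ (n - i) *
          (‖y‖ ^ k * ‖iteratedFDeriv ℝ i φ (y - x)‖) := by
        rw [Finset.mul_sum]
        exact Finset.sum_congr rfl fun j _ => by ring
    _ ≤ ∑ i ∈ Finset.range (n + 1), (n.choose i : ℝ) * ‖ξ‖ ^ (n - i) *
          (A * (h ^ i * i.factorial) * (h ^ k * k.factorial * Real.exp (‖x‖ / h))) := by
        refine Finset.sum_le_sum fun i _ => ?_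
        exact mul_le_mul_of_nonneg_left (ht k i y) (by positivity)
    _ = A * (h ^ k * k.factorial * Real.exp (‖x‖ / h)) * ∑ i ∈ Finset.range (n + 1),
          (n.choose i : ℝ) * (h ^ i * i.factorial) * ‖ξ‖ ^ (n - i) := by
        rw [Finset.mul_sum]
        exact Finset.sum_congr rfl fun j _ => by ring
    _ ≤ A * (h ^ k * k.factorial * Real.exp (‖x‖ / h)) *
          (h ^ n * n.factorial * Real.exp (‖ξ‖ / h)) := by
        gcongr
        exact sum_aux hh (norm_nonneg ξ) n
    _ = _ := by ring

/-- The function `y ↦ conj (φ(y - x)) e^{-i⟨y, ξ⟩}`, an element of `Σ₁(ℝ^d)`. -/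
noncomputable def window (φ : GelfandShilov d) (x ξ : Rd d) : GelfandShilov d :=
  ⟨fun y => (starRingEnd ℂ) (φ (y - x)) * Complex.exp (-Complex.I * (inner ℝ ξ y : ℝ)),
    window_mem φ x ξ⟩

end GelfandShilov

/-! ### Gelfand–Shilov distributions and the short-time Fourier transform -/

/-- The space `Σ₁'(ℝ^d)` of Gelfand–Shilov distributions of Beurling type, the topological dual of
`Σ₁(ℝ^d)`; the value `u ψ` is the bilinear pairing `⟨u, ψ⟩`, so that the sesquilinear `L²` pairing
`(u, ψ)` is `u (conj ψ)`. -/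
abbrev GSDistribution (d : ℕ) : Type := GelfandShilov d →L[ℂ] ℂ

/-- The embedding of `Σ₁(ℝ^d)` in `Σ₁'(ℝ^d)`, `⟨f, ψ⟩ = ∫ f(x) ψ(x) dx`. -/
noncomputable def GelfandShilov.toDistribution {d : ℕ} (f : GelfandShilov d) :
    GSDistribution d where
  toFun ψ := ∫ x, f x * ψ x
  map_add' ψ χ := by
    simp only [GelfandShilov.add_apply, mul_add]
    exact integral_add (f.integrable_mul ψ) (f.integrable_mul χ)
  map_smul' c ψ := by
    simp only [GelfandShilov.smul_apply, RingHom.id_apply, smul_eq_mul, mul_left_comm _ c]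
    exact integral_const_mul c _
  cont := by
    let L : GelfandShilov d →ₗ[ℂ] ℂ :=
      { toFun := fun ψ => ∫ x, f x * ψ x
        map_add' := fun ψ χ => by
          simp only [GelfandShilov.add_apply, mul_add]
          exact integral_add (f.integrable_mul ψ) (f.integrable_mul χ)
        map_smul' := fun c ψ => by
          simp only [GelfandShilov.smul_apply, RingHom.id_apply, smul_eq_mul, mul_left_comm _ c]
          exact integral_const_mul c _ }
    change Continuous L
    refine WithSeminorms.continuous_normedSpace_rng ℂ (GelfandShilov.withSeminorms d) L
      ⟨{⟨1, one_pos⟩}, ⟨∫ x, ‖f x‖, integral_nonneg fun _ => norm_nonneg _⟩, fun ψ => ?_⟩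
    simp only [Finset.sup_singleton]
    change ‖∫ x, f x * ψ x‖ ≤ (∫ x, ‖f x‖) * GelfandShilov.gsSeminorm d ⟨1, one_pos⟩ ψ
    rw [← integral_mul_const]
    refine norm_integral_le_of_norm_le (f.integrable.norm.mul_const _)
      (Filter.Eventually.of_forall fun x => ?_)
    rw [norm_mul]
    exact mul_le_mul_of_nonneg_left (ψ.norm_le x) (norm_nonneg _)

/-- The short-time Fourier transform
`V_φ f(x, ξ) = (2π)^{-d/2} (f, φ(· - x) e^{i⟨·, ξ⟩})_{L²}` of `f ∈ Σ₁'(ℝ^d)` with window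
`φ ∈ Σ₁(ℝ^d)`. -/
noncomputable def stft {d : ℕ} (φ : GelfandShilov d) (f : GSDistribution d) (x ξ : Rd d) : ℂ :=
  (((2 * Real.pi) ^ (-(d : ℝ) / 2) : ℝ) : ℂ) * f (φ.window x ξ)

/-! ### Moderate weights -/

/-- A weight: a positive function `ω` with both `ω` and `1/ω` in `L^∞_loc`. -/
def IsWeight {X : Type*} [TopologicalSpace X] [MeasureSpace X] (ω : X → ℝ) : Prop :=
  (∀ z, 0 < ω z) ∧ ∀ K : Set X, IsCompact K →
    MemLp ω ∞ (volume.restrict K) ∧ MemLp (fun z => (ω z)⁻¹) ∞ (volume.restrict K)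

/-- The class `𝒫_E` of moderate weights. -/
def IsModerateWeight {X : Type*} [AddGroup X] [TopologicalSpace X] [MeasureSpace X]
    (ω : X → ℝ) : Prop :=
  IsWeight ω ∧ ∃ v : X → ℝ, IsWeight v ∧ ∃ C : ℝ, 1 ≤ C ∧ ∀ z w, ω (z + w) ≤ C * ω z * v w

/-! ### Modulation spaces -/

/-- The mixed quasi-norm `‖F‖_{L^{p,q}_{(ω)}}`: the `L^p` quasi-norm of `F ω` in the first variable,
followed by the `L^q` quasi-norm in the second one. -/
noncomputable def mixedNorm {d : ℕ} (p q : ℝ) (ω : Rd d × Rd d → ℝ) (F : Rd d → Rd d → ℂ) : ℝ≥0∞ :=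
  eLpNorm (fun ξ => eLpNorm (fun x => F x ξ * (ω (x, ξ) : ℂ)) (ENNReal.ofReal p) volume)
    (ENNReal.ofReal q) volume

/-- The quasi-norm `‖f‖_{M^{p,q}_{(ω)}} = ‖V_φ f‖_{L^{p,q}_{(ω)}}` of `f ∈ Σ₁'(ℝ^d)`. -/
noncomputable def modNorm {d : ℕ} (φ : GelfandShilov d) (p q : ℝ) (ω : Rd d × Rd d → ℝ)
    (f : GSDistribution d) : ℝ≥0∞ :=
  mixedNorm p q ω (stft φ f)

/-- The modulation space `M^{p,q}_{(ω)}(ℝ^d)`, `0 < p, q < ∞`, whose quasi-norm is computed with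
the window `φ`. -/
structure ModulationSpace {d : ℕ} (φ : GelfandShilov d) (p q : ℝ) (ω : Rd d × Rd d → ℝ) where
  /-- The underlying Gelfand–Shilov distribution. -/
  toGS : GSDistribution d
  finite : modNorm φ p q ω toGS < ∞

/-- The topology defined by the quasi-norm: a set is open if around each of its points it contains
a ball of the quasi-norm. -/
instance {d : ℕ} (φ : GelfandShilov d) (p q : ℝ) (ω : Rd d × Rd d → ℝ) :
    TopologicalSpace (ModulationSpace φ p q ω) where
  IsOpen U := ∀ f ∈ U, ∃ ε : ℝ≥0∞, 0 < ε ∧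
    ∀ g : ModulationSpace φ p q ω, modNorm φ p q ω (g.toGS - f.toGS) < ε → g ∈ U
  isOpen_univ := fun _ _ => ⟨1, one_pos, fun _ _ => trivial⟩
  isOpen_inter := by
    intro U V hU hV f hf
    obtain ⟨ε, hε, h1⟩ := hU f hf.1
    obtain ⟨δ, hδ, h2⟩ := hV f hf.2
    exact ⟨min ε δ, lt_min hε hδ, fun g hg =>
      ⟨h1 g (hg.trans_le (min_le_left _ _)), h2 g (hg.trans_le (min_le_right _ _))⟩⟩
  isOpen_sUnion := by
    rintro S hS f ⟨U, hU, hf⟩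
    obtain ⟨ε, hε, h1⟩ := hS U hU f hf
    exact ⟨ε, hε, fun g hg => ⟨U, hU, h1 g hg⟩⟩

section BilinearMaps

variable {d : ℕ} {φ₀ φ₁ φ₂ : GelfandShilov d} {p₀ q₀ p₁ q₁ p₂ q₂ : ℝ}
  {ω₀ ω₁ ω₂ : Rd d × Rd d → ℝ}

/-- `T` extends the convolution of `Σ₁(ℝ^d)`: for all `f, g ∈ Σ₁(ℝ^d)`, the function `f * g` is in
`Σ₁(ℝ^d)`, `f` and `g` are in the two modulation spaces, and `T(f, g) = f * g`. -/
def ExtendsConvolution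
    (T : ModulationSpace φ₁ p₁ q₁ ω₁ × ModulationSpace φ₂ p₂ q₂ ω₂ → ModulationSpace φ₀ p₀ q₀ ω₀) :
    Prop :=
  ∀ f g : GelfandShilov d, ∃ (F : ModulationSpace φ₁ p₁ q₁ ω₁) (G : ModulationSpace φ₂ p₂ q₂ ω₂)
    (k : GelfandShilov d), F.toGS = f.toDistribution ∧ G.toGS = g.toDistribution ∧
      (∀ x, k x = ∫ y, f y * g (x - y)) ∧ (T (F, G)).toGS = k.toDistribution

/-- `T` is bilinear for the linear operations of `Σ₁'(ℝ^d)`: linear combinations of elements of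
either modulation space stay in that space, and `T` maps them to the corresponding linear
combinations. -/
def IsBilinearOnModulation
    (T : ModulationSpace φ₁ p₁ q₁ ω₁ × ModulationSpace φ₂ p₂ q₂ ω₂ → ModulationSpace φ₀ p₀ q₀ ω₀) :
    Prop :=
  (∀ (a b : ℂ) (f f' : ModulationSpace φ₁ p₁ q₁ ω₁) (g : ModulationSpace φ₂ p₂ q₂ ω₂),
    ∃ f'' : ModulationSpace φ₁ p₁ q₁ ω₁, f''.toGS = a • f.toGS + b • f'.toGS ∧
      (T (f'', g)).toGS = a • (T (f, g)).toGS + b • (T (f', g)).toGS) ∧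
  (∀ (a b : ℂ) (f : ModulationSpace φ₁ p₁ q₁ ω₁) (g g' : ModulationSpace φ₂ p₂ q₂ ω₂),
    ∃ g'' : ModulationSpace φ₂ p₂ q₂ ω₂, g''.toGS = a • g.toGS + b • g'.toGS ∧
      (T (f, g'')).toGS = a • (T (f, g)).toGS + b • (T (f, g')).toGS)

end BilinearMaps

/-! The short-time Fourier transform turns convolution into convolution in the position variable
alone. Write `W_φ f(x, ξ)` for the unnormalized transform `wval φ f (x, ξ)` and `φ~` for `conj
φ(-·)`. On `Σ₁`, `W_{φ * φ~}(f * g)(x, ξ) = ∫ W_φ f(y, ξ) W_{φ~} g(x - y, ξ) dy`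
(`stftConv_toDistribution`). The right side makes sense on the modulation spaces, and a distribution
is recovered from its transform by the inversion formula (`GSDistribution.inversion`). The extension
is therefore defined by inserting the right side, with `φ = φ₁`, in the inversion formula for the
window `Θ = φ₁ * φ₁~`, which is nonzero because `Θ(0) = ‖φ₁‖²` in `L²`.

The difficulty of the estimate is that exponents below `1` are allowed, where Young's and
Minkowski's inequalities fail for general functions. Transforms are not general functions: the
reproducing formula gives `F ≤ K F * e^{-a|·|}` for `F = |W_φ f|` and every `a > 0`. Hence `F` may
be replaced by Peetre's maximal function `sup_w F(w) e^{-a|z-w|}`. It dominates `F`, changes at most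
by the factor `e^{a|u|}` under translation by `u` (it is slowly varying), and its weighted mixed
quasi-norm is bounded by that of `F` (`exists_mix_peetre_le`). The last point follows by passing to
the power `r = min(1, p, q)`, after which the exponents `p/r` and `q/r` are at least `1`.

For slowly varying functions `L^p` embeds in `L^s` when `p ≤ s`, as for sequences. So with `1/t =
max(1, 1/p₁, 1/p₂)` the convolution of `f` and `g` is at most a constant times `(f^t * g^t)^{1/t}`,
and the classical Young inequality applies with the exponents `p_j/t ≥ 1`; this explains the
condition on the `p_j`. Hölder's inequality in `ξ` and the same embedding explain the condition on
the `q_j` (`exists_mix_convolution_le`). Synthesis followed by analysis with `φ₀` only convolves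
with rapidly decaying exponentials, and slowly varying majorants absorb this (`exists_synthesis`);
this also makes the windows arbitrary.

Throughout, elements of `Σ₁` and their transforms decay faster than every exponential, while
distributions and moderate weights grow at most exponentially. Uniqueness follows from the Hausdorff
property and the density of `Σ₁`, obtained by cutting off the inversion integral to balls; here
dominated convergence uses `p, q < ∞`. -/

/-! ### Exponential decay from factorial bounds -/

theorem integrable_exp_neg_mul_norm {E : Type*} [NormedAddCommGroup E] [NormedSpace ℝ E]
    [FiniteDimensional ℝ E] [MeasurableSpace E] [BorelSpace E] (μ : Measure E)
    [μ.IsAddHaarMeasure] {a : ℝ} (ha : 0 < a) : Integrable (fun x => Real.exp (-(a * ‖x‖))) μ := by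
  set N : ℕ := Module.finrank ℝ E + 1 with hN
  have h1 : Integrable (fun x : E => (1 + ‖x‖) ^ (-(N : ℝ))) μ :=
    integrable_one_add_norm (by rw [hN]; push_cast; linarith)
  refine (h1.const_mul (Real.exp a * N.factorial / a ^ N)).mono' (by fun_prop)
    (Filter.Eventually.of_forall fun x => ?_)
  have hx : 0 < 1 + ‖x‖ := by positivity
  rw [Real.norm_of_nonneg (Real.exp_pos _).le, Real.rpow_neg hx.le, Real.rpow_natCast]
  have h2 : (a * (1 + ‖x‖)) ^ N / N.factorial ≤ Real.exp (a * (1 + ‖x‖)) :=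
    Real.pow_div_factorial_le_exp _ (by positivity) N
  have h3 : Real.exp (a * (1 + ‖x‖)) = Real.exp a * Real.exp (a * ‖x‖) := by
    rw [← Real.exp_add]; ring_nf
  rw [h3, div_le_iff₀ (by positivity), mul_pow] at h2
  rw [Real.exp_neg, ← div_eq_mul_inv, inv_le_iff_one_le_mul₀ (Real.exp_pos _), div_div,
    div_mul_eq_mul_div, one_le_div (by positivity)]
  linarith

/-- Dividing the `k`-th bound by `(2h)^k k!` and summing gives the exponential series on the left
and a geometric series on the right. -/
theorem mul_exp_le_of_pow_mul_le {t b C h : ℝ} (hh : 0 < h)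
    (H : ∀ k : ℕ, t ^ k * b ≤ C * (h ^ k * k.factorial)) :
    b * Real.exp (t / (2 * h)) ≤ 2 * C := by
  have h1 : HasSum (fun k : ℕ => b * ((t / (2 * h)) ^ k / k.factorial))
      (b * Real.exp (t / (2 * h))) := by
    rw [Real.exp_eq_exp_ℝ]
    exact (NormedSpace.expSeries_div_hasSum_exp (t / (2 * h))).mul_left b
  have h2 : HasSum (fun k : ℕ => (1 / 2 : ℝ) ^ k * C) (2 * C) := hasSum_geometric_two.mul_right C
  refine hasSum_le (fun k => ?_) h1 h2
  have hk : b * ((t / (2 * h)) ^ k / k.factorial)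
      = (t ^ k * b) / (h ^ k * k.factorial) * (1 / 2) ^ k := by
    rw [div_pow, mul_pow, one_div, inv_pow]
    field_simp
  rw [hk, mul_comm]
  gcongr
  exact (div_le_iff₀ (by positivity)).2 (H k)

/-! ### Decay of `Σ₁` functions and of their short-time Fourier transforms -/

namespace GelfandShilov

theorem norm_iteratedFDeriv_le_exp {d : ℕ} (h : {h : ℝ // 0 < h}) (f : GelfandShilov d) (n : ℕ)
    (x : Rd d) : ‖iteratedFDeriv ℝ n f x‖ ≤
      2 * gsSeminorm d h f * (h.1 ^ n * n.factorial) * Real.exp (-(‖x‖ / (2 * h.1))) := by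
  have := mul_exp_le_of_pow_mul_le (t := ‖x‖) (b := ‖iteratedFDeriv ℝ n f x‖)
    (C := gsSeminorm d h f * (h.1 ^ n * n.factorial)) h.2 (fun k => by
      refine (bound h f k n x).trans (le_of_eq ?_)
      rw [pow_add]; ring)
  rw [Real.exp_neg, ← div_eq_mul_inv, le_div_iff₀ (Real.exp_pos _)]
  linarith

theorem gsSeminorm_le {d : ℕ} (h : {h : ℝ // 0 < h}) (f : GelfandShilov d) {C : ℝ}
    (H : ∀ (k n : ℕ) (x : Rd d), ‖x‖ ^ k * ‖iteratedFDeriv ℝ n f x‖ ≤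
      C * (h.1 ^ (k + n) * (k.factorial * n.factorial))) : gsSeminorm d h f ≤ C := by
  have h2 := h.2
  exact ciSup_le fun i => (div_le_iff₀ (by positivity)).2 (H i.1 i.2.1 i.2.2)

theorem gsSeminorm_anti {d : ℕ} {h h' : {h : ℝ // 0 < h}} (hh : h'.1 ≤ h.1)
    (f : GelfandShilov d) : gsSeminorm d h f ≤ gsSeminorm d h' f := by
  refine gsSeminorm_le h f fun k n x => (bound h' f k n x).trans ?_
  have := h'.2.le
  have := apply_nonneg (gsSeminorm d h') f
  gcongr

theorem norm_iteratedFDeriv_conj_sub {d : ℕ} (φ : GelfandShilov d) (x y : Rd d) (i : ℕ) :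
    ‖iteratedFDeriv ℝ i (fun y : Rd d => (starRingEnd ℂ) (φ (y - x))) y‖
        = ‖iteratedFDeriv ℝ i φ (y - x)‖ := by
  have e : (fun y : Rd d => (starRingEnd ℂ) (φ (y - x)))
      = Complex.conjLIE ∘ (fun y => φ (y - x)) := rfl
  rw [e, LinearIsometryEquiv.norm_iteratedFDeriv_comp_left, iteratedFDeriv_comp_sub]

theorem contDiff_conj_sub {d : ℕ} (φ : GelfandShilov d) (x : Rd d) :
    ContDiff ℝ (⊤ : ℕ∞) (fun y : Rd d => (starRingEnd ℂ) (φ (y - x))) :=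
  Complex.conjLIE.contDiff.comp (φ.2.1.comp (contDiff_id.sub contDiff_const))

theorem window_apply {d : ℕ} (φ : GelfandShilov d) (x ξ y : Rd d) :
    φ.window x ξ y = (starRingEnd ℂ) (φ (y - x)) * Complex.exp (-Complex.I * (inner ℝ ξ y : ℝ)) :=
  rfl

theorem norm_window_apply {d : ℕ} (φ : GelfandShilov d) (x ξ y : Rd d) :
    ‖φ.window x ξ y‖ = ‖φ (y - x)‖ := by
  rw [window_apply, norm_mul, Complex.norm_exp]; simp

theorem pow_mul_norm_iteratedFDeriv_sub_le {d : ℕ} (h : {h : ℝ // 0 < h}) (φ : GelfandShilov d)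
    (x y : Rd d) (k i : ℕ) : ‖y‖ ^ k * ‖iteratedFDeriv ℝ i φ (y - x)‖
      ≤ gsSeminorm d h φ * (h.1 ^ i * i.factorial) *
        (h.1 ^ k * k.factorial * Real.exp (‖x‖ / h.1)) := by
  obtain ⟨h, hh⟩ := h
  set A := gsSeminorm d ⟨h, hh⟩ φ
  have hA0 : 0 ≤ A := apply_nonneg _ _
  have h1 : ‖y‖ ^ k ≤ (‖y - x‖ + ‖x‖) ^ k := by
    gcongr
    simpa using norm_add_le (y - x) x
  calc ‖y‖ ^ k * ‖iteratedFDeriv ℝ i φ (y - x)‖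
      ≤ (‖y - x‖ + ‖x‖) ^ k * ‖iteratedFDeriv ℝ i φ (y - x)‖ := by gcongr
    _ = ∑ j ∈ Finset.range (k + 1), (k.choose j : ℝ) * ‖x‖ ^ (k - j) *
          (‖y - x‖ ^ j * ‖iteratedFDeriv ℝ i φ (y - x)‖) := by
        rw [add_pow, Finset.sum_mul]
        exact Finset.sum_congr rfl fun j _ => by ring
    _ ≤ ∑ j ∈ Finset.range (k + 1), (k.choose j : ℝ) * ‖x‖ ^ (k - j) *
          (A * (h ^ (j + i) * (j.factorial * i.factorial))) := by
        refine Finset.sum_le_sum fun j _ => ?_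
        exact mul_le_mul_of_nonneg_left (bound ⟨h, hh⟩ φ j i (y - x)) (by positivity)
    _ = A * (h ^ i * i.factorial) * ∑ j ∈ Finset.range (k + 1),
          (k.choose j : ℝ) * (h ^ j * j.factorial) * ‖x‖ ^ (k - j) := by
        rw [Finset.mul_sum]
        exact Finset.sum_congr rfl fun j _ => by ring
    _ ≤ _ := by
        gcongr
        exact sum_aux hh (norm_nonneg x) k

/-- Quantitative form of `window_mem`: expanding binomially, translation costs `e^{|x|/h}` and
modulation `e^{|ξ|/h}`, without change of `h`. This is the source of the exponential growth of
transforms of distributions. -/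
theorem gsSeminorm_window_le {d : ℕ} (h : {h : ℝ // 0 < h}) (φ : GelfandShilov d) (x ξ : Rd d) :
    gsSeminorm d h (φ.window x ξ) ≤
      gsSeminorm d h φ * Real.exp (‖x‖ / h.1) * Real.exp (‖ξ‖ / h.1) := by
  refine gsSeminorm_le h _ fun k n y => ?_
  have hh := h.2
  have hA0 : 0 ≤ gsSeminorm d h φ := apply_nonneg _ _
  have hs := contDiff_conj_sub φ x
  have he : ContDiff ℝ (⊤ : ℕ∞) (fun y : Rd d => Complex.exp (-Complex.I * (inner ℝ ξ y : ℝ))) :=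
    (contDiff_const.mul (Complex.ofRealCLM.contDiff.comp (innerSL ℝ ξ).contDiff)).cexp
  calc ‖y‖ ^ k * ‖iteratedFDeriv ℝ n (φ.window x ξ) y‖
      ≤ ‖y‖ ^ k * ∑ i ∈ Finset.range (n + 1), (n.choose i : ℝ) *
          ‖iteratedFDeriv ℝ i (fun y : Rd d => (starRingEnd ℂ) (φ (y - x))) y‖ *
          ‖iteratedFDeriv ℝ (n - i)
            (fun y : Rd d => Complex.exp (-Complex.I * (inner ℝ ξ y : ℝ))) y‖ := by
        gcongr
        exact norm_iteratedFDeriv_mul_le hs he y (by exact_mod_cast le_top)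
    _ ≤ ‖y‖ ^ k * ∑ i ∈ Finset.range (n + 1), (n.choose i : ℝ) *
          ‖iteratedFDeriv ℝ i φ (y - x)‖ * ‖ξ‖ ^ (n - i) := by
        gcongr with i hi
        · exact (norm_iteratedFDeriv_conj_sub φ x y i).le
        · exact norm_iteratedFDeriv_character_le ξ y _
    _ = ∑ i ∈ Finset.range (n + 1), (n.choose i : ℝ) * ‖ξ‖ ^ (n - i) *
          (‖y‖ ^ k * ‖iteratedFDeriv ℝ i φ (y - x)‖) := by
        rw [Finset.mul_sum]
        exact Finset.sum_congr rfl fun j _ => by ring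
    _ ≤ ∑ i ∈ Finset.range (n + 1), (n.choose i : ℝ) * ‖ξ‖ ^ (n - i) *
          (gsSeminorm d h φ * (h.1 ^ i * i.factorial) *
            (h.1 ^ k * k.factorial * Real.exp (‖x‖ / h.1))) := by
        refine Finset.sum_le_sum fun i _ => ?_
        exact mul_le_mul_of_nonneg_left (pow_mul_norm_iteratedFDeriv_sub_le h φ x y k i)
          (by positivity)
    _ = gsSeminorm d h φ * (h.1 ^ k * k.factorial * Real.exp (‖x‖ / h.1)) *
          ∑ i ∈ Finset.range (n + 1),
          (n.choose i : ℝ) * (h.1 ^ i * i.factorial) * ‖ξ‖ ^ (n - i) := by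
        rw [Finset.mul_sum]
        exact Finset.sum_congr rfl fun j _ => by ring
    _ ≤ gsSeminorm d h φ * (h.1 ^ k * k.factorial * Real.exp (‖x‖ / h.1)) *
          (h.1 ^ n * n.factorial * Real.exp (‖ξ‖ / h.1)) := by
        gcongr
        exact sum_aux hh (norm_nonneg ξ) n
    _ = _ := by ring

theorem norm_iteratedFDeriv_mul_conj_sub_le {d : ℕ} (h : {h : ℝ // 0 < h})
    (f φ : GelfandShilov d) (x y : Rd d) (n : ℕ) :
    ‖iteratedFDeriv ℝ n (fun y : Rd d => f y * (starRingEnd ℂ) (φ (y - x))) y‖ ≤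
      4 * gsSeminorm d h f * gsSeminorm d h φ * ((2 * h.1) ^ n * n.factorial) *
        (Real.exp (-(‖x‖ / (4 * h.1))) * Real.exp (-(1 / (4 * h.1) * ‖y‖))) := by
  have hh := h.2
  have hA0 : 0 ≤ gsSeminorm d h f := apply_nonneg _ _
  have hB0 : 0 ≤ gsSeminorm d h φ := apply_nonneg _ _
  -- Since `‖x‖ + ‖y‖ ≤ 2‖y‖ + 2‖y - x‖`, half of the decay rate pays for decay in `x` and still
  -- leaves decay in `y`, to be integrated.
  have hexp : Real.exp (-(‖y‖ / (2 * h.1))) * Real.exp (-(‖y - x‖ / (2 * h.1))) ≤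
      Real.exp (-(‖x‖ / (4 * h.1))) * Real.exp (-(1 / (4 * h.1) * ‖y‖)) := by
    rw [← Real.exp_add, ← Real.exp_add, Real.exp_le_exp]
    have h1 : ‖x‖ ≤ ‖y‖ + ‖y - x‖ := by
      have := norm_sub_le y (y - x); simpa using this
    have e1 : ‖y‖ / (2 * h.1) = (2 * ‖y‖) / (4 * h.1) := by field_simp; ring
    have e2 : ‖y - x‖ / (2 * h.1) = (2 * ‖y - x‖) / (4 * h.1) := by field_simp; ring
    rw [e1, e2, one_div_mul_eq_div, ← neg_add, ← neg_add, neg_le_neg_iff, ← add_div, ← add_div]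
    refine div_le_div_of_nonneg_right ?_ (by positivity)
    linarith [norm_nonneg (y - x)]
  calc ‖iteratedFDeriv ℝ n (fun y : Rd d => f y * (starRingEnd ℂ) (φ (y - x))) y‖
      ≤ ∑ i ∈ Finset.range (n + 1), (n.choose i : ℝ) * ‖iteratedFDeriv ℝ i f y‖ *
          ‖iteratedFDeriv ℝ (n - i) (fun y : Rd d => (starRingEnd ℂ) (φ (y - x))) y‖ :=
        norm_iteratedFDeriv_mul_le f.2.1 (contDiff_conj_sub φ x) y (by exact_mod_cast le_top)
    _ ≤ ∑ i ∈ Finset.range (n + 1), 4 * gsSeminorm d h f * gsSeminorm d h φ *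
          (h.1 ^ n * n.factorial) *
        (Real.exp (-(‖x‖ / (4 * h.1))) * Real.exp (-(1 / (4 * h.1) * ‖y‖))) := by
        refine Finset.sum_le_sum fun i hi => ?_
        have hi' : i ≤ n := Nat.lt_succ_iff.1 (Finset.mem_range.1 hi)
        rw [norm_iteratedFDeriv_conj_sub]
        have h1 : (n.choose i : ℝ) * i.factorial * (n - i).factorial = n.factorial := by
          exact_mod_cast Nat.choose_mul_factorial_mul_factorial hi'
        have h2 : h.1 ^ n = h.1 ^ i * h.1 ^ (n - i) := by rw [← pow_add]; congr 1; omega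
        calc _ ≤ (n.choose i : ℝ) *
              (2 * gsSeminorm d h f * (h.1 ^ i * i.factorial) * Real.exp (-(‖y‖ / (2 * h.1)))) *
              (2 * gsSeminorm d h φ * (h.1 ^ (n - i) * (n - i).factorial) *
                Real.exp (-(‖y - x‖ / (2 * h.1)))) := by
              gcongr
              · exact norm_iteratedFDeriv_le_exp h f i y
              · exact norm_iteratedFDeriv_le_exp h φ (n - i) (y - x)
          _ = 4 * gsSeminorm d h f * gsSeminorm d h φ * (h.1 ^ n * n.factorial) *
              (Real.exp (-(‖y‖ / (2 * h.1))) * Real.exp (-(‖y - x‖ / (2 * h.1)))) := by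
              rw [← h1, h2]; ring
          _ ≤ _ := by gcongr
    _ ≤ _ := by
        rw [Finset.sum_const, Finset.card_range, nsmul_eq_mul, mul_pow]
        -- The number of Leibniz terms is absorbed by passing from `h` to `2h`.
        have h3 : ((n + 1 : ℕ) : ℝ) ≤ 2 ^ n := by exact_mod_cast Nat.lt_two_pow_self
        calc _ ≤ (2 : ℝ) ^ n * (4 * gsSeminorm d h f * gsSeminorm d h φ *
          (h.1 ^ n * n.factorial) *
        (Real.exp (-(‖x‖ / (4 * h.1))) * Real.exp (-(1 / (4 * h.1) * ‖y‖)))) := by gcongr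
          _ = _ := by ring

/-- The sequence `h^n n!` need not be monotone when `h` is small, but going from `n = m + j` down to
`m` costs at most `(1/h)^j / j!`, which is bounded by `e^{1/h}` uniformly in `m` and `j`. -/
theorem pow_mul_factorial_le_exp {h : ℝ} (hh : 0 < h) {m n : ℕ} (hmn : m ≤ n) :
    h ^ m * m.factorial ≤ Real.exp (1 / h) * (h ^ n * n.factorial) := by
  obtain ⟨j, rfl⟩ := Nat.exists_eq_add_of_le hmn
  have h1 := Real.pow_div_factorial_le_exp (1 / h) (by positivity) j
  have h2 : (m.factorial * j.factorial : ℝ) ≤ (m + j).factorial := by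
    exact_mod_cast Nat.le_of_dvd (Nat.factorial_pos _) (Nat.factorial_mul_factorial_dvd_factorial_add m j)
  calc h ^ m * m.factorial = ((1 / h) ^ j / j.factorial) *
        (h ^ (m + j) * (m.factorial * j.factorial)) := by
        rw [pow_add, one_div, inv_pow]; field_simp
    _ ≤ _ := by gcongr

/-- The integral is the Fourier transform of `y ↦ f(y) conj φ(y - x)` at `ξ/2π`. Bounds for the
derivatives of this product give the decay in `ξ`, and each of them already contains the decay in
`x`. -/
theorem norm_integral_mul_window_le {d : ℕ} (φ : GelfandShilov d) {a : ℝ} (ha : 0 < a) :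
    ∃ (h : {h : ℝ // 0 < h}) (C : ℝ), 0 ≤ C ∧ ∀ (f : GelfandShilov d) (x ξ : Rd d),
      ‖∫ y, f y * φ.window x ξ y‖ ≤
        C * gsSeminorm d h f * (Real.exp (-(a * ‖x‖)) * Real.exp (-(a * ‖ξ‖))) := by
  -- This `h` gives the rate `32a` in `x` and, after the losses below, the rate `1/(2π · 16h) = 4a/π
  -- ≥ a` in `ξ`.
  have hh : 0 < 1 / (128 * a) := by positivity
  set h : {h : ℝ // 0 < h} := ⟨1 / (128 * a), hh⟩ with hdef
  have hB0 : 0 ≤ gsSeminorm d h φ := apply_nonneg _ _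
  set K := ∫ y : Rd d, Real.exp (-(1 / (4 * h.1) * ‖y‖)) with hK
  have hK0 : 0 ≤ K := integral_nonneg fun _ => (Real.exp_pos _).le
  have hKi : Integrable (fun y : Rd d => Real.exp (-(1 / (4 * h.1) * ‖y‖))) :=
    integrable_exp_neg_mul_norm volume (by have := h.2; positivity)
  set C := 2 * (Real.exp (1 / (2 * h.1)) * (4 * gsSeminorm d h φ * K)) with hC
  refine ⟨h, C, by positivity, fun f x ξ => ?_⟩
  have hA0 : 0 ≤ gsSeminorm d h f := apply_nonneg _ _
  set g : Rd d → ℂ := fun y => f y * (starRingEnd ℂ) (φ (y - x)) with hg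
  have hgs : ContDiff ℝ (⊤ : ℕ∞) g := f.2.1.mul (contDiff_conj_sub φ x)
  have hgb : ∀ n y, ‖iteratedFDeriv ℝ n g y‖ ≤ _ :=
    fun n y => norm_iteratedFDeriv_mul_conj_sub_le h f φ x y n
  have hgi : ∀ n : ℕ, Integrable (fun y => ‖iteratedFDeriv ℝ n g y‖) := by
    intro n
    refine ((hKi.const_mul (Real.exp (-(‖x‖ / (4 * h.1))))).const_mul
      (4 * gsSeminorm d h f * gsSeminorm d h φ * ((2 * h.1) ^ n * n.factorial))).mono' ?_ ?_
    · exact (hgs.continuous_iteratedFDeriv (by exact_mod_cast le_top)).norm.aestronglyMeasurable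
    · exact Filter.Eventually.of_forall fun y => by simpa using hgb n y
  have hgI : ∀ n : ℕ, ∫ y, ‖iteratedFDeriv ℝ n g y‖ ≤
      4 * gsSeminorm d h f * gsSeminorm d h φ * ((2 * h.1) ^ n * n.factorial) *
        (Real.exp (-(‖x‖ / (4 * h.1))) * K) := by
    intro n
    rw [hK, ← integral_const_mul, ← integral_const_mul]
    exact integral_mono (hgi n) ((hKi.const_mul _).const_mul _) (hgb n)
  set η : Rd d := (2 * Real.pi)⁻¹ • ξ with hη
  have hF : ∫ y, f y * φ.window x ξ y = FourierTransform.fourier g η := by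
    rw [Real.fourier_eq']
    refine integral_congr_ae (Filter.Eventually.of_forall fun y => ?_)
    simp only [window_apply, hg, smul_eq_mul]
    have : ((-2 * Real.pi * inner ℝ y η : ℝ) : ℂ) * Complex.I = -Complex.I * (inner ℝ ξ y : ℝ) := by
      rw [hη, inner_smul_right, real_inner_comm]
      have : (Real.pi : ℂ) ≠ 0 := by exact_mod_cast Real.pi_ne_zero
      push_cast
      field_simp
    rw [this]; ring
  -- The factor `8^n` collects `2^n` from the product bound, `2^n` from the estimate for Fourier
  -- transforms of derivatives, and `2^n` for the `n + 1` terms of its sum.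
  have key : ∀ n : ℕ, ‖η‖ ^ n * ‖FourierTransform.fourier g η‖ ≤
      (Real.exp (1 / (2 * h.1)) * (4 * gsSeminorm d h f * gsSeminorm d h φ *
        (Real.exp (-(‖x‖ / (4 * h.1))) * K))) * ((8 * h.1) ^ n * n.factorial) := by
    intro n
    have h1 := Real.pow_mul_norm_iteratedFDeriv_fourier_le (K := 0) (N := ⊤) (f := g)
      (by exact_mod_cast hgs) (fun k m hk hm => by
        have hk0 : k = 0 := by simpa using hk
        subst hk0
        simpa using hgi m) (k := 0) (n := n) le_rfl le_top η
    have h3 : ((n + 1 : ℕ) : ℝ) ≤ 2 ^ n := by exact_mod_cast Nat.lt_two_pow_self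
    have hh' := h.2
    rw [norm_iteratedFDeriv_zero] at h1
    refine h1.trans ?_
    rw [Finset.sum_product]
    simp only [zero_add, Finset.range_one, Finset.sum_singleton, pow_zero, one_mul, Nat.cast_zero,
      mul_zero]
    calc (2 : ℝ) ^ n * ∑ m ∈ Finset.range (n + 1), ∫ y, ‖iteratedFDeriv ℝ m g y‖
        ≤ (2 : ℝ) ^ n * ∑ m ∈ Finset.range (n + 1),
          4 * gsSeminorm d h f * gsSeminorm d h φ *
            (Real.exp (1 / (2 * h.1)) * ((2 * h.1) ^ n * n.factorial)) *
            (Real.exp (-(‖x‖ / (4 * h.1))) * K) := by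
          gcongr with m hm
          refine (hgI m).trans ?_
          refine mul_le_mul_of_nonneg_right (mul_le_mul_of_nonneg_left
            (pow_mul_factorial_le_exp (by positivity) (Nat.lt_succ_iff.1 (Finset.mem_range.1 hm)))
            (by positivity)) (by positivity)
      _ ≤ (2 : ℝ) ^ n * (2 ^ n * (4 * gsSeminorm d h f * gsSeminorm d h φ *
            (Real.exp (1 / (2 * h.1)) * ((2 * h.1) ^ n * n.factorial)) *
            (Real.exp (-(‖x‖ / (4 * h.1))) * K))) := by
          rw [Finset.sum_const, Finset.card_range, nsmul_eq_mul]
          gcongr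
      _ = _ := by
          have : (8 * h.1) ^ n = 2 ^ n * 2 ^ n * (2 * h.1) ^ n := by
            rw [← mul_pow, ← mul_pow]; congr 1; ring
          rw [this]; ring
  have h4 := mul_exp_le_of_pow_mul_le (by have := h.2; positivity) key
  rw [hF]
  have h5 : Real.exp (a * ‖ξ‖) ≤ Real.exp (‖η‖ / (2 * (8 * h.1))) := by
    rw [Real.exp_le_exp, hη, norm_smul, hdef]
    have hpi := Real.pi_pos
    rw [norm_inv, Real.norm_of_nonneg (by positivity)]
    have : (2 * Real.pi)⁻¹ * ‖ξ‖ / (2 * (8 * (1 / (128 * a)))) = (4 / Real.pi) * (a * ‖ξ‖) := by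
      field_simp; ring
    rw [this]
    have : 1 ≤ 4 / Real.pi := by rw [one_le_div hpi]; exact Real.pi_le_four
    exact le_mul_of_one_le_left (by positivity) this
  have h6 : Real.exp (-(‖x‖ / (4 * h.1))) ≤ Real.exp (-(a * ‖x‖)) := by
    rw [Real.exp_le_exp, hdef, neg_le_neg_iff]
    have : ‖x‖ / (4 * (1 / (128 * a))) = 32 * (a * ‖x‖) := by field_simp; ring
    rw [this]
    have : 0 ≤ a * ‖x‖ := by positivity
    linarith
  rw [Real.exp_neg (a * ‖ξ‖), ← mul_assoc, ← div_eq_mul_inv, le_div_iff₀ (Real.exp_pos _)]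
  calc ‖FourierTransform.fourier g η‖ * Real.exp (a * ‖ξ‖)
      ≤ ‖FourierTransform.fourier g η‖ * Real.exp (‖η‖ / (2 * (8 * h.1))) := by gcongr
    _ ≤ _ := h4
    _ ≤ 2 * (Real.exp (1 / (2 * h.1)) * (4 * gsSeminorm d h f * gsSeminorm d h φ *
        (Real.exp (-(a * ‖x‖)) * K))) := by gcongr
    _ = _ := by rw [hC]; ring

end GelfandShilov


instance instIsAddHaarMeasureVolumeProdRd {d : ℕ} :
    (volume : Measure (Rd d × Rd d)).IsAddHaarMeasure :=
  inferInstanceAs ((volume : Measure (Rd d)).prod (volume : Measure (Rd d))).IsAddHaarMeasure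

namespace GelfandShilov

@[ext] theorem ext {d : ℕ} {f g : GelfandShilov d} (h : ∀ x, f x = g x) : f = g :=
  Subtype.ext (funext h)

theorem continuous {d : ℕ} (f : GelfandShilov d) : Continuous (fun x => f x) := f.2.1.continuous

theorem norm_iteratedFDeriv_le {d : ℕ} (h : {h : ℝ // 0 < h}) (f : GelfandShilov d) (n : ℕ)
    (x : Rd d) : ‖iteratedFDeriv ℝ n f x‖ ≤ gsSeminorm d h f * (h.1 ^ n * n.factorial) := by
  simpa using bound h f 0 n x

/-! ### Superpositions -/

theorem exists_hasFDerivAt_integral {V G : Type*} [NormedAddCommGroup V] [NormedSpace ℝ V]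
    [NormedAddCommGroup G] [NormedSpace ℝ G] [CompleteSpace G]
    {α : Type*} [MeasurableSpace α] {μ : Measure α} {Φ : α → V → G} {B : α → ℝ} {x : V}
    (hΦ : ∀ a, Differentiable ℝ (Φ a)) (hm : ∀ x, AEStronglyMeasurable (fun a => Φ a x) μ)
    (hi : Integrable (fun a => Φ a x) μ)
    (hm' : AEStronglyMeasurable (fun a => fderiv ℝ (Φ a) x) μ)
    (hB : ∀ a x, ‖fderiv ℝ (Φ a) x‖ ≤ B a) (hBi : Integrable B μ) :
    ∃ L : V →L[ℝ] G, HasFDerivAt (fun x => ∫ a, Φ a x ∂μ) L x ∧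
      ∀ v, Integrable (fun a => fderiv ℝ (Φ a) x v) μ ∧ L v = ∫ a, fderiv ℝ (Φ a) x v ∂μ := by
  have hF'i : Integrable (fun a => fderiv ℝ (Φ a) x) μ :=
    hBi.mono' hm' (Filter.Eventually.of_forall fun a => hB a x)
  refine ⟨∫ a, fderiv ℝ (Φ a) x ∂μ, ?_, fun v =>
    ⟨hF'i.apply_continuousLinearMap v, ContinuousLinearMap.integral_apply hF'i v⟩⟩
  exact hasFDerivAt_integral_of_dominated_of_fderiv_le
    (F := fun x a => Φ a x) Filter.univ_mem
    (Filter.Eventually.of_forall hm) hi hm'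
    (Filter.Eventually.of_forall fun a x _ => hB a x) hBi
    (Filter.Eventually.of_forall fun a x _ => (hΦ a x).hasFDerivAt)

theorem hasFDerivAt_integral_iteratedFDeriv {V : Type*} [NormedAddCommGroup V] [NormedSpace ℝ V]
    {α : Type*} [MeasurableSpace α] {μ : Measure α} {Φ : α → V → ℂ}
    (hΦ : ∀ a, ContDiff ℝ (⊤ : ℕ∞) (Φ a))
    (hm : ∀ n x, AEStronglyMeasurable (fun a => iteratedFDeriv ℝ n (Φ a) x) μ)
    {B : ℕ → α → ℝ} (hBi : ∀ n, Integrable (B n) μ)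
    (hB : ∀ n a x, ‖iteratedFDeriv ℝ n (Φ a) x‖ ≤ B n a) (n : ℕ) (x : V) :
    HasFDerivAt (fun x => ∫ a, iteratedFDeriv ℝ n (Φ a) x ∂μ)
      (∫ a, iteratedFDeriv ℝ (n + 1) (Φ a) x ∂μ).curryLeft x := by
  have hint : ∀ n x, Integrable (fun a => iteratedFDeriv ℝ n (Φ a) x) μ := fun n x =>
    (hBi n).mono' (hm n x) (Filter.Eventually.of_forall fun a => hB n a x)
  have hF' : ∀ x a, fderiv ℝ (iteratedFDeriv ℝ n (Φ a)) x
      = (iteratedFDeriv ℝ (n + 1) (Φ a) x).curryLeft := by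
    intro x a
    rw [fderiv_iteratedFDeriv]; rfl
  have hF'm : ∀ x, AEStronglyMeasurable (fun a => fderiv ℝ (iteratedFDeriv ℝ n (Φ a)) x) μ := by
    intro x
    simp only [hF']
    exact (continuousMultilinearCurryLeftEquiv ℝ (fun _ : Fin (n + 1) => V)
      ℂ).continuous.comp_aestronglyMeasurable (hm (n + 1) x)
  have hF'b : ∀ x a, ‖fderiv ℝ (iteratedFDeriv ℝ n (Φ a)) x‖ ≤ B (n + 1) a := by
    intro x a
    rw [norm_fderiv_iteratedFDeriv]
    exact hB (n + 1) a x
  obtain ⟨L, hL, hLv⟩ := exists_hasFDerivAt_integral (Φ := fun a => iteratedFDeriv ℝ n (Φ a)) (x := x)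
    (fun a => (hΦ a).differentiable_iteratedFDeriv (by exact_mod_cast ENat.natCast_lt_top n))
    (hm n) (hint n x) (hF'm x) (fun a x => hF'b x a) (hBi (n + 1))
  have h1 : (∫ a, iteratedFDeriv ℝ (n + 1) (Φ a) x ∂μ).curryLeft = L := by
    ext v m
    obtain ⟨hi, hLv⟩ := hLv v
    rw [ContinuousMultilinearMap.curryLeft_apply,
      ContinuousMultilinearMap.integral_apply (hint (n + 1) x), hLv,
      ContinuousMultilinearMap.integral_apply hi]
    refine integral_congr_ae (Filter.Eventually.of_forall fun a => ?_)
    simp only [hF', ContinuousMultilinearMap.curryLeft_apply]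
  rw [h1]
  exact hL

/-- The integrals of the iterated derivatives form a Taylor series of the integral; majorants that
are uniform in `x` allow differentiation under the integral sign at every order. -/
theorem contDiff_integral {V : Type*} [NormedAddCommGroup V] [NormedSpace ℝ V]
    {α : Type*} [MeasurableSpace α] {μ : Measure α} {Φ : α → V → ℂ}
    (hΦ : ∀ a, ContDiff ℝ (⊤ : ℕ∞) (Φ a))
    (hm : ∀ n x, AEStronglyMeasurable (fun a => iteratedFDeriv ℝ n (Φ a) x) μ)
    {B : ℕ → α → ℝ} (hBi : ∀ n, Integrable (B n) μ)
    (hB : ∀ n a x, ‖iteratedFDeriv ℝ n (Φ a) x‖ ≤ B n a) :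
    ContDiff ℝ (⊤ : ℕ∞) (fun x => ∫ a, Φ a x ∂μ) ∧ ∀ n x,
      iteratedFDeriv ℝ n (fun x => ∫ a, Φ a x ∂μ) x = ∫ a, iteratedFDeriv ℝ n (Φ a) x ∂μ := by
  have hD := hasFDerivAt_integral_iteratedFDeriv hΦ hm hBi hB
  have hT : HasFTaylorSeriesUpTo (⊤ : ℕ∞) (fun x => ∫ a, Φ a x ∂μ)
      (fun x n => ∫ a, iteratedFDeriv ℝ n (Φ a) x ∂μ) := by
    refine ⟨fun x => ?_, fun n _ x => hD n x, fun n _ => ?_⟩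
    · rw [ContinuousMultilinearMap.curry0_apply, ContinuousMultilinearMap.integral_apply
        ((hBi 0).mono' (hm 0 x) (Filter.Eventually.of_forall fun a => hB 0 a x))]
      simp
    · exact continuous_iff_continuousAt.2 fun x => (hD n x).continuousAt
  exact ⟨hT.contDiff, fun n x => (hT.eq_iteratedFDeriv (by exact_mod_cast le_top) x).symm⟩

/-- Superpositions are formed pointwise and then shown to lie in `Σ₁`, so no vector-valued integral
in `Σ₁` is required. The seminorm bound is part of the conclusion because it turns the inversion
formula into an estimate of the topology. -/
theorem exists_eq_integral {d : ℕ} {α : Type*} [MeasurableSpace α] {μ : Measure α}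
    {H : α → ℂ} {Φ : α → GelfandShilov d}
    (hm : ∀ n x, AEStronglyMeasurable (fun a => H a • iteratedFDeriv ℝ n (Φ a) x) μ)
    (hB : ∀ h : {h : ℝ // 0 < h}, ∃ B : α → ℝ, Integrable B μ ∧
      ∀ a, ‖H a‖ * gsSeminorm d h (Φ a) ≤ B a) :
    ∃ ψ : GelfandShilov d, (∀ x, ψ x = ∫ a, H a * Φ a x ∂μ) ∧
      ∀ (h : {h : ℝ // 0 < h}) (B : α → ℝ), Integrable B μ →
        (∀ a, ‖H a‖ * gsSeminorm d h (Φ a) ≤ B a) → gsSeminorm d h ψ ≤ ∫ a, B a ∂μ := by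
  -- The parameter `h = 1` alone majorizes all derivatives uniformly in `x`, which suffices for
  -- smoothness; the other parameters enter only in the final bounds.
  obtain ⟨B₁, hB₁i, hB₁⟩ := hB ⟨1, one_pos⟩
  have hsm : ∀ n a x, iteratedFDeriv ℝ n (fun x => H a * Φ a x) x
      = H a • iteratedFDeriv ℝ n (Φ a) x := fun n a x =>
    iteratedFDeriv_const_smul_apply (f := (Φ a : Rd d → ℂ)) (a := H a)
      ((Φ a).2.1.contDiffAt.of_le (by exact_mod_cast le_top))
  have hle : ∀ n a x, ‖H a • iteratedFDeriv ℝ n (Φ a) x‖ ≤ B₁ a * n.factorial := by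
    intro n a x
    rw [norm_smul]
    calc _ ≤ ‖H a‖ * (gsSeminorm d ⟨1, one_pos⟩ (Φ a) * (1 ^ n * n.factorial)) := by
          gcongr; exact norm_iteratedFDeriv_le ⟨1, one_pos⟩ _ n x
      _ = (‖H a‖ * gsSeminorm d ⟨1, one_pos⟩ (Φ a)) * n.factorial := by ring
      _ ≤ _ := by gcongr; exact hB₁ a
  have hint : ∀ n x, Integrable (fun a => H a • iteratedFDeriv ℝ n (Φ a) x) μ := fun n x =>
    (hB₁i.mul_const _).mono' (hm n x) (Filter.Eventually.of_forall fun a => hle n a x)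
  set F : Rd d → ℂ := fun x => ∫ a, H a * Φ a x ∂μ with hF
  obtain ⟨hFs, hI⟩ : ContDiff ℝ (⊤ : ℕ∞) F ∧ ∀ n x,
      iteratedFDeriv ℝ n F x = ∫ a, H a • iteratedFDeriv ℝ n (Φ a) x ∂μ := by
    have := contDiff_integral (Φ := fun a x => H a * Φ a x) (μ := μ)
      (B := fun n a => B₁ a * n.factorial) (fun a => contDiff_const.mul (Φ a).2.1)
      (fun n x => by simpa only [hsm] using hm n x) (fun n => hB₁i.mul_const _)
      (fun n a x => by simpa only [hsm] using hle n a x)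
    simpa only [hsm] using this
  have hest : ∀ (h : {h : ℝ // 0 < h}) (B : α → ℝ), Integrable B μ →
      (∀ a, ‖H a‖ * gsSeminorm d h (Φ a) ≤ B a) → ∀ (k n : ℕ) (x : Rd d),
      ‖x‖ ^ k * ‖iteratedFDeriv ℝ n F x‖ ≤
        (∫ a, B a ∂μ) * (h.1 ^ (k + n) * (k.factorial * n.factorial)) := by
    intro h B hBi hB k n x
    have hh := h.2
    rw [hI, ← integral_mul_const]
    calc ‖x‖ ^ k * ‖∫ a, H a • iteratedFDeriv ℝ n (Φ a) x ∂μ‖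
        ≤ ‖x‖ ^ k * ∫ a, ‖H a • iteratedFDeriv ℝ n (Φ a) x‖ ∂μ := by
          gcongr; exact norm_integral_le_integral_norm _
      _ = ∫ a, ‖x‖ ^ k * ‖H a • iteratedFDeriv ℝ n (Φ a) x‖ ∂μ := by rw [integral_const_mul]
      _ ≤ _ := by
          refine integral_mono ((hint n x).norm.const_mul _) (hBi.mul_const _) fun a => ?_
          simp only [norm_smul]
          calc _ = ‖H a‖ * (‖x‖ ^ k * ‖iteratedFDeriv ℝ n (Φ a) x‖) := by ring
            _ ≤ ‖H a‖ * (gsSeminorm d h (Φ a) * (h.1 ^ (k + n) * (k.factorial * n.factorial))) := by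
                exact mul_le_mul_of_nonneg_left (bound h (Φ a) k n x) (norm_nonneg _)
            _ = (‖H a‖ * gsSeminorm d h (Φ a)) *
                  (h.1 ^ (k + n) * (k.factorial * n.factorial)) := by ring
            _ ≤ _ := by gcongr; exact hB a
  have hmem : IsGelfandShilov F := by
    refine ⟨hFs, fun h hh => ?_⟩
    · obtain ⟨B, hBi, hB'⟩ := hB ⟨h, hh⟩
      exact ⟨_, fun k n x => hest ⟨h, hh⟩ B hBi hB' k n x⟩
  exact ⟨⟨F, hmem⟩, fun x => rfl, fun h B hBi hB' => gsSeminorm_le h _ (hest h B hBi hB')⟩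

/-- The window is a section of one smooth function `U` of `(z, y)`, so its derivatives in `y` are
those of `U` along the inclusion of the last variable. Supplies the measurability needed for
superpositions of windows. -/
theorem continuous_iteratedFDeriv_window {d : ℕ} (φ : GelfandShilov d) (n : ℕ) (y : Rd d) :
    Continuous (fun z : Rd d × Rd d => iteratedFDeriv ℝ n (φ.window z.1 z.2) y) := by
  set U : (Rd d × Rd d) × Rd d → ℂ := fun w => (starRingEnd ℂ) (φ (w.2 - w.1.1)) *
    Complex.exp (-Complex.I * (inner ℝ w.1.2 w.2 : ℝ)) with hU
  have hUs : ContDiff ℝ (⊤ : ℕ∞) U := by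
    refine (Complex.conjLIE.contDiff.comp (φ.2.1.comp
      (contDiff_snd.sub (contDiff_fst.comp contDiff_fst)))).mul
      (contDiff_const.mul (Complex.ofRealCLM.contDiff.comp ?_)).cexp
    exact (contDiff_snd.comp contDiff_fst).inner ℝ contDiff_snd
  let e : Rd d →L[ℝ] (Rd d × Rd d) × Rd d := ContinuousLinearMap.inr ℝ (Rd d × Rd d) (Rd d)
  have key : ∀ z : Rd d × Rd d, iteratedFDeriv ℝ n (φ.window z.1 z.2) y =
      (iteratedFDeriv ℝ n U (z, y)).compContinuousLinearMap (fun _ => e) := by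
    intro z
    have e1 : (φ.window z.1 z.2 : Rd d → ℂ) = (fun w => U ((z, 0) + w)) ∘ e := by
      ext y; simp [e, hU, window_apply]
    have h2 : ContDiff ℝ (⊤ : ℕ∞) (fun w => U ((z, 0) + w)) :=
      hUs.comp (contDiff_const.add contDiff_id)
    rw [e1, e.iteratedFDeriv_comp_right h2 y (by exact_mod_cast le_top),
      iteratedFDeriv_comp_add_left]
    simp [e]
  simp_rw [key]
  have h3 : Continuous (fun z : Rd d × Rd d => iteratedFDeriv ℝ n U (z, y)) :=
    (hUs.continuous_iteratedFDeriv (by exact_mod_cast le_top)).comp (by fun_prop)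
  exact (ContinuousMultilinearMap.compContinuousLinearMapL (𝕜 := ℝ) (F := ℂ)
    (fun _ : Fin n => e)).continuous.comp h3

theorem continuous_window_apply {d : ℕ} (φ : GelfandShilov d) :
    Continuous (fun w : (Rd d × Rd d) × Rd d => φ.window w.1.1 w.1.2 w.2) := by
  simp only [window_apply]
  have := φ.continuous
  fun_prop

theorem norm_window_apply_le {d : ℕ} (φ : GelfandShilov d) (x ξ y : Rd d) :
    ‖φ.window x ξ y‖ ≤ gsSeminorm d ⟨1, one_pos⟩ φ := by
  rw [norm_window_apply]; exact norm_le _ _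

theorem continuous_integral_mul_window {d : ℕ} (φ : GelfandShilov d) {f : Rd d → ℂ}
    (hf : Integrable f) :
    Continuous (fun z : Rd d × Rd d => ∫ y, f y * φ.window z.1 z.2 y) := by
  refine continuous_of_dominated (bound := fun y => ‖f y‖ * gsSeminorm d ⟨1, one_pos⟩ φ)
    (fun z => hf.1.mul (φ.window z.1 z.2).continuous.aestronglyMeasurable)
    (fun z => Filter.Eventually.of_forall fun y => ?_) (hf.norm.mul_const _)
    (Filter.Eventually.of_forall fun y => ?_)
  · rw [norm_mul]; gcongr; exact norm_window_apply_le _ _ _ _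
  · exact continuous_const.mul (φ.continuous_window_apply.comp (f := fun z => (z, y)) (by fun_prop))

theorem norm_integral_mul_window_le_exp {d : ℕ} (φ : GelfandShilov d) {a : ℝ} (ha : 0 < a) :
    ∃ (h : {h : ℝ // 0 < h}) (C : ℝ), 0 ≤ C ∧ ∀ (f : GelfandShilov d) (z : Rd d × Rd d),
      ‖∫ y, f y * φ.window z.1 z.2 y‖ ≤ C * gsSeminorm d h f * Real.exp (-(a * ‖z‖)) := by
  obtain ⟨h, C, hC, H⟩ := norm_integral_mul_window_le φ ha
  refine ⟨h, C, hC, fun f z => (H f z.1 z.2).trans ?_⟩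
  have hf : 0 ≤ gsSeminorm d h f := apply_nonneg _ _
  gcongr
  rw [← Real.exp_add, Real.exp_le_exp, ← neg_add, ← mul_add, neg_le_neg_iff]
  gcongr
  rw [Prod.norm_def]
  exact max_le (le_add_of_nonneg_right (norm_nonneg _)) (le_add_of_nonneg_left (norm_nonneg _))

/-! ### Atoms and the inversion formula -/

noncomputable def conj {d : ℕ} (φ : GelfandShilov d) : GelfandShilov d :=
  ⟨fun y => (starRingEnd ℂ) (φ y), by
    have := window_mem φ 0 0
    simp only [sub_zero, inner_zero_left, Complex.ofReal_zero, mul_zero, Complex.exp_zero,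
      mul_one] at this
    exact this⟩

theorem conj_apply {d : ℕ} (φ : GelfandShilov d) (y : Rd d) :
    conj φ y = (starRingEnd ℂ) (φ y) := rfl

/-- The time-frequency shift `y ↦ φ(y - x) e^{i⟨y, ξ⟩}` at `z = (x, ξ)`. -/
noncomputable def atom {d : ℕ} (φ : GelfandShilov d) (z : Rd d × Rd d) : GelfandShilov d :=
  (conj φ).window z.1 (-z.2)

theorem atom_apply {d : ℕ} (φ : GelfandShilov d) (z : Rd d × Rd d) (y : Rd d) :
    atom φ z y = φ (y - z.1) * Complex.exp (Complex.I * (inner ℝ z.2 y : ℝ)) := by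
  simp [atom, window_apply, conj_apply]

theorem norm_atom_apply_le {d : ℕ} (φ : GelfandShilov d) (z : Rd d × Rd d) (y : Rd d) :
    ‖atom φ z y‖ ≤ gsSeminorm d ⟨1, one_pos⟩ (conj φ) := norm_window_apply_le _ _ _ _

theorem continuous_atom_apply {d : ℕ} (φ : GelfandShilov d) :
    Continuous (fun w : (Rd d × Rd d) × Rd d => atom φ w.1 w.2) := by
  simp only [atom_apply]
  have := φ.continuous
  fun_prop

theorem continuous_integral_mul_atom {d : ℕ} (φ : GelfandShilov d) {f : Rd d → ℂ}
    (hf : Integrable f) : Continuous (fun z : Rd d × Rd d => ∫ y, f y * atom φ z y) :=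
  (continuous_integral_mul_window (conj φ) hf).comp
    (g := fun z => ∫ y, f y * (conj φ).window z.1 z.2 y)
    (f := fun z : Rd d × Rd d => (z.1, -z.2)) (by fun_prop)

theorem norm_integral_mul_atom_le_exp {d : ℕ} (φ : GelfandShilov d) {a : ℝ} (ha : 0 < a) :
    ∃ (h : {h : ℝ // 0 < h}) (C : ℝ), 0 ≤ C ∧ ∀ (f : GelfandShilov d) (z : Rd d × Rd d),
      ‖∫ y, f y * atom φ z y‖ ≤ C * gsSeminorm d h f * Real.exp (-(a * ‖z‖)) := by
  obtain ⟨h, C, hC, H⟩ := norm_integral_mul_window_le_exp (conj φ) ha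
  refine ⟨h, C, hC, fun f z => ?_⟩
  have := H f (z.1, -z.2)
  simp only [Prod.norm_def, norm_neg] at this ⊢
  exact this

/-- Covariance: a translation of the variable moves the shift `z` to the other factor and leaves a
phase. The modulus of the overlap thus depends only on `w - z`, so decay of transforms becomes
off-diagonal decay of the kernel. -/
theorem integral_atom_mul_window {d : ℕ} (φ θ : GelfandShilov d) (z w : Rd d × Rd d) :
    ∫ y, atom φ z y * θ.window w.1 w.2 y =
      Complex.exp (Complex.I * (inner ℝ (z.2 - w.2) z.1 : ℝ)) *
        ∫ y, φ y * θ.window (w.1 - z.1) (w.2 - z.2) y := by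
  rw [← integral_add_right_eq_self _ z.1, ← integral_const_mul]
  refine integral_congr_ae (Filter.Eventually.of_forall fun y => ?_)
  simp only [atom_apply, window_apply, add_sub_cancel_right]
  have e1 : y + z.1 - w.1 = y - (w.1 - z.1) := by abel
  rw [e1]
  have e2 : Complex.exp (Complex.I * (inner ℝ z.2 (y + z.1) : ℝ)) *
      Complex.exp (-Complex.I * (inner ℝ w.2 (y + z.1) : ℝ)) =
      Complex.exp (Complex.I * (inner ℝ (z.2 - w.2) z.1 : ℝ)) *
      Complex.exp (-Complex.I * (inner ℝ (w.2 - z.2) y : ℝ)) := by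
    rw [← Complex.exp_add, ← Complex.exp_add]
    congr 1
    simp only [inner_add_right, inner_sub_left]
    push_cast
    ring
  linear_combination (φ y * (starRingEnd ℂ) (θ (y - (w.1 - z.1)))) * e2

theorem norm_integral_atom_mul_window_le {d : ℕ} (φ θ : GelfandShilov d) {a : ℝ} (ha : 0 < a) :
    ∃ C : ℝ, 0 ≤ C ∧ ∀ z w : Rd d × Rd d,
      ‖∫ y, atom φ z y * θ.window w.1 w.2 y‖ ≤ C * Real.exp (-(a * ‖z - w‖)) := by
  obtain ⟨h, C, hC, H⟩ := norm_integral_mul_window_le_exp θ ha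
  refine ⟨C * gsSeminorm d h φ, by positivity, fun z w => ?_⟩
  rw [integral_atom_mul_window, norm_mul, Complex.norm_exp]
  have := H φ (w - z)
  rw [norm_sub_rev w z] at this
  simpa using this

theorem integral_norm_sq_pos {d : ℕ} {φ : GelfandShilov d} (hφ : φ ≠ 0) :
    0 < ∫ y, ‖φ y‖ ^ 2 := by
  have hc : Continuous (fun y => ‖φ y‖ ^ 2) := by have := φ.continuous; fun_prop
  have hi : Integrable (fun y => ‖φ y‖ ^ 2) := by
    have := (φ.integrable_mul φ).norm
    simpa [sq] using this
  refine lt_of_le_of_ne (integral_nonneg fun _ => by positivity) fun h => hφ ?_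
  have h1 := (integral_eq_zero_iff_of_nonneg (fun y => by positivity) hi).1 h.symm
  have h2 := (hc.ae_eq_iff_eq volume (continuous_zero (X := Rd d) (M := ℝ))).1 h1
  ext y
  have h3 : ‖φ y‖ ^ 2 = 0 := congrFun h2 y
  exact norm_eq_zero.1 (by simpa using h3)

/-- For a fixed position `t`, Fourier inversion for `y ↦ ψ(y) φ(y - t)` evaluates the integral over
frequencies as `(2π)^d ψ(x) |φ(x - t)|²`; integrating in `t` leaves `(2π)^d ‖φ‖² ψ(x)`, with the
`L²` norm. -/
theorem inversion {d : ℕ} {φ : GelfandShilov d} (hφ : φ ≠ 0) : ∃ c : ℝ, 0 < c ∧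
    ∀ (ψ : GelfandShilov d) (x : Rd d),
      ψ x = c * ∫ z : Rd d × Rd d, (∫ y, ψ y * atom φ z y) * φ.window z.1 z.2 x := by
  have hpos := integral_norm_sq_pos hφ
  set N := ∫ y, ‖φ y‖ ^ 2 with hN
  have hpi := Real.pi_pos
  refine ⟨((2 * Real.pi) ^ d * N)⁻¹, by positivity, fun ψ x => ?_⟩
  obtain ⟨h, C, hC, H⟩ := norm_integral_mul_atom_le_exp φ one_pos
  have hVc : Continuous (fun z : Rd d × Rd d => ∫ y, ψ y * atom φ z y) :=
    continuous_integral_mul_atom φ ψ.integrable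
  have hint : Integrable (fun z : Rd d × Rd d => (∫ y, ψ y * atom φ z y) * φ.window z.1 z.2 x) := by
    refine (((integrable_exp_neg_mul_norm (volume : Measure (Rd d × Rd d)) one_pos).const_mul
      (C * gsSeminorm d h ψ)).mul_const (gsSeminorm d ⟨1, one_pos⟩ φ)).mono' ?_ ?_
    · exact (hVc.mul (φ.continuous_window_apply.comp (f := fun z => (z, x))
        (by fun_prop))).aestronglyMeasurable
    · refine Filter.Eventually.of_forall fun z => ?_
      rw [norm_mul]
      gcongr
      · exact H ψ z
      · exact norm_window_apply_le _ _ _ _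
  have hprod := integral_prod _ hint
  rw [Measure.volume_eq_prod, hprod]
  have hinner : ∀ t : Rd d, ∫ ξ : Rd d, (∫ y, ψ y * atom φ (t, ξ) y) * φ.window t ξ x =
      (2 * Real.pi) ^ d * ψ x * (‖φ (x - t)‖ ^ 2 : ℝ) := by
    intro t
    set g : Rd d → ℂ := fun y => ψ y * φ (y - t) with hg
    have hgi : Integrable g := by
      have hc : Continuous (fun y => φ (y - t)) := φ.continuous.comp (by fun_prop)
      exact ψ.integrable.mul_bdd (c := gsSeminorm d ⟨1, one_pos⟩ φ) hc.aestronglyMeasurable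
        (Filter.Eventually.of_forall fun y => φ.norm_le _)
    have hgc : Continuous g := ψ.continuous.mul (φ.continuous.comp (by fun_prop))
    have hF : ∀ η : Rd d, FourierTransformInv.fourierInv g η
        = ∫ y, ψ y * atom φ (t, (2 * Real.pi) • η) y := by
      intro η
      rw [Real.fourierInv_eq']
      refine integral_congr_ae (Filter.Eventually.of_forall fun y => ?_)
      simp only [atom_apply, hg, smul_eq_mul, inner_smul_left, real_inner_comm y η]
      have : ((2 * Real.pi * inner ℝ y η : ℝ) : ℂ) * Complex.I =
        Complex.I * (((starRingEnd ℝ) (2 * Real.pi) * inner ℝ y η : ℝ) : ℂ) := by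
        simp; ring
      rw [this]; ring
    have hFi : Integrable (FourierTransformInv.fourierInv g) := by
      have h1 : Integrable (fun ξ : Rd d => ∫ y, ψ y * atom φ (t, ξ) y) := by
        refine (((integrable_exp_neg_mul_norm (volume : Measure (Rd d)) one_pos).const_mul
          (C * gsSeminorm d h ψ))).mono'
          (hVc.comp (f := fun ξ => (t, ξ)) (by fun_prop)).aestronglyMeasurable ?_
        refine Filter.Eventually.of_forall fun ξ => (H ψ (t, ξ)).trans ?_
        have hf : 0 ≤ gsSeminorm d h ψ := apply_nonneg _ _
        gcongr
        exact norm_snd_le (t, ξ)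
      have h2 := h1.comp_smul (R := 2 * Real.pi) (by positivity)
      exact h2.congr (Filter.Eventually.of_forall fun η => (hF η).symm)
    -- Together with the continuity of `g`, this makes Fourier inversion valid at every point `x`,
    -- not just almost everywhere.
    have hFi' : Integrable (FourierTransform.fourier g) := by
      refine hFi.comp_neg.congr (Filter.Eventually.of_forall fun η => ?_)
      simp only [Real.fourierInv_eq_fourier_neg, neg_neg]
    have hinv := congrFun (hgc.fourier_fourierInv_eq hgi hFi') x
    rw [Real.fourier_eq'] at hinv
    have hR : (2 * Real.pi) ≠ 0 := by positivity
    -- The substitution `ξ = 2πη` matches the two normalizations of the Fourier transform and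
    -- produces `(2π)^d`.
    have hsub := Measure.integral_comp_smul (volume : Measure (Rd d))
      (fun ξ : Rd d => (∫ y, ψ y * atom φ (t, ξ) y) * φ.window t ξ x) (2 * Real.pi)
    rw [finrank_euclideanSpace_fin, abs_of_pos (by positivity)] at hsub
    have h3 : ∫ η : Rd d, (∫ y, ψ y * atom φ (t, (2 * Real.pi) • η) y) *
        φ.window t ((2 * Real.pi) • η) x = (starRingEnd ℂ) (φ (x - t)) * g x := by
      rw [← hinv, ← integral_const_mul]
      refine integral_congr_ae (Filter.Eventually.of_forall fun η => ?_)
      simp only [hF, window_apply, smul_eq_mul, inner_smul_left]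
      have : ((-2 * Real.pi * inner ℝ η x : ℝ) : ℂ) * Complex.I =
        -Complex.I * (((starRingEnd ℝ) (2 * Real.pi) * inner ℝ η x : ℝ) : ℂ) := by
        simp; ring
      rw [this]; ring
    have h4 : (fun ξ : Rd d => (∫ y, ψ y * atom φ (t, ξ) y) * φ.window t ξ x) =
      (fun ξ : Rd d => (∫ y, ψ y * atom φ (t, ξ) y) * φ.window t ξ x) := rfl
    rw [h3] at hsub
    have h5 : ∫ ξ : Rd d, (∫ y, ψ y * atom φ (t, ξ) y) * φ.window t ξ x =
        (2 * Real.pi) ^ d * ((starRingEnd ℂ) (φ (x - t)) * g x) := by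
      rw [hsub, Complex.real_smul]
      have : (2 * (Real.pi : ℂ)) ^ d ≠ 0 := by exact_mod_cast (pow_ne_zero d hR)
      push_cast
      rw [← mul_assoc, mul_inv_cancel₀ this, one_mul]
    rw [h5, hg]
    have h6 : (starRingEnd ℂ) (φ (x - t)) * φ (x - t) = ((‖φ (x - t)‖ ^ 2 : ℝ) : ℂ) := by
      rw [← Complex.normSq_eq_conj_mul_self, Complex.normSq_eq_norm_sq]
    linear_combination ((2 * Real.pi) ^ d * ψ x) * h6
  simp only [hinner]
  rw [integral_const_mul, integral_complex_ofReal, integral_sub_left_eq_self (fun y => ‖φ y‖ ^ 2)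
    volume x, ← hN]
  have h7 : (N : ℂ) ≠ 0 := by exact_mod_cast hpos.ne'
  have h8 : (Real.pi : ℂ) ≠ 0 := by exact_mod_cast Real.pi_ne_zero
  push_cast
  field_simp

end GelfandShilov


/-! ### Representation of distributions -/

/-- The bound makes `f` factor through the range of `Λ` by a bounded functional, which the
Hahn–Banach theorem extends to `𝓗` and the Riesz theorem represents. -/
theorem exists_eq_inner_of_norm_le {W 𝓗 : Type*} [AddCommGroup W] [Module ℂ W]
    [NormedAddCommGroup 𝓗] [InnerProductSpace ℂ 𝓗] [CompleteSpace 𝓗] (Λ : W →ₗ[ℂ] 𝓗)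
    (f : W →ₗ[ℂ] ℂ) (K : ℝ) (h : ∀ w, ‖f w‖ ≤ K * ‖Λ w‖) :
    ∃ g : 𝓗, ∀ w, f w = inner ℂ g (Λ w) := by
  have hker : LinearMap.ker Λ ≤ LinearMap.ker f := by
    intro w hw
    have h1 := h w
    rw [LinearMap.mem_ker.1 hw, norm_zero, mul_zero] at h1
    exact LinearMap.mem_ker.2 (norm_le_zero_iff.1 h1)
  let g0 : LinearMap.range Λ →ₗ[ℂ] ℂ :=
    ((LinearMap.ker Λ).liftQ f hker).comp Λ.quotKerEquivRange.symm.toLinearMap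
  have hg0 : ∀ w, g0 ⟨Λ w, LinearMap.mem_range_self Λ w⟩ = f w := by
    intro w
    have : Λ.quotKerEquivRange.symm ⟨Λ w, LinearMap.mem_range_self Λ w⟩
        = Submodule.Quotient.mk w := Λ.quotKerEquivRange_symm_apply_image w _
    simp [g0, this]
  let g1 : LinearMap.range Λ →L[ℂ] ℂ := g0.mkContinuous K (by
    rintro ⟨_, w, rfl⟩
    rw [hg0]; exact h w)
  obtain ⟨g2, hg2, -⟩ := exists_extension_norm_eq (LinearMap.range Λ) g1
  refine ⟨(InnerProductSpace.toDual ℂ 𝓗).symm g2, fun w => ?_⟩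
  rw [InnerProductSpace.toDual_symm_apply]
  exact ((hg2 ⟨Λ w, LinearMap.mem_range_self Λ w⟩).trans (hg0 w)).symm

theorem exp_neg_mul_norm_sub_le {E : Type*} [SeminormedAddCommGroup E] {a : ℝ} (ha : 0 ≤ a)
    (z w : E) : Real.exp (-(a * ‖z - w‖)) ≤ Real.exp (-(a * ‖z‖)) * Real.exp (a * ‖w‖) := by
  rw [← Real.exp_add, Real.exp_le_exp]
  have h1 : ‖z‖ ≤ ‖z - w‖ + ‖w‖ := by simpa using norm_add_le (z - w) w
  nlinarith [mul_le_mul_of_nonneg_left h1 ha]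

/-! ### Coefficients of `Σ₁` functions with respect to time-frequency shifts -/

namespace GelfandShilov

/-- The pairing of `ψ` with the atom of `φ` at `z`. -/
noncomputable def coef {d : ℕ} (φ ψ : GelfandShilov d) (z : Rd d × Rd d) : ℂ :=
  ∫ y, ψ y * atom φ z y

theorem continuous_coef {d : ℕ} (φ ψ : GelfandShilov d) : Continuous (coef φ ψ) :=
  continuous_integral_mul_atom φ ψ.integrable

theorem coef_add {d : ℕ} (φ ψ χ : GelfandShilov d) (z : Rd d × Rd d) :
    coef φ (ψ + χ) z = coef φ ψ z + coef φ χ z := by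
  simp only [coef, add_apply, add_mul]
  exact integral_add (ψ.integrable_mul _) (χ.integrable_mul _)

theorem coef_smul {d : ℕ} (φ ψ : GelfandShilov d) (c : ℂ) (z : Rd d × Rd d) :
    coef φ (c • ψ) z = c * coef φ ψ z := by
  simp only [coef, smul_apply, mul_assoc]
  exact integral_const_mul _ _

theorem norm_coef_le {d : ℕ} (φ : GelfandShilov d) {a : ℝ} (ha : 0 < a) :
    ∃ (h : {h : ℝ // 0 < h}) (C : ℝ), 0 ≤ C ∧ ∀ (ψ : GelfandShilov d) (z : Rd d × Rd d),
      ‖coef φ ψ z‖ ≤ C * gsSeminorm d h ψ * Real.exp (-(a * ‖z‖)) :=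
  norm_integral_mul_atom_le_exp φ ha

theorem norm_coef_window_le {d : ℕ} (φ θ : GelfandShilov d) {a : ℝ} (ha : 0 < a) :
    ∃ C : ℝ, 0 ≤ C ∧ ∀ z w : Rd d × Rd d,
      ‖coef φ (θ.window w.1 w.2) z‖ ≤ C * Real.exp (-(a * ‖z - w‖)) := by
  simpa only [coef, mul_comm] using norm_integral_atom_mul_window_le φ θ ha

theorem continuous_coef_window {d : ℕ} (φ θ : GelfandShilov d) (z : Rd d × Rd d) :
    Continuous (fun w : Rd d × Rd d => coef φ (θ.window w.1 w.2) z) := by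
  have := continuous_integral_mul_window θ (atom φ z).integrable
  simpa only [coef, mul_comm] using this

theorem gsSeminorm_window_le_exp {d : ℕ} (h : {h : ℝ // 0 < h}) (φ : GelfandShilov d)
    (z : Rd d × Rd d) :
    gsSeminorm d h (φ.window z.1 z.2) ≤ gsSeminorm d h φ * Real.exp (2 / h.1 * ‖z‖) := by
  have hh := h.2
  refine (gsSeminorm_window_le h φ z.1 z.2).trans ?_
  have h0 : 0 ≤ gsSeminorm d h φ := apply_nonneg _ _
  rw [mul_assoc, ← Real.exp_add, ← add_div, div_mul_eq_mul_div]
  gcongr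
  linarith [norm_fst_le z, norm_snd_le z]

/-- The inversion formula writes `ψ` as a superposition of windows, whose seminorms grow at the rate
`2/h`. With `norm_coef_le`, the topology of `Σ₁` is thus described by exponentially weighted norms
of coefficients. -/
theorem gsSeminorm_le_integral_coef {d : ℕ} {φ : GelfandShilov d} (hφ : φ ≠ 0)
    (h : {h : ℝ // 0 < h}) : ∃ C : ℝ, 0 ≤ C ∧ ∀ ψ : GelfandShilov d,
      Integrable (fun z => ‖coef φ ψ z‖ * Real.exp (2 / h.1 * ‖z‖)) ∧
      gsSeminorm d h ψ ≤ C * ∫ z, ‖coef φ ψ z‖ * Real.exp (2 / h.1 * ‖z‖) := by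
  obtain ⟨c, hc, hinv⟩ := inversion hφ
  have hI : ∀ (h : {h : ℝ // 0 < h}) (ψ : GelfandShilov d),
      Integrable (fun z => ‖coef φ ψ z‖ * Real.exp (2 / h.1 * ‖z‖)) := by
    intro h ψ
    have hh := h.2
    obtain ⟨h', C, hC, H⟩ := norm_coef_le φ (a := 2 / h.1 + 1) (by positivity)
    refine ((integrable_exp_neg_mul_norm volume one_pos).const_mul
      (C * gsSeminorm d h' ψ)).mono' ?_ (Filter.Eventually.of_forall fun z => ?_)
    · have := continuous_coef φ ψ
      exact Continuous.aestronglyMeasurable (by fun_prop)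
    · rw [Real.norm_of_nonneg (by positivity)]
      calc _ ≤ C * gsSeminorm d h' ψ * Real.exp (-((2 / h.1 + 1) * ‖z‖)) *
            Real.exp (2 / h.1 * ‖z‖) := by gcongr; exact H ψ z
        _ = _ := by rw [mul_assoc, ← Real.exp_add]; ring_nf
  refine ⟨c * gsSeminorm d h φ, by positivity, fun ψ => ⟨hI h ψ, ?_⟩⟩
  have hB : ∀ (h : {h : ℝ // 0 < h}) (z : Rd d × Rd d), ‖(c : ℂ) * coef φ ψ z‖ *
      gsSeminorm d h (φ.window z.1 z.2) ≤
        c * gsSeminorm d h φ * (‖coef φ ψ z‖ * Real.exp (2 / h.1 * ‖z‖)) := by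
    intro h z
    rw [norm_mul, Complex.norm_real, Real.norm_of_nonneg hc.le]
    calc _ ≤ c * ‖coef φ ψ z‖ * (gsSeminorm d h φ * Real.exp (2 / h.1 * ‖z‖)) := by
          gcongr; exact gsSeminorm_window_le_exp h φ z
      _ = _ := by ring
  obtain ⟨ψ', hψ', hest⟩ := exists_eq_integral (μ := (volume : Measure (Rd d × Rd d)))
    (H := fun z => (c : ℂ) * coef φ ψ z) (Φ := fun z => φ.window z.1 z.2)
    (fun n x => ((continuous_const.mul (continuous_coef φ ψ)).smul
      (continuous_iteratedFDeriv_window φ n x)).aestronglyMeasurable)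
    (fun h => ⟨_, (hI h ψ).const_mul (c * gsSeminorm d h φ), hB h⟩)
  have : ψ' = ψ := by
    ext x
    rw [hψ', hinv, ← integral_const_mul]
    simp only [mul_assoc]; rfl
  rw [← this, ← integral_const_mul]
  rw [this]
  have := hest h _ ((hI h ψ).const_mul (c * gsSeminorm d h φ)) (hB h)
  rwa [‹ψ' = ψ›] at this

end GelfandShilov

/-! ### Distributions as integrals against coefficients -/

namespace GSDistribution
open GelfandShilov

/-- Continuity gives finitely many seminorms, and they are all dominated by the one with the least
parameter. -/
theorem exists_norm_le {d : ℕ} (f : GSDistribution d) :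
    ∃ (h : {h : ℝ // 0 < h}) (C : ℝ), 0 ≤ C ∧ ∀ ψ, ‖f ψ‖ ≤ C * gsSeminorm d h ψ := by
  obtain ⟨s, C, -, hC⟩ := Seminorm.bound_of_continuous (withSeminorms d)
    ((normSeminorm ℂ ℂ).comp f.toLinearMap) (continuous_norm.comp f.continuous)
  have hs : ∀ s : Finset {h : ℝ // 0 < h}, ∃ h : {h : ℝ // 0 < h}, ∀ h' ∈ s, h.1 ≤ h'.1 := by
    classical
    intro s
    induction s using Finset.induction with
    | empty => exact ⟨⟨1, one_pos⟩, by simp⟩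
    | insert a s _ ih =>
      obtain ⟨h, hh⟩ := ih
      refine ⟨⟨min a.1 h.1, lt_min a.2 h.2⟩, fun h' hh' => ?_⟩
      rcases Finset.mem_insert.1 hh' with rfl | h2
      · exact min_le_left _ _
      · exact (min_le_right _ _).trans (hh _ h2)
  obtain ⟨h, hh⟩ := hs s
  refine ⟨h, C, C.2, fun ψ => (hC ψ).trans ?_⟩
  change (C : ℝ) * (s.sup (gsSeminorm d)) ψ ≤ _
  gcongr
  exact Seminorm.finset_sup_apply_le (apply_nonneg _ _) fun h' hh' => gsSeminorm_anti (hh h' hh') ψ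

/-- A weighted `L¹` norm of the coefficients bounds `f`; the Cauchy–Schwarz inequality replaces it
by a weighted `L²` norm, for which functionals are inner products. The representation lets `f` pass
under integrals by Fubini's theorem for scalar functions. -/
theorem exists_representation {d : ℕ} (f : GSDistribution d) {φ : GelfandShilov d} (hφ : φ ≠ 0) :
    ∃ (G : Rd d × Rd d → ℂ) (a : ℝ), 0 < a ∧ AEStronglyMeasurable G ∧
      Integrable (fun z => ‖G z‖ * Real.exp (-(a * ‖z‖))) ∧ ∀ ψ, f ψ = ∫ z, G z * coef φ ψ z := by
  obtain ⟨h, C, hC, hf⟩ := exists_norm_le f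
  obtain ⟨C', hC', hint⟩ := gsSeminorm_le_integral_coef hφ h
  have hh := h.2
  set R := 2 / h.1 with hR
  have hR0 : 0 < R := by positivity
  -- The weight in `L²` is `e^{(R+1)|z|}`: one unit above `R` for Cauchy–Schwarz. Decay at the rate
  -- `R + 2` leaves `e^{-|z|}`, which is square integrable.
  obtain ⟨h', K, hK, H⟩ := norm_coef_le φ (a := R + 2) (by positivity)
  have hE : MemLp (fun z : Rd d × Rd d => Real.exp (-(1 * ‖z‖))) 2 := by
    rw [memLp_two_iff_integrable_sq (Continuous.aestronglyMeasurable (by fun_prop))]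
    refine (integrable_exp_neg_mul_norm volume two_pos).congr
      (Filter.Eventually.of_forall fun z => ?_)
    simp only
    rw [sq, ← Real.exp_add]; ring_nf
  have hmem : ∀ ψ, MemLp (fun z => coef φ ψ z * (Real.exp ((R + 1) * ‖z‖) : ℂ)) 2 := by
    intro ψ
    have hcont := continuous_coef φ ψ
    refine (hE.const_mul (K * gsSeminorm d h' ψ)).of_le
      (Continuous.aestronglyMeasurable (by fun_prop)) (Filter.Eventually.of_forall fun z => ?_)
    rw [norm_mul, Complex.norm_real, Real.norm_of_nonneg (Real.exp_pos _).le]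
    refine le_trans ?_ (Real.le_norm_self _)
    calc _ ≤ K * gsSeminorm d h' ψ * Real.exp (-((R + 2) * ‖z‖)) * Real.exp ((R + 1) * ‖z‖) := by
          gcongr; exact H ψ z
      _ = _ := by rw [mul_assoc, ← Real.exp_add]; ring_nf
  let Λ : GelfandShilov d →ₗ[ℂ] Lp ℂ 2 (volume : Measure (Rd d × Rd d)) :=
    { toFun := fun ψ => (hmem ψ).toLp _
      map_add' := fun ψ χ => by
        rw [← MemLp.toLp_add]
        congr 1
        ext z
        simp only [coef_add, Pi.add_apply, add_mul]
      map_smul' := fun c ψ => by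
        rw [RingHom.id_apply, ← MemLp.toLp_const_smul]
        congr 1
        ext z
        simp only [coef_smul, Pi.smul_apply, smul_eq_mul, mul_assoc] }
  have hΛ : ∀ ψ, Λ ψ = (hmem ψ).toLp _ := fun ψ => rfl
  have hbound : ∀ ψ, ‖f ψ‖ ≤ C * C' * (∫ z : Rd d × Rd d,
      ‖Real.exp (-(1 * ‖z‖))‖ ^ (2 : ℝ)) ^ (1 / (2 : ℝ)) * ‖Λ ψ‖ := by
    intro ψ
    have hE' : MemLp (fun z : Rd d × Rd d => ((Real.exp (-(1 * ‖z‖)) : ℝ) : ℂ)) 2 := hE.ofReal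
    have h1 := integral_mul_norm_le_Lp_mul_Lq (μ := (volume : Measure (Rd d × Rd d)))
      (Real.HolderConjugate.two_two) (f := fun z => ((Real.exp (-(1 * ‖z‖)) : ℝ) : ℂ))
      (g := fun z => coef φ ψ z * (Real.exp ((R + 1) * ‖z‖) : ℂ))
      (by simpa using hE') (by simpa using hmem ψ)
    have h2 : ‖Λ ψ‖ = (∫ z, ‖coef φ ψ z * (Real.exp ((R + 1) * ‖z‖) : ℂ)‖ ^ (2 : ℝ)) ^
        (1 / (2 : ℝ)) := by
      rw [hΛ, Lp.norm_toLp, (hmem ψ).eLpNorm_eq_integral_rpow_norm (by simp) (by simp),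
        ENNReal.toReal_ofReal (by positivity)]
      simp
    rw [← h2] at h1
    simp only [Complex.norm_real (Real.exp (-(1 * ‖_‖)))] at h1
    calc ‖f ψ‖ ≤ C * (C' * ∫ z, ‖coef φ ψ z‖ * Real.exp (R * ‖z‖)) :=
          (hf ψ).trans (by gcongr; exact (hint ψ).2)
      _ = C * C' * ∫ z, ‖Real.exp (-(1 * ‖z‖))‖ *
            ‖coef φ ψ z * (Real.exp ((R + 1) * ‖z‖) : ℂ)‖ := by
          rw [mul_assoc]
          congr 3
          ext z
          rw [norm_mul, Complex.norm_real, Real.norm_of_nonneg (Real.exp_pos _).le,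
            Real.norm_of_nonneg (Real.exp_pos _).le, mul_left_comm, ← Real.exp_add]
          ring_nf
      _ ≤ _ := by rw [mul_assoc (C * C')]; gcongr
  obtain ⟨g, hg⟩ := exists_eq_inner_of_norm_le Λ f.toLinearMap _ hbound
  -- The weight is moved from the coefficient to `g`; against `e^{-(R+2)|z|}` there remains the
  -- product of `|g|` and `e^{-|z|}`, both in `L²`.
  refine ⟨fun z => (starRingEnd ℂ) (g z) * (Real.exp ((R + 1) * ‖z‖) : ℂ), R + 2, by positivity,
    ?_, ?_, fun ψ => ?_⟩
  · exact (Complex.continuous_conj.comp_aestronglyMeasurable (Lp.aestronglyMeasurable g)).mul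
      (Continuous.aestronglyMeasurable (by fun_prop))
  · have h3 := (Lp.memLp g).norm.integrable_mul hE
    refine h3.congr (Filter.Eventually.of_forall fun z => ?_)
    simp only [Pi.mul_apply]
    rw [norm_mul, Complex.norm_real, Real.norm_of_nonneg (Real.exp_pos _).le, mul_assoc,
      ← Real.exp_add, RCLike.norm_conj]
    ring_nf
  · refine (hg ψ).trans ?_
    rw [L2.inner_def]
    refine integral_congr_ae ?_
    filter_upwards [(hmem ψ).coeFn_toLp] with z hz
    rw [hΛ, hz, RCLike.inner_apply]
    ring

end GSDistribution


/-- The exponential weight `z ↦ exp (a ‖z‖)` with values in `[0, ∞]`. -/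
noncomputable def expw {E : Type*} [Norm E] (a : ℝ) (z : E) : ℝ≥0∞ :=
  ENNReal.ofReal (Real.exp (a * ‖z‖))

/-! ### The reproducing formula -/

namespace GelfandShilov

/-- The inversion formula integrated against the atom at `z`. It is a hypothesis here so that the
same constant `c` serves for functions and for distributions. -/
theorem coef_reproducing {d : ℕ} {φ : GelfandShilov d} {c : ℝ}
    (hinv : ∀ (ψ : GelfandShilov d) (x : Rd d),
      ψ x = c * ∫ z : Rd d × Rd d, coef φ ψ z * φ.window z.1 z.2 x)
    (ψ : GelfandShilov d) (z : Rd d × Rd d) :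
    coef φ ψ z = c * ∫ w, coef φ ψ w * coef φ (φ.window w.1 w.2) z := by
  obtain ⟨h, C, hC, H⟩ := norm_coef_le φ one_pos
  have hcont := continuous_coef φ ψ
  have hci : Integrable (coef φ ψ) := by
    refine ((integrable_exp_neg_mul_norm volume one_pos).const_mul (C * gsSeminorm d h ψ)).mono'
      hcont.aestronglyMeasurable (Filter.Eventually.of_forall fun w => ?_)
    exact H ψ w
  have hjoint : Integrable (fun p : Rd d × (Rd d × Rd d) =>
      coef φ ψ p.2 * φ.window p.2.1 p.2.2 p.1 * atom φ z p.1)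
      ((volume : Measure (Rd d)).prod volume) := by
    have h1 := ((atom φ z).integrable.norm.mul_const (gsSeminorm d ⟨1, one_pos⟩ φ)).mul_prod
      hci.norm
    refine h1.mono' ?_ (Filter.Eventually.of_forall fun p => ?_)
    · have h2 := (continuous_window_apply φ).comp
        (f := fun p : Rd d × (Rd d × Rd d) => (p.2, p.1)) (by fun_prop)
      have h3 := (atom φ z).continuous
      exact ((hcont.comp continuous_snd).mul h2).mul (h3.comp continuous_fst)
        |>.aestronglyMeasurable
    · rw [norm_mul, norm_mul]
      calc _ ≤ ‖coef φ ψ p.2‖ * gsSeminorm d ⟨1, one_pos⟩ φ * ‖atom φ z p.1‖ := by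
            gcongr; exact norm_window_apply_le _ _ _ _
        _ = _ := by ring
  calc coef φ ψ z = ∫ y, (c * ∫ w, coef φ ψ w * φ.window w.1 w.2 y) * atom φ z y := by
        rw [coef]; simp only [← hinv]
    _ = c * ∫ y, ∫ w, coef φ ψ w * φ.window w.1 w.2 y * atom φ z y := by
        rw [← integral_const_mul]
        congr 1; ext y
        rw [mul_assoc, ← integral_mul_const]
    _ = c * ∫ w, ∫ y, coef φ ψ w * φ.window w.1 w.2 y * atom φ z y := by
        rw [integral_integral_swap (f := fun y w => coef φ ψ w * φ.window w.1 w.2 y * atom φ z y)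
          hjoint]
    _ = _ := by
        congr 2; ext w
        rw [coef, coef, ← integral_const_mul]
        simp only [mul_assoc]

end GelfandShilov

/-! ### The short-time Fourier transform of a distribution: growth, continuity, inversion -/

namespace GSDistribution
open GelfandShilov

/-- The short-time Fourier transform without its normalizing factor. -/
noncomputable def wval {d : ℕ} (θ : GelfandShilov d) (f : GSDistribution d) (z : Rd d × Rd d) : ℂ :=
  f (θ.window z.1 z.2)

theorem norm_wval_le {d : ℕ} (θ : GelfandShilov d) (f : GSDistribution d) :
    ∃ C R : ℝ, 0 ≤ C ∧ 0 < R ∧ ∀ z, ‖wval θ f z‖ ≤ C * Real.exp (R * ‖z‖) := by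
  obtain ⟨h, C, hC, hf⟩ := exists_norm_le f
  have hh := h.2
  refine ⟨C * gsSeminorm d h θ, 2 / h.1, by positivity, by positivity, fun z => (hf _).trans ?_⟩
  rw [mul_assoc]
  gcongr
  exact gsSeminorm_window_le_exp h θ z

/-- A representation of `f` with `θ` itself as window reduces continuity to dominated convergence
near each point; the zero window, which represents nothing, is treated apart. -/
theorem continuous_wval {d : ℕ} (θ : GelfandShilov d) (f : GSDistribution d) :
    Continuous (wval θ f) := by
  by_cases hθ : θ = 0
  · have : wval θ f = fun _ => 0 := by
      funext z
      have h0 : θ.window z.1 z.2 = 0 := by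
        ext y; rw [window_apply, hθ]
        change (starRingEnd ℂ) 0 * _ = 0
        simp
      rw [wval, h0, map_zero]
    rw [this]; exact continuous_const
  obtain ⟨G, a, ha, hGm, hGi, hG⟩ := exists_representation f hθ
  obtain ⟨C, hC, H⟩ := norm_coef_window_le θ θ ha
  have : wval θ f = fun w => ∫ z, G z * coef θ (θ.window w.1 w.2) z := funext fun w => hG _
  rw [this]
  refine continuous_iff_continuousAt.2 fun w₀ => ?_
  refine continuousAt_of_dominated (bound := fun z => ‖G z‖ * Real.exp (-(a * ‖z‖)) *
    (C * Real.exp (a * (‖w₀‖ + 1)))) (Filter.Eventually.of_forall fun w =>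
      hGm.mul (continuous_coef _ _).aestronglyMeasurable) ?_ (hGi.mul_const _)
    (Filter.Eventually.of_forall fun z =>
      (continuous_const.mul (continuous_coef_window θ θ z)).continuousAt)
  filter_upwards [Metric.ball_mem_nhds w₀ one_pos] with w hw
  refine Filter.Eventually.of_forall fun z => ?_
  rw [norm_mul]
  have hw' : ‖w‖ ≤ ‖w₀‖ + 1 := by
    have h1 : ‖w - w₀‖ < 1 := by simpa [dist_eq_norm] using hw
    have h2 : ‖w‖ ≤ ‖w₀‖ + ‖w - w₀‖ := by simpa using norm_add_le w₀ (w - w₀)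
    linarith
  calc ‖G z‖ * ‖coef θ (θ.window w.1 w.2) z‖ ≤ ‖G z‖ * (C * (Real.exp (-(a * ‖z‖)) *
        Real.exp (a * (‖w₀‖ + 1)))) := by
        gcongr
        refine (H z w).trans ?_
        gcongr
        exact (exp_neg_mul_norm_sub_le ha.le z w).trans (by gcongr)
    _ = _ := by ring

theorem integrable_wval_mul_coef {d : ℕ} (θ φ : GelfandShilov d) (f : GSDistribution d)
    (ψ : GelfandShilov d) : Integrable (fun w => wval θ f w * coef φ ψ w) := by
  obtain ⟨C, R, hC, hR, hf⟩ := norm_wval_le θ f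
  obtain ⟨h, K, hK, H⟩ := norm_coef_le φ (a := R + 1) (by positivity)
  refine ((integrable_exp_neg_mul_norm volume one_pos).const_mul
    (C * (K * gsSeminorm d h ψ))).mono'
    ((continuous_wval θ f).mul (continuous_coef φ ψ)).aestronglyMeasurable
    (Filter.Eventually.of_forall fun w => ?_)
  rw [norm_mul]
  calc _ ≤ (C * Real.exp (R * ‖w‖)) * (K * gsSeminorm d h ψ * Real.exp (-((R + 1) * ‖w‖))) := by
        gcongr
        · exact hf w
        · exact H ψ w
    _ = C * (K * gsSeminorm d h ψ) * (Real.exp (R * ‖w‖) * Real.exp (-((R + 1) * ‖w‖))) := by ring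
    _ = _ := by rw [← Real.exp_add]; ring_nf

/-- Inserting the reproducing formula for the coefficients of `ψ` in a representation of `f` and
exchanging the integrals, the representation reassembles `f` applied to the windows. The auxiliary
density `G` disappears from the result. -/
theorem inversion {d : ℕ} {φ : GelfandShilov d} (hφ : φ ≠ 0) : ∃ c : ℝ, 0 < c ∧
    ∀ (f : GSDistribution d) (ψ : GelfandShilov d), f ψ = c * ∫ w, wval φ f w * coef φ ψ w := by
  obtain ⟨c, hc, hinv⟩ := GelfandShilov.inversion hφ
  refine ⟨c, hc, fun f ψ => ?_⟩
  obtain ⟨G, a, ha, hGm, hGi, hG⟩ := exists_representation f hφ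
  obtain ⟨C, hC, H⟩ := norm_coef_window_le φ φ ha
  -- The kernel costs `e^{a|w|}` when its decay is shifted to the variable of `G`; the extra unit of
  -- decay keeps the double integral absolutely convergent.
  obtain ⟨h, K, hK, HK⟩ := norm_coef_le φ (a := a + 1) (by positivity)
  have hcw : Continuous (fun p : (Rd d × Rd d) × (Rd d × Rd d) =>
      coef φ (φ.window p.2.1 p.2.2) p.1) := by
    have h1 : (fun p : (Rd d × Rd d) × (Rd d × Rd d) => coef φ (φ.window p.2.1 p.2.2) p.1) =
        fun p => Complex.exp (Complex.I * (inner ℝ (p.1.2 - p.2.2) p.1.1 : ℝ)) *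
        ∫ y, φ y * φ.window (p.2.1 - p.1.1) (p.2.2 - p.1.2) y := by
      ext p
      rw [← integral_atom_mul_window φ φ p.1 p.2, coef]
      simp only [mul_comm]
    rw [h1]
    have h2 := (continuous_integral_mul_window φ φ.integrable).comp
      (f := fun p : (Rd d × Rd d) × (Rd d × Rd d) => p.2 - p.1) (by fun_prop)
    refine Continuous.mul (by fun_prop) h2
  have hjoint : Integrable (fun p : (Rd d × Rd d) × (Rd d × Rd d) =>
      G p.1 * (coef φ ψ p.2 * coef φ (φ.window p.2.1 p.2.2) p.1))
      ((volume : Measure (Rd d × Rd d)).prod volume) := by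
    have h1 := (hGi.mul_const (C * (K * gsSeminorm d h ψ))).mul_prod
      (integrable_exp_neg_mul_norm (volume : Measure (Rd d × Rd d)) one_pos)
    refine h1.mono' ?_ (Filter.Eventually.of_forall fun p => ?_)
    · exact hGm.comp_fst.mul
        (((continuous_coef φ ψ).comp continuous_snd).mul hcw).aestronglyMeasurable
    · rw [norm_mul, norm_mul]
      calc _ ≤ ‖G p.1‖ * (K * gsSeminorm d h ψ * Real.exp (-((a + 1) * ‖p.2‖)) *
            (C * (Real.exp (-(a * ‖p.1‖)) * Real.exp (a * ‖p.2‖)))) := by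
            gcongr
            · exact HK ψ p.2
            · exact (H p.1 p.2).trans (by gcongr; exact exp_neg_mul_norm_sub_le ha.le _ _)
        _ = ‖G p.1‖ * Real.exp (-(a * ‖p.1‖)) * (C * (K * gsSeminorm d h ψ)) *
            (Real.exp (-((a + 1) * ‖p.2‖)) * Real.exp (a * ‖p.2‖)) := by ring
        _ = _ := by rw [← Real.exp_add]; ring_nf
  calc f ψ = ∫ z, G z * (c * ∫ w, coef φ ψ w * coef φ (φ.window w.1 w.2) z) := by
        rw [hG]; simp only [← coef_reproducing hinv]
    _ = c * ∫ z, ∫ w, G z * (coef φ ψ w * coef φ (φ.window w.1 w.2) z) := by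
        rw [← integral_const_mul]
        congr 1; ext z
        rw [mul_left_comm, ← integral_const_mul]
    _ = c * ∫ w, ∫ z, G z * (coef φ ψ w * coef φ (φ.window w.1 w.2) z) := by
        rw [integral_integral_swap
          (f := fun z w => G z * (coef φ ψ w * coef φ (φ.window w.1 w.2) z)) hjoint]
    _ = _ := by
        congr 2; ext w
        rw [wval, hG, ← integral_mul_const]
        congr 1; ext z; ring

/-- Inversion applied to the test function `θ.window w.1 w.2`. For `θ = φ` this is a sub-mean-value
inequality at every exponential rate; for other `θ` it is the change of window. The constant is
independent of `f`. -/
theorem enorm_wval_le {d : ℕ} {φ : GelfandShilov d} (hφ : φ ≠ 0) (θ : GelfandShilov d) {a : ℝ}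
    (ha : 0 < a) : ∃ C : ℝ≥0, ∀ (f : GSDistribution d) (w : Rd d × Rd d),
      ‖wval θ f w‖ₑ ≤ C * ∫⁻ z, ‖wval φ f z‖ₑ * expw (-a) (z - w) := by
  obtain ⟨c, hc, hinv⟩ := inversion hφ
  obtain ⟨C, hC, H⟩ := norm_coef_window_le φ θ ha
  refine ⟨(c * C).toNNReal, fun f w => ?_⟩
  change _ ≤ ENNReal.ofReal (c * C) * _
  rw [wval, hinv, enorm_mul, ENNReal.ofReal_mul hc.le, mul_assoc]
  have h1 : ‖(c : ℂ)‖ₑ = ENNReal.ofReal c := by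
    rw [← ofReal_norm, Complex.norm_real, Real.norm_of_nonneg hc.le]
  rw [h1]
  gcongr
  refine (enorm_integral_le_lintegral_enorm _).trans ?_
  rw [← lintegral_const_mul' _ _ ENNReal.ofReal_ne_top]
  refine lintegral_mono fun z => ?_
  rw [enorm_mul, mul_left_comm]
  gcongr
  rw [← ofReal_norm, expw, ← ENNReal.ofReal_mul hC]
  exact ENNReal.ofReal_le_ofReal (by simpa [neg_mul] using H z w)

/-- Synthesis of a distribution from its coefficients. -/
theorem exists_eq_integral_coef {d : ℕ} (φ : GelfandShilov d) {H : Rd d × Rd d → ℂ} {a : ℝ}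
    (ha : 0 < a) (hm : AEStronglyMeasurable H)
    (hi : Integrable (fun z => ‖H z‖ * Real.exp (-(a * ‖z‖)))) :
    (∀ ψ, Integrable (fun z => H z * coef φ ψ z)) ∧
    ∃ f : GSDistribution d, ∀ ψ, f ψ = ∫ z, H z * coef φ ψ z := by
  obtain ⟨h, K, hK, HK⟩ := norm_coef_le φ ha
  have hle : ∀ ψ z, ‖H z * coef φ ψ z‖ ≤
      ‖H z‖ * Real.exp (-(a * ‖z‖)) * (K * gsSeminorm d h ψ) := by
    intro ψ z
    rw [norm_mul]
    calc _ ≤ ‖H z‖ * (K * gsSeminorm d h ψ * Real.exp (-(a * ‖z‖))) := by gcongr; exact HK ψ z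
      _ = _ := by ring
  have hint : ∀ ψ, Integrable (fun z => H z * coef φ ψ z) := fun ψ =>
    (hi.mul_const _).mono' (hm.mul (continuous_coef φ ψ).aestronglyMeasurable)
      (Filter.Eventually.of_forall (hle ψ))
  refine ⟨hint, ?_⟩
  let L : GelfandShilov d →ₗ[ℂ] ℂ :=
    { toFun := fun ψ => ∫ z, H z * coef φ ψ z
      map_add' := fun ψ χ => by
        simp only [coef_add, mul_add]
        exact integral_add (hint ψ) (hint χ)
      map_smul' := fun c ψ => by
        simp only [coef_smul, mul_left_comm _ c, RingHom.id_apply, smul_eq_mul]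
        exact integral_const_mul _ _ }
  have hL : Continuous L := by
    refine WithSeminorms.continuous_normedSpace_rng ℂ (GelfandShilov.withSeminorms d) L
      ⟨{h}, ⟨(∫ z, ‖H z‖ * Real.exp (-(a * ‖z‖))) * K, by positivity⟩, fun ψ => ?_⟩
    simp only [Finset.sup_singleton]
    change ‖∫ z, H z * coef φ ψ z‖ ≤ (∫ z, ‖H z‖ * Real.exp (-(a * ‖z‖))) * K * gsSeminorm d h ψ
    rw [mul_assoc, ← integral_mul_const]
    exact norm_integral_le_of_norm_le (hi.mul_const _) (Filter.Eventually.of_forall (hle ψ))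
  exact ⟨⟨L, hL⟩, fun ψ => rfl⟩

end GSDistribution


/-! ### Exponential weights -/

section Expw
variable {E : Type*} [NormedAddCommGroup E]

theorem expw_ne_top (a : ℝ) (z : E) : expw a z ≠ ∞ := ENNReal.ofReal_ne_top

theorem expw_zero_right (a : ℝ) : expw a (0 : E) = 1 := by simp [expw]

theorem expw_mul_expw (a b : ℝ) (z : E) : expw a z * expw b z = expw (a + b) z := by
  rw [expw, expw, expw, ← ENNReal.ofReal_mul (Real.exp_pos _).le, ← Real.exp_add, add_mul]

theorem expw_mul_expw_neg (a : ℝ) (z : E) : expw a z * expw (-a) z = 1 := by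
  rw [expw_mul_expw]; simp [expw]

theorem expw_rpow (a r : ℝ) (z : E) : expw a z ^ r = expw (a * r) z := by
  rw [expw, expw, ENNReal.ofReal_rpow_of_pos (Real.exp_pos _), ← Real.exp_mul]
  ring_nf

theorem expw_neg_right (a : ℝ) (z : E) : expw a (-z) = expw a z := by simp [expw]

theorem expw_sub_comm (a : ℝ) (z w : E) : expw a (z - w) = expw a (w - z) := by
  simp [expw, norm_sub_rev]

theorem expw_mono {a b : ℝ} (h : a ≤ b) (z : E) : expw a z ≤ expw b z :=
  ENNReal.ofReal_le_ofReal (Real.exp_le_exp.2 (by gcongr))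

theorem expw_add_le {a : ℝ} (ha : 0 ≤ a) (z w : E) : expw a (z + w) ≤ expw a z * expw a w := by
  rw [expw, expw, expw, ← ENNReal.ofReal_mul (Real.exp_pos _).le, ← Real.exp_add, ← mul_add]
  exact ENNReal.ofReal_le_ofReal (Real.exp_le_exp.2 (by gcongr; exact norm_add_le _ _))

theorem expw_neg_add_le {a : ℝ} (ha : 0 ≤ a) (z u : E) :
    expw (-a) (z + u) ≤ expw a u * expw (-a) z := by
  rw [expw, expw, expw, ← ENNReal.ofReal_mul (Real.exp_pos _).le, ← Real.exp_add]
  refine ENNReal.ofReal_le_ofReal (Real.exp_le_exp.2 ?_)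
  have h1 : ‖z‖ ≤ ‖z + u‖ + ‖u‖ := by simpa using norm_sub_le (z + u) u
  nlinarith [mul_le_mul_of_nonneg_left h1 ha]

theorem expw_neg_mul_le {a : ℝ} (ha : 0 ≤ a) (z w : E) :
    expw (-a) z * expw (-a) w ≤ expw (-a) (z + w) := by
  rw [expw, expw, expw, ← ENNReal.ofReal_mul (Real.exp_pos _).le, ← Real.exp_add]
  refine ENNReal.ofReal_le_ofReal (Real.exp_le_exp.2 ?_)
  nlinarith [mul_le_mul_of_nonneg_left (norm_add_le z w) ha]

theorem continuous_expw (a : ℝ) : Continuous (fun z : E => expw a z) :=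
  ENNReal.continuous_ofReal.comp (by fun_prop)

theorem lintegral_expw_neg_ne_top [NormedSpace ℝ E] [FiniteDimensional ℝ E] [MeasureSpace E]
    [BorelSpace E] [(volume : Measure E).IsAddHaarMeasure] {a : ℝ} (ha : 0 < a) :
    ∫⁻ z : E, expw (-a) z ≠ ∞ := by
  have h := (integrable_exp_neg_mul_norm (volume : Measure E) ha).lintegral_lt_top
  simpa [expw, neg_mul] using h.ne

end Expw

/-! ### Slowly varying functions -/

/-- `N` grows at most by the factor `exp (a ‖u‖)` under translation by `u`. -/
def SlowlyVarying {E : Type*} [NormedAddCommGroup E] (a : ℝ) (N : E → ℝ≥0∞) : Prop :=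
  ∀ z u, N (z + u) ≤ expw a u * N z

namespace SlowlyVarying
variable {E : Type*} [NormedAddCommGroup E] {a b : ℝ} {N M : E → ℝ≥0∞}

theorem le_mul (h : SlowlyVarying a N) (z w : E) : N z ≤ expw a (z - w) * N w := by
  simpa using h w (z - w)

theorem mono (h : SlowlyVarying a N) (hab : a ≤ b) : SlowlyVarying b N := fun z u =>
  (h z u).trans (by gcongr; exact expw_mono hab u)

theorem mul (hN : SlowlyVarying a N) (hM : SlowlyVarying b M) :
    SlowlyVarying (a + b) (fun z => N z * M z) := fun z u => by
  rw [← expw_mul_expw]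
  calc N (z + u) * M (z + u) ≤ (expw a u * N z) * (expw b u * M z) :=
        mul_le_mul' (hN z u) (hM z u)
    _ = _ := by ring

theorem const_mul (hN : SlowlyVarying a N) (c : ℝ≥0∞) : SlowlyVarying a (fun z => c * N z) :=
  fun z u => (mul_le_mul_right (hN z u) c).trans (le_of_eq (by ring))

theorem rpow (hN : SlowlyVarying a N) {r : ℝ} (hr : 0 ≤ r) :
    SlowlyVarying (a * r) (fun z => N z ^ r) := fun z u => by
  rw [← expw_rpow, ← ENNReal.mul_rpow_of_nonneg _ _ hr]
  exact ENNReal.rpow_le_rpow (hN z u) hr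

theorem comp_sub_left (hN : SlowlyVarying a N) (x : E) : SlowlyVarying a (fun y => N (x - y)) :=
  fun z u => by
    have := hN (x - z) (-u)
    rwa [expw_neg_right, ← sub_eq_add_neg, sub_sub] at this

/-- Since `N w ≥ e^{-a|z-w|} N z`, the function is lower semicontinuous, even where it is infinite.
In particular suprema over uncountable families, such as maximal functions, are measurable. -/
theorem measurable [MeasurableSpace E] [BorelSpace E] (hN : SlowlyVarying a N) :
    Measurable N := by
  refine LowerSemicontinuous.measurable fun z c hc => ?_
  have h1 : Filter.Tendsto (fun w => expw (-a) (z - w) * N z) (nhds z) (nhds (1 * N z)) := by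
    refine ENNReal.Tendsto.mul_const ?_ (Or.inl one_ne_zero)
    have h2 : Continuous (fun w : E => expw (-a) (z - w)) :=
      (continuous_expw (-a)).comp (by fun_prop)
    simpa [expw_zero_right] using h2.tendsto z
  rw [one_mul] at h1
  filter_upwards [h1.eventually (lt_mem_nhds hc)] with w hw
  refine hw.trans_le ?_
  calc _ ≤ expw (-a) (z - w) * (expw a (z - w) * N w) := by gcongr; exact hN.le_mul z w
    _ = N w := by rw [← mul_assoc, mul_comm (expw (-a) _), expw_mul_expw_neg, one_mul]

end SlowlyVarying

theorem slowlyVarying_convolution {E : Type*} [NormedAddCommGroup E] [MeasureSpace E] {a : ℝ}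
    (ha : 0 ≤ a) (F : E → ℝ≥0∞) :
    SlowlyVarying a (fun z => ∫⁻ w, F w * expw (-a) (z - w)) := fun z u => by
  rw [← lintegral_const_mul' _ _ (expw_ne_top a u)]
  refine lintegral_mono fun w => ?_
  rw [mul_left_comm]
  gcongr
  rw [add_sub_right_comm]
  exact expw_neg_add_le ha _ _

/-! ### The quasi-norm of `L^p` -/

/-- The `L^p` quasi-norm of a function with values in `[0, ∞]`. -/
noncomputable def lpn {E : Type*} [MeasureSpace E] (p : ℝ) (g : E → ℝ≥0∞) : ℝ≥0∞ :=
  (∫⁻ x, g x ^ p) ^ (1 / p)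

section Lpn
variable {E : Type*} [MeasureSpace E] {p : ℝ}

theorem lpn_rpow (hp : 0 < p) (g : E → ℝ≥0∞) : lpn p g ^ p = ∫⁻ x, g x ^ p := by
  rw [lpn, ← ENNReal.rpow_mul, one_div_mul_cancel hp.ne', ENNReal.rpow_one]

theorem lpn_mono_ae (hp : 0 < p) {f g : E → ℝ≥0∞} (h : ∀ᵐ x, f x ≤ g x) : lpn p f ≤ lpn p g := by
  refine ENNReal.rpow_le_rpow (lintegral_mono_ae ?_) (by positivity)
  filter_upwards [h] with x hx using ENNReal.rpow_le_rpow hx hp.le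

theorem lpn_mono (hp : 0 < p) {f g : E → ℝ≥0∞} (h : ∀ x, f x ≤ g x) : lpn p f ≤ lpn p g :=
  lpn_mono_ae hp (Filter.Eventually.of_forall h)

theorem lpn_const_mul (hp : 0 < p) {c : ℝ≥0∞} (hc : c ≠ ∞) (g : E → ℝ≥0∞) :
    lpn p (fun x => c * g x) = c * lpn p g := by
  simp only [lpn, ENNReal.mul_rpow_of_nonneg _ _ hp.le]
  rw [lintegral_const_mul' _ _ (ENNReal.rpow_ne_top_of_nonneg hp.le hc),
    ENNReal.mul_rpow_of_nonneg _ _ (by positivity), ← ENNReal.rpow_mul, mul_one_div_cancel hp.ne',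
    ENNReal.rpow_one]

theorem lpn_div_rpow {r : ℝ} (hr : 0 < r) (g : E → ℝ≥0∞) :
    lpn (p / r) (fun x => g x ^ r) = lpn p g ^ r := by
  simp only [lpn, ← ENNReal.rpow_mul]
  rw [mul_div_cancel₀ _ hr.ne', one_div_div, one_div_mul_eq_div]

theorem add_rpow_le_two_rpow_mul {t : ℝ} (ht : 0 ≤ t) (x y : ℝ≥0∞) :
    (x + y) ^ t ≤ 2 ^ t * (x ^ t + y ^ t) := by
  rcases le_total x y with h | h
  · calc (x + y) ^ t ≤ (2 * y) ^ t := by gcongr; rw [two_mul]; gcongr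
      _ = 2 ^ t * y ^ t := ENNReal.mul_rpow_of_nonneg _ _ ht
      _ ≤ _ := by gcongr; exact le_add_self
  · calc (x + y) ^ t ≤ (2 * x) ^ t := by gcongr; rw [two_mul]; gcongr
      _ = 2 ^ t * x ^ t := ENNReal.mul_rpow_of_nonneg _ _ ht
      _ ≤ _ := by gcongr; exact le_self_add

theorem lpn_add_le (hp : 0 < p) {f : E → ℝ≥0∞} (hf : AEMeasurable f) (g : E → ℝ≥0∞) :
    lpn p (fun x => f x + g x) ≤ 2 * 2 ^ (1 / p) * (lpn p f + lpn p g) := by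
  have h2 : ∫⁻ x, (f x + g x) ^ p ≤ 2 ^ p * ((∫⁻ x, f x ^ p) + ∫⁻ x, g x ^ p) := by
    rw [← lintegral_add_left' (hf.pow_const p),
      ← lintegral_const_mul' _ _ (ENNReal.rpow_ne_top_of_nonneg hp.le ENNReal.ofNat_ne_top)]
    exact lintegral_mono fun x => add_rpow_le_two_rpow_mul hp.le _ _
  have hp' : 0 ≤ 1 / p := by positivity
  calc lpn p (fun x => f x + g x) ≤ (2 ^ p * ((∫⁻ x, f x ^ p) + ∫⁻ x, g x ^ p)) ^ (1 / p) :=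
        ENNReal.rpow_le_rpow h2 hp'
    _ = 2 * ((∫⁻ x, f x ^ p) + ∫⁻ x, g x ^ p) ^ (1 / p) := by
        rw [ENNReal.mul_rpow_of_nonneg _ _ hp', ← ENNReal.rpow_mul, mul_one_div_cancel hp.ne',
          ENNReal.rpow_one]
    _ ≤ 2 * (2 ^ (1 / p) * (lpn p f + lpn p g)) := by
        gcongr; exact add_rpow_le_two_rpow_mul hp' _ _
    _ = _ := by ring

end Lpn

/-! ### Minkowski's integral inequality -/

/-- With `S` the inner integral, write `S^P = S · S^{P-1}`, apply Hölder's inequality for each `b`,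
and cancel a power of the norm of `S`. Cancellation requires a finite norm, so `S` is first
truncated in height and to sets of finite measure, and monotone convergence removes the truncation.
-/
theorem lpn_lintegral_le {E B : Type*} [MeasureSpace E] [SigmaFinite (volume : Measure E)]
    [MeasurableSpace B] {μ : Measure B} [SFinite μ] {P : ℝ} (hP : 1 ≤ P) {h : B → E → ℝ≥0∞}
    (hm : Measurable (Function.uncurry h)) :
    lpn P (fun x => ∫⁻ b, h b x ∂μ) ≤ ∫⁻ b, lpn P (h b) ∂μ := by
  have hm' : Measurable (fun x => ∫⁻ b, h b x ∂μ) := hm.lintegral_prod_left'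
  have hmb : ∀ b, Measurable (h b) := fun b => hm.comp measurable_prodMk_left
  rcases hP.eq_or_lt with rfl | hP1
  · simp only [lpn, ENNReal.rpow_one, one_div_one]
    rw [lintegral_lintegral_swap]
    exact (hm.comp measurable_swap).aemeasurable
  have hP0 : 0 < P := by linarith
  set S : E → ℝ≥0∞ := fun x => ∫⁻ b, h b x ∂μ with hS
  set R := ∫⁻ b, lpn P (h b) ∂μ with hR
  let s := spanningSets (volume : Measure E)
  have hs : ∀ n, MeasurableSet (s n) := measurableSet_spanningSets _
  let T : ℕ → E → ℝ≥0∞ := fun n => (s n).indicator (fun x => min (S x) n)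
  have hTm : ∀ n, Measurable (T n) := fun n => (hm'.min measurable_const).indicator (hs n)
  have hTS : ∀ n x, T n x ≤ S x := fun n x => by
    by_cases hx : x ∈ s n <;> simp [T, hx]
  have hTfin : ∀ n, ∫⁻ x, T n x ^ P ≠ ∞ := by
    intro n
    have h1 : ∀ x, T n x ^ P ≤ (s n).indicator (fun _ => (n : ℝ≥0∞) ^ P) x := fun x => by
      by_cases hx : x ∈ s n
      · simp only [T, Set.indicator_of_mem hx]
        exact ENNReal.rpow_le_rpow (min_le_right _ _) hP0.le
      · simp [T, hx, hP0]
    refine ne_top_of_le_ne_top ?_ (lintegral_mono h1)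
    rw [lintegral_indicator (hs n), setLIntegral_const]
    exact ENNReal.mul_ne_top (ENNReal.rpow_ne_top_of_nonneg hP0.le (ENNReal.natCast_ne_top n))
      (measure_spanningSets_lt_top _ n).ne
  have hTle : ∀ n, ∫⁻ x, T n x ^ P ≤ R ^ P := by
    intro n
    have hc := Real.HolderConjugate.conjExponent hP1
    set Q := P.conjExponent
    have h1 : ∫⁻ x, T n x ^ P ≤ R * (∫⁻ x, T n x ^ P) ^ (1 / Q) := by
      calc ∫⁻ x, T n x ^ P ≤ ∫⁻ x, S x * T n x ^ (P - 1) := by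
            refine lintegral_mono fun x => ?_
            calc T n x ^ P = T n x ^ (1 + (P - 1)) := by ring_nf
              _ = T n x * T n x ^ (P - 1) := by
                  rw [ENNReal.rpow_add_of_nonneg _ _ zero_le_one (by linarith), ENNReal.rpow_one]
              _ ≤ _ := by gcongr; exact hTS n x
        _ = ∫⁻ x, ∫⁻ b, h b x * T n x ^ (P - 1) ∂μ := by
            congr 1; ext x
            have hmx : Measurable (fun b => h b x) := hm.comp measurable_prodMk_right
            rw [lintegral_mul_const _ hmx]
        _ = ∫⁻ b, (∫⁻ x, h b x * T n x ^ (P - 1)) ∂μ := by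
            rw [lintegral_lintegral_swap (f := fun x b => h b x * T n x ^ (P - 1))]
            exact ((hm.comp measurable_swap).mul
              (((hTm n).comp measurable_fst).pow_const _)).aemeasurable
        _ ≤ ∫⁻ b, lpn P (h b) * (∫⁻ x, T n x ^ P) ^ (1 / Q) ∂μ := by
            refine lintegral_mono fun b => ?_
            exact ENNReal.lintegral_mul_rpow_le_lintegral_rpow_mul_lintegral_rpow hc
              (hmb b).aemeasurable (hTm n).aemeasurable
        _ = _ := by
            rw [lintegral_mul_const' _ _ (ENNReal.rpow_ne_top_of_nonneg
              (by have := hc.symm.pos; positivity) (hTfin n))]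
    rcases eq_or_ne (∫⁻ x, T n x ^ P) 0 with h0 | h0
    · rw [h0]; exact zero_le
    have hf := hTfin n
    set I := ∫⁻ x, T n x ^ P
    have h2 : I ^ (1 / P) * I ^ (1 / Q) ≤ R * I ^ (1 / Q) := by
      rw [← ENNReal.rpow_add _ _ h0 hf]
      have : 1 / P + 1 / Q = 1 := by
        have := hc.inv_add_inv_eq_one; simpa [one_div] using this
      rw [this, ENNReal.rpow_one]; exact h1
    have h3 := (ENNReal.mul_le_mul_iff_left (ENNReal.rpow_pos (pos_iff_ne_zero.2 h0) hf).ne'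
      (ENNReal.rpow_ne_top_of_ne_zero h0 hf)).1 h2
    calc I = (I ^ (1 / P)) ^ P := by
          rw [← ENNReal.rpow_mul, one_div_mul_cancel hP0.ne', ENNReal.rpow_one]
      _ ≤ _ := by gcongr
  have hmono : Monotone T := by
    intro m n hmn x
    have h1 : s m ⊆ s n := monotone_spanningSets _ hmn
    by_cases hx : x ∈ s m
    · simp only [T, Set.indicator_of_mem hx, Set.indicator_of_mem (h1 hx)]
      gcongr
    · simp [T, hx]
  have hsup : ∀ x, S x ^ P = ⨆ n, T n x ^ P := by
    intro x
    refine le_antisymm ?_ (iSup_le fun n => ENNReal.rpow_le_rpow (hTS n x) hP0.le)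
    obtain ⟨n₀, hn₀⟩ := Set.mem_iUnion.1 (by
      rw [iUnion_spanningSets (volume : Measure E)]; exact Set.mem_univ x)
    refine le_of_forall_lt fun c hc => ?_
    have h2 : c ^ (1 / P) < S x := by
      rw [one_div, ENNReal.rpow_inv_lt_iff hP0]; exact hc
    obtain ⟨n₁, hn₁⟩ := ENNReal.exists_nat_gt (h2.ne_top)
    have h3 : c ^ (1 / P) < T (max n₀ n₁) x := by
      have hx : x ∈ s (max n₀ n₁) := monotone_spanningSets _ (le_max_left _ _) hn₀
      simp only [T, Set.indicator_of_mem hx]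
      refine lt_min h2 (hn₁.trans_le ?_)
      exact_mod_cast le_max_right _ _
    rw [one_div, ENNReal.rpow_inv_lt_iff hP0] at h3
    exact h3.trans_le (le_iSup (fun n => T n x ^ P) _)
  rw [lpn, one_div, ENNReal.rpow_inv_le_iff hP0]
  simp only [hsup]
  rw [lintegral_iSup (fun n => (hTm n).pow_const P)
    (fun m n hmn x => ENNReal.rpow_le_rpow (hmono hmn x) hP0.le)]
  exact iSup_le hTle

/-! ### Young's inequality -/

/-- Hölder's inequality with three factors: `f g = (f^p g^q)^{1/s} (f^p)^{1/p-1/s} (g^q)^{1/q-1/s}`,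
and the outer exponents add up to `1` by `hpqs`. Raised to the power `s`, only the first factor
depends on `x`, and Tonelli's theorem integrates it. -/
theorem lpn_convolution_le {E : Type*} [NormedAddCommGroup E] [MeasureSpace E] [BorelSpace E]
    [SecondCountableTopology E] [SigmaFinite (volume : Measure E)]
    [(volume : Measure E).IsAddLeftInvariant] [(volume : Measure E).IsNegInvariant]
    {p q s : ℝ} (hp : 1 ≤ p) (hq : 1 ≤ q) (hs : 1 ≤ s) (hpqs : 1 + 1 / s = 1 / p + 1 / q)
    {f g : E → ℝ≥0∞} (hf : Measurable f) (hg : Measurable g) :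
    lpn s (fun x => ∫⁻ y, f y * g (x - y)) ≤ lpn p f * lpn q g := by
  have hp0 : 0 < p := by linarith
  have hq0 : 0 < q := by linarith
  have hs0 : 0 < s := by linarith
  have hq1 : 1 / q ≤ 1 := by rw [div_le_one hq0]; exact hq
  have hp1 : 1 / p ≤ 1 := by rw [div_le_one hp0]; exact hp
  have hα : 0 ≤ 1 / p - 1 / s := by linarith
  have hβ : 0 ≤ 1 / q - 1 / s := by linarith
  have hσ : 0 ≤ 1 / s := by positivity
  have hpt : ∀ x, ∫⁻ y, f y * g (x - y) ≤ (∫⁻ y, f y ^ p * g (x - y) ^ q) ^ (1 / s) *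
      ((∫⁻ y, f y ^ p) ^ (1 / p - 1 / s) * (∫⁻ y, g y ^ q) ^ (1 / q - 1 / s)) := by
    intro x
    have hgx : Measurable (fun y => g (x - y)) := hg.comp (measurable_const.sub measurable_id)
    have h := ENNReal.lintegral_prod_norm_pow_le (μ := (volume : Measure E))
      (Finset.univ : Finset (Fin 3))
      (f := ![fun y => f y ^ p * g (x - y) ^ q, fun y => f y ^ p, fun y => g (x - y) ^ q])
      (p := ![1 / s, 1 / p - 1 / s, 1 / q - 1 / s]) (by
        intro i _
        fin_cases i
        · exact ((hf.pow_const p).mul (hgx.pow_const q)).aemeasurable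
        · exact (hf.pow_const p).aemeasurable
        · exact (hgx.pow_const q).aemeasurable) (by
        simp [Fin.sum_univ_three] at hpqs ⊢; linarith) (by
        intro i _
        fin_cases i
        · exact hσ
        · exact hα
        · exact hβ)
    simp only [Fin.prod_univ_three, Matrix.cons_val_zero, Matrix.cons_val_one,
      Matrix.cons_val] at h
    rw [lintegral_sub_left_eq_self (fun y => g y ^ q) x, mul_assoc] at h
    refine le_trans (le_of_eq ?_) h
    congr 1; ext y
    rw [ENNReal.mul_rpow_of_nonneg _ _ hσ]
    have e1 : f y = (f y ^ p) ^ (1 / s) * (f y ^ p) ^ (1 / p - 1 / s) := by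
      rw [← ENNReal.rpow_add_of_nonneg _ _ hσ hα, ← ENNReal.rpow_mul]
      have : p * (1 / s + (1 / p - 1 / s)) = 1 := by field_simp; ring
      rw [this, ENNReal.rpow_one]
    have e2 : g (x - y) = (g (x - y) ^ q) ^ (1 / s) * (g (x - y) ^ q) ^ (1 / q - 1 / s) := by
      rw [← ENNReal.rpow_add_of_nonneg _ _ hσ hβ, ← ENNReal.rpow_mul]
      have : q * (1 / s + (1 / q - 1 / s)) = 1 := by field_simp; ring
      rw [this, ENNReal.rpow_one]
    nth_rewrite 1 [e1]
    nth_rewrite 1 [e2]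
    ring
  set A := ∫⁻ y, f y ^ p with hA
  set B := ∫⁻ y, g y ^ q with hB
  have hTon : ∫⁻ x, ∫⁻ y, f y ^ p * g (x - y) ^ q = A * B := by
    rw [lintegral_lintegral_swap]
    · have : ∀ y, ∫⁻ x, f y ^ p * g (x - y) ^ q = f y ^ p * B := by
        intro y
        have hgy : Measurable (fun x => g (x - y)) :=
          hg.comp (measurable_id.sub measurable_const)
        rw [lintegral_const_mul _ (hgy.pow_const q)]
        congr 1
        have := lintegral_sub_right_eq_self (μ := (volume : Measure E)) (fun x => g x ^ q) y
        exact this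
      simp only [this]
      rw [lintegral_mul_const _ (hf.pow_const p)]
    · exact (((hf.comp measurable_snd).pow_const p).mul
        ((hg.comp (measurable_fst.sub measurable_snd)).pow_const q)).aemeasurable
  have hmeas : Measurable (fun x => ∫⁻ y, f y ^ p * g (x - y) ^ q) :=
    Measurable.lintegral_prod_right' (f := fun z : E × E => f z.2 ^ p * g (z.1 - z.2) ^ q)
      (((hf.comp measurable_snd).pow_const p).mul
        ((hg.comp (measurable_fst.sub measurable_snd)).pow_const q))
  have hfin : ∫⁻ x, (∫⁻ y, f y * g (x - y)) ^ s ≤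
      A * B * (A ^ (1 / p - 1 / s) * B ^ (1 / q - 1 / s)) ^ s := by
    calc _ ≤ ∫⁻ x, (∫⁻ y, f y ^ p * g (x - y) ^ q) *
          (A ^ (1 / p - 1 / s) * B ^ (1 / q - 1 / s)) ^ s := by
          refine lintegral_mono fun x => (ENNReal.rpow_le_rpow (hpt x) hs0.le).trans (le_of_eq ?_)
          rw [ENNReal.mul_rpow_of_nonneg _ _ hs0.le, ← ENNReal.rpow_mul, one_div_mul_cancel hs0.ne',
            ENNReal.rpow_one]
      _ = _ := by rw [lintegral_mul_const _ hmeas, hTon]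
  calc lpn s (fun x => ∫⁻ y, f y * g (x - y))
      ≤ (A * B * (A ^ (1 / p - 1 / s) * B ^ (1 / q - 1 / s)) ^ s) ^ (1 / s) :=
        ENNReal.rpow_le_rpow hfin hσ
    _ = (A ^ (1 / s) * A ^ (1 / p - 1 / s)) * (B ^ (1 / s) * B ^ (1 / q - 1 / s)) := by
        rw [ENNReal.mul_rpow_of_nonneg _ _ hσ, ENNReal.mul_rpow_of_nonneg _ _ hσ,
          ← ENNReal.rpow_mul _ s, mul_one_div_cancel hs0.ne', ENNReal.rpow_one]
        ring
    _ = _ := by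
        rw [← ENNReal.rpow_add_of_nonneg _ _ hσ hα, ← ENNReal.rpow_add_of_nonneg _ _ hσ hβ]
        simp [lpn, hA, hB]

/-! ### Embeddings for slowly varying functions -/

section Embedding
variable {E : Type*} [NormedAddCommGroup E] [NormedSpace ℝ E] [FiniteDimensional ℝ E]
  [MeasureSpace E] [BorelSpace E] [(volume : Measure E).IsAddHaarMeasure]

/-- On the unit ball around `z` the function is at least `e^{-a} N z`; it remains to integrate `N^p`
over that ball. -/
theorem SlowlyVarying.exists_le_lpn {a p : ℝ} (ha : 0 ≤ a) (hp : 0 < p) :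
    ∃ C : ℝ≥0, ∀ N : E → ℝ≥0∞, SlowlyVarying a N → ∀ z, N z ≤ C * lpn p N := by
  set V := volume (Metric.ball (0 : E) 1) with hV
  have hV0 : V ≠ 0 := (Metric.measure_ball_pos volume _ one_pos).ne'
  have hVt : V ≠ ∞ := measure_ball_lt_top.ne
  set K : ℝ≥0∞ := ENNReal.ofReal (Real.exp a) ^ p / V with hK
  have hKt : K ≠ ∞ := ENNReal.div_ne_top
    (ENNReal.rpow_ne_top_of_nonneg hp.le ENNReal.ofReal_ne_top) hV0
  have hKt' : K ^ (1 / p) ≠ ∞ := ENNReal.rpow_ne_top_of_nonneg (by positivity) hKt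
  refine ⟨(K ^ (1 / p)).toNNReal, fun N hN z => ?_⟩
  rw [ENNReal.coe_toNNReal hKt', lpn, ← ENNReal.mul_rpow_of_nonneg _ _ (by positivity), one_div,
    ENNReal.le_rpow_inv_iff hp]
  have h1 : N z ^ p * V ≤ ENNReal.ofReal (Real.exp a) ^ p * ∫⁻ x, N x ^ p := by
    calc N z ^ p * V = ∫⁻ u in Metric.ball (0 : E) 1, N z ^ p := by rw [setLIntegral_const]
      _ ≤ ∫⁻ u in Metric.ball (0 : E) 1, ENNReal.ofReal (Real.exp a) ^ p * N (z + u) ^ p := by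
          refine setLIntegral_mono' measurableSet_ball fun u hu => ?_
          rw [← ENNReal.mul_rpow_of_nonneg _ _ hp.le]
          refine ENNReal.rpow_le_rpow ?_ hp.le
          have h2 := hN (z + u) (-u)
          rw [add_neg_cancel_right, expw_neg_right] at h2
          refine h2.trans ?_
          gcongr
          refine ENNReal.ofReal_le_ofReal (Real.exp_le_exp.2 ?_)
          have : ‖u‖ ≤ 1 := by simpa using (Metric.mem_ball.1 hu).le
          exact mul_le_of_le_one_right ha this
      _ ≤ ∫⁻ u, ENNReal.ofReal (Real.exp a) ^ p * N (z + u) ^ p := setLIntegral_le_lintegral _ _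
      _ = _ := by
          rw [lintegral_const_mul' _ _ (ENNReal.rpow_ne_top_of_nonneg hp.le ENNReal.ofReal_ne_top),
            lintegral_add_left_eq_self (fun u => N u ^ p) z]
  calc N z ^ p = N z ^ p * V / V := (ENNReal.mul_div_cancel_right hV0 hVt).symm
    _ ≤ (ENNReal.ofReal (Real.exp a) ^ p * ∫⁻ x, N x ^ p) / V := by gcongr
    _ = _ := by rw [hK, ENNReal.mul_div_right_comm]

/-- Being bounded by its `L^p` quasi-norm, `N` satisfies `N^s ≤ N^p (D‖N‖_p)^{s-p}`. This is the
embedding known for sequences, slow variation playing the role of discreteness. -/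
theorem SlowlyVarying.exists_lpn_le {a p s : ℝ} (ha : 0 ≤ a) (hp : 0 < p) (hps : p ≤ s) :
    ∃ C : ℝ≥0, ∀ N : E → ℝ≥0∞, SlowlyVarying a N → lpn s N ≤ C * lpn p N := by
  obtain ⟨C, hC⟩ := SlowlyVarying.exists_le_lpn (E := E) ha hp
  have hs : 0 < s := by linarith
  -- A constant at least `1` is nonzero, which settles the case of an infinite quasi-norm, and
  -- permits `L ≤ D L` below.
  refine ⟨max 1 C, fun N hN => ?_⟩
  set D : ℝ≥0 := max 1 C
  have hD : ∀ z, N z ≤ D * lpn p N := fun z => (hC N hN z).trans (by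
    gcongr; exact le_max_right _ _)
  set L := lpn p N with hL
  rcases eq_or_ne L ∞ with htop | htop
  · rw [htop, ENNReal.mul_top]
    · exact le_top
    · have : (1 : ℝ≥0) ≤ D := le_max_left _ _
      have : (0 : ℝ≥0) < D := by positivity
      exact_mod_cast this.ne'
  have hDL : (D : ℝ≥0∞) * L ≠ ∞ := ENNReal.mul_ne_top ENNReal.coe_ne_top htop
  have h1L : L ≤ D * L := by
    have : (1 : ℝ≥0∞) ≤ D := by exact_mod_cast le_max_left 1 C
    exact le_mul_of_one_le_left zero_le this
  rw [lpn, one_div, ENNReal.rpow_inv_le_iff hs]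
  calc ∫⁻ x, N x ^ s = ∫⁻ x, N x ^ p * N x ^ (s - p) := by
        congr 1; ext x
        rw [← ENNReal.rpow_add_of_nonneg _ _ hp.le (by linarith)]; ring_nf
    _ ≤ ∫⁻ x, N x ^ p * (D * L) ^ (s - p) := by
        refine lintegral_mono fun x => ?_
        gcongr
        exact hD x
    _ = L ^ p * (D * L) ^ (s - p) := by
        rw [lintegral_mul_const' _ _ (ENNReal.rpow_ne_top_of_nonneg (by linarith) hDL),
          hL, lpn_rpow hp]
    _ ≤ (D * L) ^ p * (D * L) ^ (s - p) := by gcongr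
    _ = _ := by rw [← ENNReal.rpow_add_of_nonneg _ _ hp.le (by linarith)]; ring_nf

end Embedding


/-! ### Peetre's maximal function -/

/-- Peetre's maximal function of `F`. -/
noncomputable def peetre {E : Type*} [NormedAddCommGroup E] (a : ℝ) (F : E → ℝ≥0∞) (z : E) : ℝ≥0∞ :=
  ⨆ w, F w * expw (-a) (z - w)

section Peetre
variable {E : Type*} [NormedAddCommGroup E] {a : ℝ} {F : E → ℝ≥0∞}

theorem le_peetre (z : E) : F z ≤ peetre a F z := by
  calc F z = F z * expw (-a) (z - z) := by simp [expw_zero_right]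
    _ ≤ _ := le_iSup (fun w => F w * expw (-a) (z - w)) z

theorem slowlyVarying_peetre (ha : 0 ≤ a) : SlowlyVarying a (peetre a F) := fun z u => by
  refine iSup_le fun w => ?_
  calc F w * expw (-a) (z + u - w) ≤ F w * (expw a u * expw (-a) (z - w)) := by
        gcongr
        rw [add_sub_right_comm]
        exact expw_neg_add_le ha _ _
    _ = expw a u * (F w * expw (-a) (z - w)) := by ring
    _ ≤ _ := by gcongr; exact le_iSup (fun w => F w * expw (-a) (z - w)) w

/-- By the triangle inequality the hypothesis on `F` passes to the maximal function `M`: it is at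
most `K` times the integral of `y(w) = F(w) e^{-a|z-w|}`. Since `y ≤ M`, one has `y ≤ y^r M^{1-r}`,
and division by the finite `M^{1-r}` gives the claim. -/
theorem peetre_rpow_le_of_ne_top [MeasureSpace E] (ha : 0 ≤ a) {r : ℝ} (hr0 : 0 < r) (hr1 : r ≤ 1)
    {K : ℝ≥0∞} (hF : ∀ z, F z ≤ K * ∫⁻ w, F w * expw (-a) (w - z)) {z : E}
    (hM : peetre a F z ≠ ∞) :
    peetre a F z ^ r ≤ K * ∫⁻ w, F w ^ r * expw (-(a * r)) (z - w) := by
  set M := peetre a F z with hMdef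
  set I := ∫⁻ w, F w ^ r * expw (-(a * r)) (z - w) with hI
  have hM1 : M ^ (1 - r) ≠ ∞ := ENNReal.rpow_ne_top_of_nonneg (by linarith) hM
  have h1 : M ≤ K * I * M ^ (1 - r) := by
    refine iSup_le fun w' => ?_
    have h2 : ∫⁻ w, F w * expw (-a) (z - w) ≤ I * M ^ (1 - r) := by
      rw [← lintegral_mul_const' _ _ hM1]
      refine lintegral_mono fun w => ?_
      set y := F w * expw (-a) (z - w) with hy
      calc y = y ^ r * y ^ (1 - r) := by
            rw [← ENNReal.rpow_add_of_nonneg _ _ hr0.le (by linarith), add_sub_cancel,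
              ENNReal.rpow_one]
        _ ≤ y ^ r * M ^ (1 - r) := by
            gcongr
            exact le_iSup (fun w => F w * expw (-a) (z - w)) w
        _ = _ := by rw [hy, ENNReal.mul_rpow_of_nonneg _ _ hr0.le, expw_rpow, neg_mul]
    calc F w' * expw (-a) (z - w') ≤ K * (∫⁻ w, F w * expw (-a) (w - w')) * expw (-a) (z - w') := by
          gcongr; exact hF w'
      _ = K * ∫⁻ w, F w * expw (-a) (w - w') * expw (-a) (z - w') := by
          rw [mul_assoc, lintegral_mul_const' _ _ (expw_ne_top _ _)]
      _ ≤ K * ∫⁻ w, F w * expw (-a) (z - w) := by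
          refine mul_le_mul' le_rfl (lintegral_mono fun w => ?_)
          rw [mul_assoc, expw_sub_comm (-a) w w']
          refine mul_le_mul' le_rfl ?_
          refine (expw_neg_mul_le ha _ _).trans (le_of_eq ?_)
          congr 1; abel
      _ ≤ _ := by rw [mul_assoc]; gcongr
  rcases eq_or_ne M 0 with h0 | h0
  · rw [h0, ENNReal.zero_rpow_of_pos hr0]; exact zero_le
  refine (ENNReal.mul_le_mul_iff_left (ENNReal.rpow_pos (pos_iff_ne_zero.2 h0) hM).ne' hM1).1 ?_
  rw [← ENNReal.rpow_add_of_nonneg _ _ hr0.le (by linarith), add_sub_cancel, ENNReal.rpow_one]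
  exact h1

/-- Finiteness is now derived. By the growth bound the maximal function at the larger rate `b =
max(a, R)` is finite, so `F^r ≤ K(b) I`; as `I` is slowly varying, the maximal function at the rate
`a` is finite wherever `I` is. The final bound is then taken at the rate `a`, so that its constant
does not involve `C` and `R`, which will depend on the distribution. -/
theorem peetre_rpow_le [MeasureSpace E] (ha : 0 < a) {r : ℝ} (hr0 : 0 < r) (hr1 : r ≤ 1)
    {K : ℝ → ℝ≥0} (hF : ∀ a, 0 < a → ∀ z, F z ≤ K a * ∫⁻ w, F w * expw (-a) (w - z))
    {C : ℝ≥0} {R : ℝ} (hR : 0 ≤ R) (hgrowth : ∀ z, F z ≤ C * expw R z) (z : E) :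
    peetre a F z ^ r ≤ (K a + 1 : ℝ≥0) * ∫⁻ w, F w ^ r * expw (-(a * r)) (z - w) := by
  set I : E → ℝ≥0∞ := fun z => ∫⁻ w, F w ^ r * expw (-(a * r)) (z - w) with hI
  change _ ≤ _ * I z
  rcases eq_or_ne (I z) ∞ with htop | htop
  -- The summand `1` in `K a + 1` makes the constant nonzero, so that the right side is infinite
  -- here.
  · rw [htop, ENNReal.mul_top (by exact_mod_cast (by positivity : K a + 1 ≠ 0))]
    exact le_top
  set b := max a R with hb
  have hb0 : 0 < b := lt_max_of_lt_left ha
  have hMb : ∀ z, peetre b F z ≠ ∞ := by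
    intro z
    refine ne_top_of_le_ne_top (ENNReal.mul_ne_top (ENNReal.coe_ne_top (r := C))
      (expw_ne_top R z)) (iSup_le fun w => ?_)
    calc F w * expw (-b) (z - w) ≤ C * expw R w * expw (-R) (z - w) := by
          gcongr
          · exact hgrowth w
          · exact expw_mono (neg_le_neg (le_max_right _ _)) _
      _ ≤ C * (expw R z * expw R (z - w)) * expw (-R) (z - w) := by
          gcongr
          have := expw_add_le hR z (-(z - w))
          rwa [expw_neg_right, neg_sub, add_sub_cancel] at this
      _ = C * expw R z * (expw R (z - w) * expw (-R) (z - w)) := by ring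
      _ = _ := by rw [expw_mul_expw_neg, mul_one]
  have hle : ∀ w, F w ^ r ≤ K b * I w := fun w =>
    calc F w ^ r ≤ peetre b F w ^ r := by gcongr; exact le_peetre w
      _ ≤ K b * ∫⁻ u, F u ^ r * expw (-(b * r)) (w - u) :=
          peetre_rpow_le_of_ne_top hb0.le hr0 hr1 (hF b hb0) (hMb w)
      _ ≤ _ := by
          simp only [hI]
          gcongr with u
          exact expw_mono (by
            rw [neg_le_neg_iff]; exact mul_le_mul_of_nonneg_right (le_max_left _ _) hr0.le) _
  have hIsv : SlowlyVarying (a * r) I := slowlyVarying_convolution (by positivity) _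
  have hfin : peetre a F z ≤ (K b * I z) ^ (1 / r) := by
    refine iSup_le fun w => ?_
    rw [one_div, ENNReal.le_rpow_inv_iff hr0, ENNReal.mul_rpow_of_nonneg _ _ hr0.le, expw_rpow,
      neg_mul]
    calc F w ^ r * expw (-(a * r)) (z - w) ≤ K b * (expw (a * r) (z - w) * I z) *
          expw (-(a * r)) (z - w) := by
          gcongr
          refine (hle w).trans ?_
          gcongr
          rw [expw_sub_comm]
          exact hIsv.le_mul w z
      _ = K b * I z * (expw (a * r) (z - w) * expw (-(a * r)) (z - w)) := by ring
      _ = _ := by rw [expw_mul_expw_neg, mul_one]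
  have hMa : peetre a F z ≠ ∞ := ne_top_of_le_ne_top
    (ENNReal.rpow_ne_top_of_nonneg (by positivity) (ENNReal.mul_ne_top ENNReal.coe_ne_top htop)) hfin
  refine (peetre_rpow_le_of_ne_top ha.le hr0 hr1 (hF a ha) hMa).trans ?_
  gcongr
  exact le_self_add

end Peetre

/-! ### Maximal functions of short-time Fourier transforms -/

namespace GSDistribution
open GelfandShilov

theorem exists_peetre_rpow_le {d : ℕ} {φ : GelfandShilov d} (hφ : φ ≠ 0) {a r : ℝ} (ha : 0 < a)
    (hr0 : 0 < r) (hr1 : r ≤ 1) : ∃ K : ℝ≥0, ∀ (f : GSDistribution d) (z : Rd d × Rd d),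
      peetre a (fun w => ‖wval φ f w‖ₑ) z ^ r ≤
        K * ∫⁻ w, ‖wval φ f w‖ₑ ^ r * expw (-(a * r)) (z - w) := by
  have h1 : ∀ a : ℝ, ∃ K : ℝ≥0, 0 < a → ∀ (f : GSDistribution d) (w : Rd d × Rd d),
      ‖wval φ f w‖ₑ ≤ K * ∫⁻ z, ‖wval φ f z‖ₑ * expw (-a) (z - w) := by
    intro a
    by_cases ha : 0 < a
    · obtain ⟨K, hK⟩ := enorm_wval_le hφ φ ha
      exact ⟨K, fun _ => hK⟩
    · exact ⟨0, fun h => absurd h ha⟩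
  choose K hK using h1
  refine ⟨K a + 1, fun f z => ?_⟩
  obtain ⟨C, R, hC, hR, hf⟩ := norm_wval_le φ f
  refine peetre_rpow_le (K := K) (C := C.toNNReal) (R := R) ha hr0 hr1
    (fun a ha z => hK a ha f z) hR.le (fun z => ?_) z
  rw [← ofReal_norm, expw]
  change _ ≤ ENNReal.ofReal C * _
  rw [← ENNReal.ofReal_mul hC]
  exact ENNReal.ofReal_le_ofReal (hf z)

/-- Change of window at the rate `a + 1`: the part `a` goes into the supremum and the remaining
exponential is integrable. -/
theorem exists_enorm_wval_le_peetre {d : ℕ} {φ : GelfandShilov d} (hφ : φ ≠ 0)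
    (θ : GelfandShilov d) {a : ℝ} (ha : 0 < a) : ∃ K : ℝ≥0, ∀ (f : GSDistribution d)
      (z : Rd d × Rd d), ‖wval θ f z‖ₑ ≤ K * peetre a (fun w => ‖wval φ f w‖ₑ) z := by
  obtain ⟨C, hC⟩ := enorm_wval_le hφ θ (a := a + 1) (by positivity)
  have hfin := lintegral_expw_neg_ne_top (E := Rd d × Rd d) one_pos
  refine ⟨C * (∫⁻ z : Rd d × Rd d, expw (-1) z).toNNReal, fun f w => (hC f w).trans ?_⟩
  rw [ENNReal.coe_mul, ENNReal.coe_toNNReal hfin, mul_assoc]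
  gcongr
  rw [← lintegral_sub_right_eq_self (fun z : Rd d × Rd d => expw (-1) z) w,
    ← lintegral_mul_const _ (show Measurable fun z : Rd d × Rd d => expw (-1) (z - w) from
      ((continuous_expw (-1)).comp (f := fun z : Rd d × Rd d => z - w) (by fun_prop)).measurable)]
  refine lintegral_mono fun z => ?_
  have : expw (-(a + 1)) (z - w) = expw (-1) (z - w) * expw (-a) (w - z) := by
    rw [expw_sub_comm (-a), expw_mul_expw]; ring_nf
  rw [this, mul_left_comm]
  exact mul_le_mul' le_rfl (le_iSup (fun z => ‖wval φ f z‖ₑ * expw (-a) (w - z)) z)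

end GSDistribution

/-! ### Mixed quasi-norms -/

/-- The mixed quasi-norm of a function with values in `[0, ∞]`. -/
noncomputable def mix {d : ℕ} (p q : ℝ) (N : Rd d × Rd d → ℝ≥0∞) : ℝ≥0∞ :=
  lpn q (fun ξ => lpn p (fun x => N (x, ξ)))

section Mix
variable {d : ℕ} {p q : ℝ} {N M : Rd d × Rd d → ℝ≥0∞}

theorem mix_mono (hp : 0 < p) (hq : 0 < q) (h : ∀ z, N z ≤ M z) : mix p q N ≤ mix p q M :=
  lpn_mono hq fun _ => lpn_mono hp fun _ => h _

theorem mix_const_mul (hp : 0 < p) (hq : 0 < q) {c : ℝ≥0∞} (hc : c ≠ ∞) :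
    mix p q (fun z => c * N z) = c * mix p q N := by
  simp only [mix, lpn_const_mul hp hc, lpn_const_mul hq hc]

theorem mix_div_rpow {r : ℝ} (hr : 0 < r) :
    mix (p / r) (q / r) (fun z => N z ^ r) = mix p q N ^ r := by
  simp only [mix, lpn_div_rpow hr]

theorem measurable_lpn_section (hN : Measurable N) :
    Measurable (fun ξ => lpn p (fun x => N (x, ξ))) :=
  (Measurable.lintegral_prod_left' (hN.pow_const p)).pow_const _

theorem mix_add_le (hp : 0 < p) (hq : 0 < q) : ∃ κ : ℝ≥0, ∀ N M : Rd d × Rd d → ℝ≥0∞,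
    Measurable N → mix p q (fun z => N z + M z) ≤ κ * (mix p q N + mix p q M) := by
  have hp2 : (2 * 2 ^ (1 / p) : ℝ≥0∞) ≠ ∞ := ENNReal.mul_ne_top (by simp)
    (ENNReal.rpow_ne_top_of_nonneg (by positivity) (by simp))
  have hq2 : (2 * 2 ^ (1 / q) : ℝ≥0∞) ≠ ∞ := ENNReal.mul_ne_top (by simp)
    (ENNReal.rpow_ne_top_of_nonneg (by positivity) (by simp))
  refine ⟨(2 * 2 ^ (1 / p) * (2 * 2 ^ (1 / q)) : ℝ≥0∞).toNNReal, fun N M hN => ?_⟩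
  rw [ENNReal.coe_toNNReal (ENNReal.mul_ne_top hp2 hq2)]
  calc mix p q (fun z => N z + M z)
      ≤ lpn q (fun ξ => (2 * 2 ^ (1 / p)) * (lpn p (fun x => N (x, ξ)) +
          lpn p (fun x => M (x, ξ)))) :=
        lpn_mono hq fun ξ => lpn_add_le hp (hN.comp measurable_prodMk_right).aemeasurable _
    _ = (2 * 2 ^ (1 / p)) * lpn q (fun ξ => lpn p (fun x => N (x, ξ)) +
          lpn p (fun x => M (x, ξ))) := lpn_const_mul hq hp2 _
    _ ≤ (2 * 2 ^ (1 / p)) * (2 * 2 ^ (1 / q) * (mix p q N + mix p q M)) := by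
        gcongr
        exact lpn_add_le hq (measurable_lpn_section hN).aemeasurable _
    _ = _ := by ring

theorem expw_neg_prod_le {b : ℝ} (hb : 0 ≤ b) (u v : Rd d) :
    expw (-b) (u, v) ≤ expw (-(b / 2)) u * expw (-(b / 2)) v := by
  rw [expw, expw, expw, ← ENNReal.ofReal_mul (Real.exp_pos _).le, ← Real.exp_add]
  refine ENNReal.ofReal_le_ofReal (Real.exp_le_exp.2 ?_)
  have h1 := norm_fst_le (u, v)
  have h2 := norm_snd_le (u, v)
  simp only at h1 h2
  nlinarith [mul_le_mul_of_nonneg_left (add_le_add h1 h2) hb]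

theorem lpn_convolution_expw_le {P : ℝ} (hP : 1 ≤ P) (c : ℝ) {g : Rd d → ℝ≥0∞}
    (hg : Measurable g) : lpn P (fun x => ∫⁻ y, g y * expw c (x - y)) ≤
      lpn P g * ∫⁻ y : Rd d, expw c y := by
  have := lpn_convolution_le hP le_rfl hP (by simp [add_comm]) hg
    (continuous_expw (E := Rd d) c).measurable
  simpa [lpn] using this

/-- The exponential is dominated by a product of exponentials in the two variables. Minkowski's
inequality takes the inner norm under the integral in frequency, and Young's inequality with an
integrable kernel is applied once in each variable. -/
theorem mix_convolution_le {P Q : ℝ} (hP : 1 ≤ P) (hQ : 1 ≤ Q) {b : ℝ} (hb : 0 < b) :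
    ∃ C : ℝ≥0, ∀ g : Rd d × Rd d → ℝ≥0∞, Measurable g →
      mix P Q (fun z => ∫⁻ w, g w * expw (-b) (z - w)) ≤ C * mix P Q g := by
  set k : Rd d → ℝ≥0∞ := fun y => expw (-(b / 2)) y with hk
  have hkm : Measurable k := (continuous_expw _).measurable
  set I := ∫⁻ y, k y with hI
  have hIt : I ≠ ∞ := lintegral_expw_neg_ne_top (by positivity)
  have hP0 : 0 < P := by linarith
  have hQ0 : 0 < Q := by linarith
  refine ⟨(I * I).toNNReal, fun g hg => ?_⟩
  rw [ENNReal.coe_toNNReal (ENNReal.mul_ne_top hIt hIt)]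
  set A : Rd d → ℝ≥0∞ := fun η => lpn P (fun x => g (x, η)) with hA
  have hAm : Measurable A := measurable_lpn_section hg
  have hinner : Measurable (fun p : Rd d × Rd d => ∫⁻ y, g (y, p.1) * k (p.2 - y)) := by
    refine Measurable.lintegral_prod_right'
      (f := fun z : (Rd d × Rd d) × Rd d => g (z.2, z.1.1) * k (z.1.2 - z.2)) ?_
    exact (hg.comp (by fun_prop)).mul (hkm.comp (by fun_prop))
  have hpt : ∀ x ξ, ∫⁻ w, g w * expw (-b) ((x, ξ) - w) ≤
      ∫⁻ η, k (ξ - η) * ∫⁻ y, g (y, η) * k (x - y) := by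
    intro x ξ
    have hm : Measurable (fun w : Rd d × Rd d => g w * expw (-b) ((x, ξ) - w)) :=
      hg.mul ((continuous_expw (-b)).comp (by fun_prop)).measurable
    rw [Measure.volume_eq_prod, lintegral_prod_symm _ hm.aemeasurable]
    refine lintegral_mono fun η => ?_
    rw [← lintegral_const_mul' _ _ (expw_ne_top _ _)]
    refine lintegral_mono fun y => ?_
    rw [mul_left_comm, mul_comm (k (ξ - η))]
    gcongr
    exact expw_neg_prod_le hb.le _ _
  have hin : ∀ ξ, lpn P (fun x => ∫⁻ w, g w * expw (-b) ((x, ξ) - w)) ≤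
      I * ∫⁻ η, A η * k (ξ - η) := by
    intro ξ
    calc _ ≤ lpn P (fun x => ∫⁻ η, k (ξ - η) * ∫⁻ y, g (y, η) * k (x - y)) :=
          lpn_mono hP0 fun x => hpt x ξ
      _ ≤ ∫⁻ η, lpn P (fun x => k (ξ - η) * ∫⁻ y, g (y, η) * k (x - y)) :=
          lpn_lintegral_le hP (h := fun η x => k (ξ - η) * ∫⁻ y, g (y, η) * k (x - y))
            ((hkm.comp (by fun_prop)).mul hinner)
      _ = ∫⁻ η, k (ξ - η) * lpn P (fun x => ∫⁻ y, g (y, η) * k (x - y)) := by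
          simp only [lpn_const_mul hP0 (expw_ne_top _ _), hk]
      _ ≤ ∫⁻ η, I * (A η * k (ξ - η)) := by
          refine lintegral_mono fun η => ?_
          calc _ ≤ k (ξ - η) * (A η * I) := by
                gcongr
                exact lpn_convolution_expw_le hP _ (hg.comp measurable_prodMk_right)
            _ = _ := by ring
      _ = _ := lintegral_const_mul' _ _ hIt
  calc mix P Q (fun z => ∫⁻ w, g w * expw (-b) (z - w))
      ≤ lpn Q (fun ξ => I * ∫⁻ η, A η * k (ξ - η)) := lpn_mono hQ0 hin
    _ = I * lpn Q (fun ξ => ∫⁻ η, A η * k (ξ - η)) := lpn_const_mul hQ0 hIt _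
    _ ≤ I * (lpn Q A * I) := by gcongr; exact lpn_convolution_expw_le hQ _ hAm
    _ = _ := by rw [mix]; ring

/-! ### Young's and Hölder's inequalities for slowly varying functions, all positive exponents -/

namespace SlowlyVarying
variable {a : ℝ}

theorem expw_fst (a : ℝ) (u : Rd d) : expw a ((u, 0) : Rd d × Rd d) = expw a u := by
  simp [expw]

theorem expw_snd (a : ℝ) (u : Rd d) : expw a ((0, u) : Rd d × Rd d) = expw a u := by
  simp [expw]

theorem section_left (hN : SlowlyVarying a N) (ξ : Rd d) :
    SlowlyVarying a (fun x => N (x, ξ)) := fun x u => by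
  simpa [expw_fst] using hN (x, ξ) (u, 0)

theorem lpn_section (hN : SlowlyVarying a N) (hp : 0 < p) :
    SlowlyVarying a (fun ξ => lpn p (fun x => N (x, ξ))) := fun ξ u => by
  rw [← lpn_const_mul hp (expw_ne_top a u)]
  refine lpn_mono hp fun x => ?_
  simpa [expw_snd] using hN (x, ξ) (0, u)

theorem exists_le_mix (ha : 0 ≤ a) (hp : 0 < p) (hq : 0 < q) :
    ∃ C : ℝ≥0, ∀ N : Rd d × Rd d → ℝ≥0∞, SlowlyVarying a N → ∀ z, N z ≤ C * mix p q N := by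
  obtain ⟨C₁, h₁⟩ := exists_le_lpn (E := Rd d) ha hp
  obtain ⟨C₂, h₂⟩ := exists_le_lpn (E := Rd d) ha hq
  refine ⟨C₁ * C₂, fun N hN z => ?_⟩
  calc N z ≤ C₁ * lpn p (fun x => N (x, z.2)) := h₁ _ (hN.section_left z.2) z.1
    _ ≤ C₁ * (C₂ * mix p q N) := by gcongr; exact h₂ _ (hN.lpn_section hp) z.2
    _ = _ := by push_cast; ring

theorem convolution_right {E : Type*} [NormedAddCommGroup E] [MeasureSpace E] {f g : E → ℝ≥0∞}
    (hg : SlowlyVarying a g) : SlowlyVarying a (fun x => ∫⁻ y, f y * g (x - y)) := fun x u => by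
  rw [← lintegral_const_mul' _ _ (expw_ne_top a u)]
  refine lintegral_mono fun y => ?_
  rw [mul_left_comm]
  gcongr
  rw [add_sub_right_comm]
  exact hg _ _

/-- Let `1/t` be the maximum in the hypothesis. The integrand `y ↦ f(y) g(x - y)` is slowly varying,
so its `L¹` norm is controlled by its `L^t` quasi-norm, that is by `(f^t * g^t)^{1/t}`. As `p_j/t ≥
1`, Young's inequality puts `f^t * g^t` in `L^s` with `1/s = t/p₁ + t/p₂ - 1`. The hypothesis says
`s ≤ p₀/t`, and a second embedding finishes. -/
theorem exists_lpn_convolution_le (ha : 0 ≤ a) {p₀ p₁ p₂ : ℝ} (h₀ : 0 < p₀) (h₁ : 0 < p₁)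
    (h₂ : 0 < p₂) (h : 1 / p₀ ≤ 1 / p₁ + 1 / p₂ - max 1 (max (1 / p₁) (1 / p₂))) :
    ∃ C : ℝ≥0, ∀ f g : Rd d → ℝ≥0∞, SlowlyVarying a f → SlowlyVarying a g →
      lpn p₀ (fun x => ∫⁻ y, f y * g (x - y)) ≤ C * (lpn p₁ f * lpn p₂ g) := by
  set m := max 1 (max (1 / p₁) (1 / p₂)) with hm
  have hm1 : 1 ≤ m := le_max_left _ _
  have hmp₁ : 1 / p₁ ≤ m := (le_max_left _ _).trans (le_max_right _ _)
  have hmp₂ : 1 / p₂ ≤ m := (le_max_right _ _).trans (le_max_right _ _)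
  have hm0 : 0 < m := by linarith
  set t := 1 / m with ht
  have ht0 : 0 < t := by positivity
  have ht1 : t ≤ 1 := by rw [ht, div_le_one hm0]; exact hm1
  have hmt : m * t = 1 := by rw [ht]; field_simp
  have hP₁ : 1 ≤ p₁ / t := by
    rw [le_div_iff₀ ht0, one_mul, ht, div_le_iff₀ hm0]
    rwa [div_le_iff₀ h₁, mul_comm] at hmp₁
  have hP₂ : 1 ≤ p₂ / t := by
    rw [le_div_iff₀ ht0, one_mul, ht, div_le_iff₀ hm0]
    rwa [div_le_iff₀ h₂, mul_comm] at hmp₂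
  have e₁ : 1 / (p₁ / t) = t * (1 / p₁) := by field_simp
  have e₂ : 1 / (p₂ / t) = t * (1 / p₂) := by field_simp
  have hle₁ : 1 / (p₁ / t) ≤ 1 := by rw [div_le_one (by positivity)]; exact hP₁
  have hle₂ : 1 / (p₂ / t) ≤ 1 := by rw [div_le_one (by positivity)]; exact hP₂
  have hsum : 1 / (p₀ / t) ≤ 1 / (p₁ / t) + 1 / (p₂ / t) - 1 := by
    rw [e₁, e₂]
    have e₀ : 1 / (p₀ / t) = t * (1 / p₀) := by field_simp
    rw [e₀]
    have := mul_le_mul_of_nonneg_left h ht0.le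
    linarith
  have hpos : 0 < 1 / (p₀ / t) := by positivity
  set σ := 1 / (p₁ / t) + 1 / (p₂ / t) - 1 with hσ
  have hσ0 : 0 < σ := by linarith
  set s := 1 / σ with hs
  have hs1 : 1 ≤ s := by rw [hs, le_div_iff₀ hσ0]; linarith
  have hσs : 1 / s = σ := by rw [hs, one_div_one_div]
  have hsp : s ≤ p₀ / t := by
    rw [hs, div_le_iff₀ hσ0]
    rwa [div_le_iff₀ (by positivity), mul_comm] at hsum
  obtain ⟨C₁, hC₁⟩ := exists_lpn_le (E := Rd d) (a := a + a) (p := t) (s := 1) (by positivity) ht0 ht1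
  obtain ⟨C₂, hC₂⟩ := exists_lpn_le (E := Rd d) (a := a * t) (p := s) (s := p₀ / t)
    (by positivity) (by positivity) hsp
  refine ⟨C₁ * C₂ ^ (1 / t), fun f g hf hg => ?_⟩
  have hft : Measurable (fun y => f y ^ t) := hf.measurable.pow_const t
  have hgt : Measurable (fun y => g y ^ t) := hg.measurable.pow_const t
  set J : Rd d → ℝ≥0∞ := fun x => ∫⁻ y, f y ^ t * g (x - y) ^ t with hJ
  have hJsv : SlowlyVarying (a * t) J :=
    convolution_right (f := fun y => f y ^ t) (g := fun y => g y ^ t) (hg.rpow ht0.le)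
  have hpt : ∀ x, ∫⁻ y, f y * g (x - y) ≤ C₁ * J x ^ (1 / t) := by
    intro x
    have := hC₁ (fun y => f y * g (x - y)) (hf.mul (hg.comp_sub_left x))
    simpa [lpn, ENNReal.mul_rpow_of_nonneg _ _ ht0.le] using this
  have hYoung : lpn s J ≤ (lpn p₁ f * lpn p₂ g) ^ t := by
    have := lpn_convolution_le hP₁ hP₂ hs1 (by rw [hσs, hσ]; ring) hft hgt
    rwa [lpn_div_rpow ht0, lpn_div_rpow ht0, ← ENNReal.mul_rpow_of_nonneg _ _ ht0.le] at this
  have hexp : p₀ / t / (1 / t) = p₀ := by field_simp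
  have h1t : 0 < 1 / t := by positivity
  calc lpn p₀ (fun x => ∫⁻ y, f y * g (x - y)) ≤ lpn p₀ (fun x => C₁ * J x ^ (1 / t)) :=
        lpn_mono h₀ hpt
    _ = C₁ * lpn (p₀ / t) J ^ (1 / t) := by
        rw [lpn_const_mul h₀ ENNReal.coe_ne_top, ← lpn_div_rpow h1t, hexp]
    _ ≤ C₁ * (C₂ * (lpn p₁ f * lpn p₂ g) ^ t) ^ (1 / t) := by
        gcongr
        exact (hC₂ J hJsv).trans (by gcongr)
    _ = _ := by
        rw [ENNReal.mul_rpow_of_nonneg _ _ h1t.le, ← ENNReal.rpow_mul _ t, mul_one_div_cancel ht0.ne',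
          ENNReal.rpow_one, ENNReal.coe_mul, ENNReal.coe_rpow_of_nonneg _ h1t.le, mul_assoc]

/-- Convolution in the first variable. -/
theorem partialConvolution {N₁ N₂ : Rd d × Rd d → ℝ≥0∞} (ha : 0 ≤ a)
    (h₁ : SlowlyVarying a N₁) (h₂ : SlowlyVarying a N₂) :
    SlowlyVarying (a + a) (fun z : Rd d × Rd d => ∫⁻ y, N₁ (y, z.2) * N₂ (z.1 - y, z.2)) := fun z u => by
  rw [← lintegral_const_mul' _ _ (expw_ne_top _ u)]
  refine lintegral_mono fun y => ?_
  have e₁ : N₁ (y, (z + u).2) ≤ expw a u * N₁ (y, z.2) := by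
    have := h₁ (y, z.2) (0, u.2)
    rw [expw_snd] at this
    refine (le_trans (le_of_eq (by simp)) this).trans ?_
    gcongr
    exact ENNReal.ofReal_le_ofReal (Real.exp_le_exp.2 (by gcongr; exact norm_snd_le u))
  have e₂ : N₂ ((z + u).1 - y, (z + u).2) ≤ expw a u * N₂ (z.1 - y, z.2) := by
    have := h₂ (z.1 - y, z.2) u
    refine le_trans (le_of_eq ?_) this
    congr 1
    ext1
    · simp [add_sub_right_comm]
    · simp
  calc _ ≤ (expw a u * N₁ (y, z.2)) * (expw a u * N₂ (z.1 - y, z.2)) := mul_le_mul' e₁ e₂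
    _ = _ := by rw [← expw_mul_expw]; ring

/-- For each frequency the one-variable estimate applies to the sections. The resulting product of
slowly varying functions is in `L^τ`, `1/τ = 1/q₁ + 1/q₂`, by Hölder's inequality, and hence in
`L^{q₀}` because `τ ≤ q₀`. -/
theorem exists_mix_convolution_le (ha : 0 ≤ a) {p₀ p₁ p₂ q₀ q₁ q₂ : ℝ} (h₀ : 0 < p₀) (h₁ : 0 < p₁)
    (h₂ : 0 < p₂) (h : 1 / p₀ ≤ 1 / p₁ + 1 / p₂ - max 1 (max (1 / p₁) (1 / p₂)))
    (hq₀ : 0 < q₀) (hq₁ : 0 < q₁) (hq₂ : 0 < q₂) (hq : 1 / q₀ ≤ 1 / q₁ + 1 / q₂) :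
    ∃ C : ℝ≥0, ∀ N₁ N₂ : Rd d × Rd d → ℝ≥0∞, SlowlyVarying a N₁ → SlowlyVarying a N₂ →
      mix p₀ q₀ (fun z => ∫⁻ y, N₁ (y, z.2) * N₂ (z.1 - y, z.2)) ≤
        C * (mix p₁ q₁ N₁ * mix p₂ q₂ N₂) := by
  obtain ⟨C₁, hC₁⟩ := exists_lpn_convolution_le (d := d) ha h₀ h₁ h₂ h
  have hτ : 0 < 1 / q₁ + 1 / q₂ := by positivity
  set τ := 1 / (1 / q₁ + 1 / q₂) with hτdef
  have hτ0 : 0 < τ := by positivity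
  have hτq : τ ≤ q₀ := by
    rw [hτdef, div_le_iff₀ hτ]
    rwa [div_le_iff₀ hq₀, mul_comm] at hq
  have hττ : 1 / τ = 1 / q₁ + 1 / q₂ := by rw [hτdef, one_div_one_div]
  have hτ1 : τ < q₁ := by
    rw [hτdef, div_lt_iff₀ hτ, mul_add, mul_one_div_cancel hq₁.ne']
    have : 0 < q₁ * (1 / q₂) := by positivity
    linarith
  obtain ⟨C₂, hC₂⟩ := exists_lpn_le (E := Rd d) (a := a + a) (by positivity) hτ0 hτq
  refine ⟨C₁ * C₂, fun N₁ N₂ hN₁ hN₂ => ?_⟩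
  set A₁ : Rd d → ℝ≥0∞ := fun ξ => lpn p₁ (fun x => N₁ (x, ξ)) with hA₁
  set A₂ : Rd d → ℝ≥0∞ := fun ξ => lpn p₂ (fun x => N₂ (x, ξ)) with hA₂
  have hs₁ : SlowlyVarying a A₁ := hN₁.lpn_section h₁
  have hs₂ : SlowlyVarying a A₂ := hN₂.lpn_section h₂
  calc _ ≤ lpn q₀ (fun ξ => C₁ * (A₁ ξ * A₂ ξ)) :=
        lpn_mono hq₀ fun ξ => hC₁ _ _ (hN₁.section_left ξ) (hN₂.section_left ξ)
    _ = C₁ * lpn q₀ (fun ξ => A₁ ξ * A₂ ξ) := lpn_const_mul hq₀ ENNReal.coe_ne_top _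
    _ ≤ C₁ * (C₂ * lpn τ (fun ξ => A₁ ξ * A₂ ξ)) := by
        gcongr; exact hC₂ _ (hs₁.mul hs₂)
    _ ≤ C₁ * (C₂ * (lpn q₁ A₁ * lpn q₂ A₂)) := by
        gcongr
        exact ENNReal.lintegral_Lp_mul_le_Lq_mul_Lr hτ0 hτ1 hττ volume
          hs₁.measurable.aemeasurable hs₂.measurable.aemeasurable
    _ = _ := by simp only [mix]; push_cast; ring

end SlowlyVarying

/-- Dominated convergence twice: the inner one at almost every `ξ`, namely where the section of `M`
has a finite quasi-norm. -/
theorem tendsto_mix_zero (hp : 0 < p) (hq : 0 < q) {D : ℕ → Rd d × Rd d → ℝ≥0∞}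
    (hD : ∀ n, Measurable (D n)) (hM : Measurable M) (hDM : ∀ n z, D n z ≤ M z)
    (hfin : mix p q M ≠ ∞) (hlim : ∀ z, Filter.Tendsto (fun n => D n z) Filter.atTop (nhds 0)) :
    Filter.Tendsto (fun n => mix p q (D n)) Filter.atTop (nhds 0) := by
  have hcont : ∀ {t : ℝ} {u : ℕ → ℝ≥0∞}, 0 < t → Filter.Tendsto u Filter.atTop (nhds 0) →
      Filter.Tendsto (fun n => u n ^ t) Filter.atTop (nhds 0) := by
    intro t u ht hu
    have := (ENNReal.continuous_rpow_const (y := t)).continuousAt.tendsto.comp hu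
    simpa [ENNReal.zero_rpow_of_pos ht, Function.comp_def] using this
  have hA : ∫⁻ ξ, lpn p (fun x => M (x, ξ)) ^ q ≠ ∞ := by
    rw [← lpn_rpow hq]; exact ENNReal.rpow_ne_top_of_nonneg hq.le hfin
  have hAm : Measurable (fun ξ => lpn p (fun x => M (x, ξ)) ^ q) :=
    (measurable_lpn_section hM).pow_const q
  have hae := ae_lt_top hAm hA
  refine hcont (by positivity) ?_
  have h0 : ∫⁻ _ : Rd d, (0 : ℝ≥0∞) = 0 := by simp
  rw [← h0]
  refine tendsto_lintegral_of_dominated_convergence _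
    (fun n => (measurable_lpn_section (hD n)).pow_const q)
    (fun n => Filter.Eventually.of_forall fun ξ =>
      ENNReal.rpow_le_rpow (lpn_mono hp fun x => hDM n (x, ξ)) hq.le) hA ?_
  filter_upwards [hae] with ξ hξ
  refine hcont hq (hcont (by positivity) ?_)
  rw [← h0]
  refine tendsto_lintegral_of_dominated_convergence (fun x => M (x, ξ) ^ p)
    (fun n => ((hD n).comp measurable_prodMk_right).pow_const p)
    (fun n => Filter.Eventually.of_forall fun x => ENNReal.rpow_le_rpow (hDM n (x, ξ)) hp.le) ?_
    (Filter.Eventually.of_forall fun x => hcont hp (hlim (x, ξ)))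
  rw [← lpn_rpow hp]
  refine ENNReal.rpow_ne_top_of_nonneg hp.le fun h => ?_
  rw [h, ENNReal.top_rpow_of_pos hq] at hξ
  exact lt_irrefl _ hξ

end Mix

/-! ### Mixed quasi-norm bound for the maximal function -/

namespace GSDistribution
open GelfandShilov

/-- The `r`-th power of the maximal function is bounded by a convolution of `|W_φ f|^r` with an
exponential. Moving the weight under the convolution lowers the rate from `ar` to `(a - b)r`, still
positive as `b < a`. For `r = min(1, p, q)` the exponents `p/r`, `q/r` are at least `1`, where
convolution with an exponential is bounded. -/
theorem exists_mix_peetre_le {d : ℕ} {φ : GelfandShilov d} (hφ : φ ≠ 0) {a b p q : ℝ}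
    (hb : 0 ≤ b) (hab : b < a) (hp : 0 < p) (hq : 0 < q) {W : Rd d × Rd d → ℝ≥0∞}
    (hW : SlowlyVarying b W) (hWt : ∀ z, W z ≠ ∞) : ∃ K : ℝ≥0, ∀ f : GSDistribution d,
      mix p q (fun z => peetre a (fun w => ‖wval φ f w‖ₑ) z * W z) ≤
        K * mix p q (fun z => ‖wval φ f z‖ₑ * W z) := by
  set r := min 1 (min p q) with hr
  have hr0 : 0 < r := lt_min one_pos (lt_min hp hq)
  have hr1 : r ≤ 1 := min_le_left _ _
  have hP : 1 ≤ p / r := by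
    rw [le_div_iff₀ hr0, one_mul]; exact (min_le_right _ _).trans (min_le_left _ _)
  have hQ : 1 ≤ q / r := by
    rw [le_div_iff₀ hr0, one_mul]; exact (min_le_right _ _).trans (min_le_right _ _)
  obtain ⟨K₁, hK₁⟩ := exists_peetre_rpow_le hφ (hb.trans_lt hab) hr0 hr1
  obtain ⟨K₂, hK₂⟩ := mix_convolution_le (d := d) hP hQ (b := (a - b) * r)
    (mul_pos (by linarith) hr0)
  have hpr : 0 < p / r := by positivity
  have hqr : 0 < q / r := by positivity
  refine ⟨(K₁ * K₂) ^ (1 / r), fun f => ?_⟩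
  have hFm : Measurable (fun z => ‖wval φ f z‖ₑ) := (continuous_wval φ f).enorm.measurable
  set G : Rd d × Rd d → ℝ≥0∞ := fun w => (‖wval φ f w‖ₑ * W w) ^ r with hG
  have hGm : Measurable G := (hFm.mul hW.measurable).pow_const r
  have hpt : ∀ z, (peetre a (fun w => ‖wval φ f w‖ₑ) z * W z) ^ r ≤
      K₁ * ∫⁻ w, G w * expw (-((a - b) * r)) (z - w) := by
    intro z
    rw [ENNReal.mul_rpow_of_nonneg _ _ hr0.le]
    calc _ ≤ (K₁ * ∫⁻ w, ‖wval φ f w‖ₑ ^ r * expw (-(a * r)) (z - w)) * W z ^ r := by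
          gcongr; exact hK₁ f z
      _ = K₁ * ∫⁻ w, ‖wval φ f w‖ₑ ^ r * expw (-(a * r)) (z - w) * W z ^ r := by
          rw [mul_assoc, lintegral_mul_const' _ _ (ENNReal.rpow_ne_top_of_nonneg hr0.le (hWt z))]
      _ ≤ _ := by
          refine mul_le_mul' le_rfl (lintegral_mono fun w => ?_)
          calc _ ≤ ‖wval φ f w‖ₑ ^ r * expw (-(a * r)) (z - w) * (expw b (z - w) * W w) ^ r := by
                refine mul_le_mul' le_rfl (ENNReal.rpow_le_rpow ?_ hr0.le)
                exact hW.le_mul z w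
            _ = (‖wval φ f w‖ₑ * W w) ^ r * expw (-((a - b) * r)) (z - w) := by
                rw [ENNReal.mul_rpow_of_nonneg _ _ hr0.le, expw_rpow,
                  ENNReal.mul_rpow_of_nonneg _ _ hr0.le]
                have : expw (-((a - b) * r)) (z - w) =
                    expw (-(a * r)) (z - w) * expw (b * r) (z - w) := by
                  rw [expw_mul_expw]; ring_nf
                rw [this]; ring
  have hmix : mix p q (fun z => peetre a (fun w => ‖wval φ f w‖ₑ) z * W z) ^ r ≤
      (K₁ * K₂ : ℝ≥0) * mix p q (fun z => ‖wval φ f z‖ₑ * W z) ^ r := by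
    rw [← mix_div_rpow hr0, ← mix_div_rpow hr0]
    calc _ ≤ mix (p / r) (q / r) (fun z => K₁ * ∫⁻ w, G w * expw (-((a - b) * r)) (z - w)) :=
          mix_mono hpr hqr hpt
      _ = K₁ * mix (p / r) (q / r) (fun z => ∫⁻ w, G w * expw (-((a - b) * r)) (z - w)) :=
          mix_const_mul hpr hqr ENNReal.coe_ne_top
      _ ≤ K₁ * (K₂ * mix (p / r) (q / r) G) := mul_le_mul' le_rfl (hK₂ G hGm)
      _ = _ := by push_cast; ring
  rw [ENNReal.coe_rpow_of_nonneg _ (by positivity)]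
  rw [← ENNReal.le_rpow_inv_iff hr0, ENNReal.mul_rpow_of_nonneg _ _ (by positivity),
    ENNReal.rpow_rpow_inv hr0.ne'] at hmix
  rwa [one_div]

end GSDistribution


/-! ### Moderate weights are exponentially controlled -/

namespace IsWeight
variable {X : Type*} [TopologicalSpace X] [MeasureSpace X] {ω : X → ℝ}

theorem exists_ae_le (hω : IsWeight ω) {K : Set X} (hK : IsCompact K) (hKm : MeasurableSet K) :
    ∃ B : ℝ, 0 < B ∧ ∀ᵐ w, w ∈ K → ω w ≤ B := by
  have h := (hω.2 K hK).1.eLpNorm_lt_top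
  rw [eLpNorm_exponent_top] at h
  have h1 := ae_le_eLpNormEssSup (f := ω) (μ := volume.restrict K)
  rw [ae_restrict_iff' hKm] at h1
  refine ⟨(eLpNormEssSup ω (volume.restrict K)).toReal + 1, by positivity, ?_⟩
  filter_upwards [h1] with w hw hwK
  have h2 := hw hwK
  rw [← ofReal_norm, ENNReal.ofReal_le_iff_le_toReal h.ne, Real.norm_of_nonneg (hω.1 w).le] at h2
  linarith

end IsWeight

namespace IsModerateWeight
variable {E : Type*} [NormedAddCommGroup E] [NormedSpace ℝ E] [FiniteDimensional ℝ E]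
  [MeasureSpace E] [BorelSpace E] [(volume : Measure E).IsAddHaarMeasure] {ω : E → ℝ}

/-- The function `v` is bounded on compact sets only almost everywhere, so it cannot be evaluated at
a prescribed `w`. For almost every `u` in the unit ball, however, both `v u` and `v (w - u)` are at
most the essential bound on the ball of radius `2`; then `w` is reached in the two steps `w - u` and
`u`. -/
theorem exists_le_of_norm_le_one (hω : IsModerateWeight ω) :
    ∃ K : ℝ, 1 ≤ K ∧ ∀ z w : E, ‖w‖ ≤ 1 → ω (z + w) ≤ K * ω z := by
  obtain ⟨hω, v, hv, C, hC, hmod⟩ := hω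
  have : ProperSpace E := FiniteDimensional.proper ℝ E
  obtain ⟨B, hB, hvB⟩ := hv.exists_ae_le (isCompact_closedBall (0 : E) 2) measurableSet_closedBall
  set M := C * B with hM
  have hM0 : 0 ≤ M := by positivity
  have hS : ∀ w, v w ≤ B → ∀ z, ω (z + w) ≤ M * ω z := by
    intro w hw z
    calc ω (z + w) ≤ C * ω z * v w := hmod z w
      _ ≤ C * ω z * B := mul_le_mul_of_nonneg_left hw
          (mul_nonneg (by linarith) (hω.1 z).le)
      _ = _ := by ring
  refine ⟨max 1 (M * M), le_max_left _ _, fun z w hw => ?_⟩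
  have h2 : ∀ᵐ u, w - u ∈ Metric.closedBall (0 : E) 2 → v (w - u) ≤ B :=
    (Measure.measurePreserving_sub_left volume w).quasiMeasurePreserving.ae hvB
  have hpos : (volume (Metric.ball (0 : E) 1)) ≠ 0 := (Metric.measure_ball_pos _ _ one_pos).ne'
  obtain ⟨u, hu, hu1, hu2⟩ : ∃ u ∈ Metric.ball (0 : E) 1, v u ≤ B ∧ v (w - u) ≤ B := by
    by_contra! hcon
    refine hpos (measure_mono_null ?_ (ae_iff.1 (hvB.and h2)))
    intro u hu hall
    have hu' : ‖u‖ < 1 := by simpa using hu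
    refine absurd (hall.2 ?_) (not_le.2 (hcon u hu (hall.1 ?_)))
    · rw [mem_closedBall_zero_iff]
      linarith [norm_sub_le w u]
    · rw [mem_closedBall_zero_iff]; linarith
  calc ω (z + w) = ω (z + (w - u) + u) := by congr 1; abel
    _ ≤ M * ω (z + (w - u)) := hS u hu1 _
    _ ≤ M * (M * ω z) := mul_le_mul_of_nonneg_left (hS _ hu2 z) hM0
    _ = M * M * ω z := by ring
    _ ≤ _ := mul_le_mul_of_nonneg_right (le_max_right _ _) (hω.1 z).le

/-- A shift by `w` is split into `⌊‖w‖⌋ + 1` equal steps of length at most `1`, each costing a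
factor `K`. -/
theorem exists_le_exp (hω : IsModerateWeight ω) :
    ∃ C r : ℝ, 0 < C ∧ 0 < r ∧ ∀ z w : E, ω (z + w) ≤ C * ω z * Real.exp (r * ‖w‖) := by
  obtain ⟨K, hK, h⟩ := hω.exists_le_of_norm_le_one
  have hpos := hω.1.1
  have hiter : ∀ (u : E), ‖u‖ ≤ 1 → ∀ (n : ℕ) (z : E), ω (z + n • u) ≤ K ^ n * ω z := by
    intro u hu n
    induction n with
    | zero => intro z; simp
    | succ n ih =>
      intro z
      calc ω (z + (n + 1) • u) = ω ((z + n • u) + u) := by rw [succ_nsmul, add_assoc]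
        _ ≤ K * ω (z + n • u) := h _ _ hu
        _ ≤ K * (K ^ n * ω z) := mul_le_mul_of_nonneg_left (ih z) (by linarith)
        _ = _ := by ring
  have hL : 0 ≤ Real.log K := Real.log_nonneg hK
  have hK0 : 0 < K := by linarith
  -- The rate `log K` would suffice; adding `1` makes it positive also when `K = 1`.
  refine ⟨K, Real.log K + 1, hK0, by linarith, fun z w => ?_⟩
  set n := ⌊‖w‖⌋₊ + 1 with hn
  have hn0 : (0 : ℝ) < n := by positivity
  have hwn : ‖w‖ ≤ n := by rw [hn]; push_cast; exact (Nat.lt_floor_add_one _).le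
  have hnw : (n : ℝ) ≤ ‖w‖ + 1 := by
    rw [hn]; push_cast; linarith [Nat.floor_le (norm_nonneg w)]
  have hw : w = n • ((n : ℝ)⁻¹ • w) := by
    rw [← Nat.cast_smul_eq_nsmul ℝ, smul_smul, mul_inv_cancel₀ hn0.ne', one_smul]
  have hu : ‖(n : ℝ)⁻¹ • w‖ ≤ 1 := by
    rw [norm_smul, Real.norm_of_nonneg (by positivity), inv_mul_le_iff₀ hn0, mul_one]
    exact hwn
  calc ω (z + w) = ω (z + n • ((n : ℝ)⁻¹ • w)) := by rw [← hw]
    _ ≤ K ^ n * ω z := hiter _ hu n z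
    _ ≤ (K * Real.exp ((Real.log K + 1) * ‖w‖)) * ω z := by
        refine mul_le_mul_of_nonneg_right ?_ (hpos z).le
        rw [← Real.rpow_natCast, Real.rpow_def_of_pos hK0]
        nth_rw 2 [← Real.exp_log hK0]
        rw [← Real.exp_add, Real.exp_le_exp]
        nlinarith [mul_le_mul_of_nonneg_left hnw hL, norm_nonneg w]
    _ = _ := by ring

/-- A moderate weight is equivalent to a slowly varying one. -/
theorem exists_slowlyVarying (hω : IsModerateWeight ω) :
    ∃ (W : E → ℝ≥0∞) (r : ℝ) (C : ℝ≥0), 0 < r ∧ SlowlyVarying r W ∧ (∀ z, W z ≠ ∞) ∧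
      ∀ z, ENNReal.ofReal (ω z) ≤ W z ∧ W z ≤ C * ENNReal.ofReal (ω z) := by
  obtain ⟨C, r, hC, hr, h⟩ := hω.exists_le_exp
  have hle : ∀ z, peetre r (fun z => ENNReal.ofReal (ω z)) z ≤
      C.toNNReal * ENNReal.ofReal (ω z) := by
    refine fun z => iSup_le fun w => ?_
    change _ ≤ ENNReal.ofReal C * _
    rw [expw, ← ENNReal.ofReal_mul (hω.1.1 w).le, ← ENNReal.ofReal_mul hC.le]
    refine ENNReal.ofReal_le_ofReal ?_
    calc _ ≤ C * ω z * Real.exp (r * ‖z - w‖) * Real.exp (-r * ‖z - w‖) := by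
          gcongr
          have := h z (w - z)
          rwa [add_sub_cancel, norm_sub_rev] at this
      _ = C * ω z * Real.exp (r * ‖z - w‖ + -r * ‖z - w‖) := by rw [Real.exp_add]; ring
      _ = C * ω z := by simp
  exact ⟨peetre r (fun z => ENNReal.ofReal (ω z)), r, C.toNNReal, hr, slowlyVarying_peetre hr.le,
    fun z => ne_top_of_le_ne_top (ENNReal.mul_ne_top ENNReal.coe_ne_top ENNReal.ofReal_ne_top)
      (hle z), fun z => ⟨le_peetre z, hle z⟩⟩

end IsModerateWeight

/-! ### The quasi-norm of a modulation space -/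

theorem eLpNorm_ofReal_eq_lpn {E F : Type*} [MeasureSpace E] [TopologicalSpace F]
    [ContinuousENorm F] {p : ℝ} (hp : 0 < p) (f : E → F) :
    eLpNorm f (ENNReal.ofReal p) volume = lpn p (fun x => ‖f x‖ₑ) := by
  rw [eLpNorm_eq_lintegral_rpow_enorm_toReal (by simpa using hp) ENNReal.ofReal_ne_top,
    ENNReal.toReal_ofReal hp.le, lpn]

section ModNorm
open GSDistribution
variable {d : ℕ} {φ : GelfandShilov d} {p q : ℝ} {ω : Rd d × Rd d → ℝ}

theorem modNorm_eq_mix (hp : 0 < p) (hq : 0 < q) (hω : ∀ z, 0 ≤ ω z) (f : GSDistribution d) :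
    modNorm φ p q ω f = ENNReal.ofReal ((2 * Real.pi) ^ (-(d : ℝ) / 2)) *
      mix p q (fun z => ‖wval φ f z‖ₑ * ENNReal.ofReal (ω z)) := by
  rw [← mix_const_mul hp hq ENNReal.ofReal_ne_top, modNorm, mixedNorm, eLpNorm_ofReal_eq_lpn hq, mix]
  congr 1
  funext ξ
  rw [eLpNorm_ofReal_eq_lpn hp, enorm_eq_self]
  congr 1
  funext x
  have h1 : ‖(((2 * Real.pi) ^ (-(d : ℝ) / 2) : ℝ) : ℂ)‖ₑ =
      ENNReal.ofReal ((2 * Real.pi) ^ (-(d : ℝ) / 2)) := by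
    rw [← ofReal_norm, Complex.norm_real, Real.norm_of_nonneg (by positivity)]
  have h2 : ‖(ω (x, ξ) : ℂ)‖ₑ = ENNReal.ofReal (ω (x, ξ)) := by
    rw [← ofReal_norm, Complex.norm_real, Real.norm_of_nonneg (hω _)]
  rw [enorm_mul, stft, enorm_mul, h1, h2, wval, mul_assoc]

theorem exists_modNorm_equiv (hp : 0 < p) (hq : 0 < q) {W : Rd d × Rd d → ℝ≥0∞} {C : ℝ≥0}
    (hω : ∀ z, 0 ≤ ω z)
    (hW : ∀ z, ENNReal.ofReal (ω z) ≤ W z ∧ W z ≤ C * ENNReal.ofReal (ω z)) :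
    ∃ A : ℝ≥0, ∀ f, modNorm φ p q ω f ≤ A * mix p q (fun z => ‖wval φ f z‖ₑ * W z) ∧
      mix p q (fun z => ‖wval φ f z‖ₑ * W z) ≤ A * modNorm φ p q ω f := by
  set k : ℝ := (2 * Real.pi) ^ (-(d : ℝ) / 2) with hk
  have hk0 : 0 < k := by positivity
  -- The first summand serves one inequality and the second the other.
  refine ⟨k.toNNReal + C * (k⁻¹).toNNReal, fun f => ?_⟩
  rw [modNorm_eq_mix hp hq hω, ENNReal.coe_add, ENNReal.coe_mul]
  change _ ≤ (ENNReal.ofReal k + C * ENNReal.ofReal k⁻¹) * _ ∧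
    _ ≤ (ENNReal.ofReal k + C * ENNReal.ofReal k⁻¹) * (ENNReal.ofReal k * _)
  constructor
  · refine mul_le_mul' le_self_add (mix_mono hp hq fun z => mul_le_mul' le_rfl (hW z).1)
  · calc _ ≤ mix p q (fun z => C * (‖wval φ f z‖ₑ * ENNReal.ofReal (ω z))) :=
          mix_mono hp hq fun z => by
            rw [mul_left_comm]; exact mul_le_mul' le_rfl (hW z).2
      _ = C * ENNReal.ofReal k⁻¹ * (ENNReal.ofReal k *
            mix p q (fun z => ‖wval φ f z‖ₑ * ENNReal.ofReal (ω z))) := by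
          rw [mix_const_mul hp hq ENNReal.coe_ne_top, mul_assoc, ← mul_assoc (ENNReal.ofReal k⁻¹),
            ← ENNReal.ofReal_mul (by positivity), inv_mul_cancel₀ hk0.ne', ENNReal.ofReal_one,
            one_mul]
      _ ≤ _ := mul_le_mul' le_add_self le_rfl

end ModNorm


/-! ### The convolution algebra `Σ₁` -/

namespace GelfandShilov
variable {d : ℕ}

theorem norm_le_exp (f : GelfandShilov d) {a : ℝ} (ha : 0 < a) :
    ∃ C : ℝ, 0 ≤ C ∧ ∀ x, ‖f x‖ ≤ C * Real.exp (-(a * ‖x‖)) := by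
  refine ⟨2 * gsSeminorm d ⟨1 / (2 * a), by positivity⟩ f, by positivity, fun x => ?_⟩
  have h := norm_iteratedFDeriv_le_exp ⟨1 / (2 * a), by positivity⟩ f 0 x
  have e : ‖x‖ / (2 * (1 / (2 * a))) = a * ‖x‖ := by field_simp
  rw [e] at h
  simpa only [norm_iteratedFDeriv_zero, pow_zero, Nat.factorial_zero, Nat.cast_one, mul_one] using h

/-- The convolution is a superposition of translates of `g` with density `f`. The seminorm of the
translate by `y` grows like `e^{|y|/h}`, which the decay of `f` at the rate `1/h + 1` compensates.
-/
theorem exists_conv (f g : GelfandShilov d) :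
    ∃ k : GelfandShilov d, ∀ x, k x = ∫ y, f y * g (x - y) := by
  have happ : ∀ y x, (conj g).window y 0 x = g (x - y) := fun y x => by
    simp [window_apply, conj_apply]
  obtain ⟨k, hk, -⟩ := exists_eq_integral (μ := (volume : Measure (Rd d))) (H := fun y => f y)
    (Φ := fun y => (conj g).window y 0) (fun n x => by
      have h1 : Continuous (fun y : Rd d => iteratedFDeriv ℝ n ((conj g).window y 0) x) :=
        (continuous_iteratedFDeriv_window (conj g) n x).comp (f := fun y : Rd d => (y, (0 : Rd d)))
          (by fun_prop)
      exact (f.continuous.smul h1).aestronglyMeasurable) (fun h => by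
      have hh := h.2
      obtain ⟨C, hC, hf⟩ := norm_le_exp f (a := 1 / h.1 + 1) (by positivity)
      refine ⟨fun y => C * gsSeminorm d h (conj g) * Real.exp (-(1 * ‖y‖)),
        (integrable_exp_neg_mul_norm _ one_pos).const_mul _, fun y => ?_⟩
      have h2 := gsSeminorm_window_le h (conj g) y 0
      simp only [norm_zero, zero_div, Real.exp_zero, mul_one] at h2
      calc _ ≤ (C * Real.exp (-((1 / h.1 + 1) * ‖y‖))) *
            (gsSeminorm d h (conj g) * Real.exp (‖y‖ / h.1)) := by
            refine mul_le_mul (hf y) h2 (apply_nonneg _ _) (by positivity)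
        _ = C * gsSeminorm d h (conj g) *
            (Real.exp (-((1 / h.1 + 1) * ‖y‖)) * Real.exp (‖y‖ / h.1)) := by ring
        _ = _ := by
            rw [← Real.exp_add]
            congr 2
            ring)
  exact ⟨k, fun x => by simp only [hk, happ]⟩

/-- The convolution of two elements of `Σ₁(ℝ^d)`. -/
noncomputable def conv (f g : GelfandShilov d) : GelfandShilov d := (exists_conv f g).choose

theorem conv_apply (f g : GelfandShilov d) (x : Rd d) : conv f g x = ∫ y, f y * g (x - y) :=
  (exists_conv f g).choose_spec x

theorem conv_comm (f g : GelfandShilov d) : conv f g = conv g f := by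
  ext x
  rw [conv_apply, conv_apply, ← integral_sub_left_eq_self _ volume x]
  simp [mul_comm]

theorem conv_assoc (f g h : GelfandShilov d) : conv (conv f g) h = conv f (conv g h) := by
  ext x
  have hint : Integrable (Function.uncurry fun y u : Rd d => f u * g (y - u) * h (x - y))
      (volume.prod volume) := by
    have h1 : Integrable (fun p : Rd d × Rd d => f p.2 * g (p.1 - p.2)) (volume.prod volume) := by
      have := f.integrable.convolution_integrand (ContinuousLinearMap.mul ℂ ℂ) g.integrable
      simpa using this
    exact h1.mul_bdd (c := gsSeminorm d ⟨1, one_pos⟩ h)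
      (h.continuous.comp (f := fun p : Rd d × Rd d => x - p.1)
        (by fun_prop)).aestronglyMeasurable (Filter.Eventually.of_forall fun p => h.norm_le _)
  calc conv (conv f g) h x = ∫ y, ∫ u, f u * g (y - u) * h (x - y) := by
        rw [conv_apply]
        refine integral_congr_ae (Filter.Eventually.of_forall fun y => ?_)
        simp only [conv_apply, integral_mul_const]
    _ = ∫ u, ∫ y, f u * g (y - u) * h (x - y) := integral_integral_swap hint
    _ = conv f (conv g h) x := by
        rw [conv_apply]
        refine integral_congr_ae (Filter.Eventually.of_forall fun u => ?_)
        simp only [conv_apply, mul_assoc, integral_const_mul]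
        congr 1
        rw [← integral_add_right_eq_self _ u]
        simp only [add_sub_cancel_right]
        congr 1
        funext y
        rw [sub_sub, add_comm u]

/-- The involution `φ ↦ conj φ(-·)`. -/
noncomputable def involution (φ : GelfandShilov d) : GelfandShilov d :=
  ⟨fun y => (starRingEnd ℂ) (φ (-y)), by
    have e : (fun y : Rd d => (starRingEnd ℂ) (φ (-y))) =
        (conj φ : Rd d → ℂ) ∘ LinearIsometryEquiv.neg ℝ := rfl
    rw [e]
    refine ⟨(conj φ).2.1.comp (LinearIsometryEquiv.neg ℝ).contDiff, fun h hh => ?_⟩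
    obtain ⟨C, hC⟩ := (conj φ).2.2 h hh
    refine ⟨C, fun k n x => ?_⟩
    rw [LinearIsometryEquiv.norm_iteratedFDeriv_comp_right]
    simpa using hC k n (-x)⟩

theorem involution_apply (φ : GelfandShilov d) (y : Rd d) :
    involution φ y = (starRingEnd ℂ) (φ (-y)) := rfl

theorem involution_involution (φ : GelfandShilov d) : involution (involution φ) = φ := by
  ext y; simp [involution_apply]

theorem involution_conv (φ ψ : GelfandShilov d) :
    involution (conv φ ψ) = conv (involution φ) (involution ψ) := by
  ext x
  rw [involution_apply, conv_apply, conv_apply, ← integral_conj, ← integral_neg_eq_self]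
  simp only [involution_apply, map_mul]
  congr 1
  funext y
  rw [← neg_add', sub_eq_add_neg x]

/-- The value at the origin is the square of the `L²` norm of `φ`. Hence this convolution can serve
as a window for inversion. -/
theorem conv_involution_ne_zero {φ : GelfandShilov d} (hφ : φ ≠ 0) :
    conv φ (involution φ) ≠ 0 := by
  intro h
  have h1 : conv φ (involution φ) 0 = 0 := by rw [h]; rfl
  have h2 := integral_norm_sq_pos hφ
  have h3 : conv φ (involution φ) 0 = ((∫ y, ‖φ y‖ ^ 2 : ℝ) : ℂ) := by
    rw [conv_apply, ← integral_complex_ofReal]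
    congr 1
    funext y
    rw [involution_apply, zero_sub, neg_neg, Complex.mul_conj, Complex.normSq_eq_norm_sq]
  rw [h3] at h1
  exact h2.ne' (by exact_mod_cast h1)

/-- The modulation `y ↦ f(y) e^{-i⟨y, ξ⟩}`. -/
noncomputable def modulate (f : GelfandShilov d) (ξ : Rd d) : GelfandShilov d :=
  (conj f).window 0 ξ

theorem modulate_apply (f : GelfandShilov d) (ξ y : Rd d) :
    modulate f ξ y = f y * Complex.exp (-Complex.I * (inner ℝ ξ y : ℝ)) := by
  simp [modulate, window_apply, conj_apply]

theorem modulate_conv (f g : GelfandShilov d) (ξ : Rd d) :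
    modulate (conv f g) ξ = conv (modulate f ξ) (modulate g ξ) := by
  ext x
  rw [modulate_apply, conv_apply, conv_apply, ← integral_mul_const]
  congr 1
  funext y
  have : Complex.exp (-Complex.I * (inner ℝ ξ x : ℝ)) =
      Complex.exp (-Complex.I * (inner ℝ ξ y : ℝ)) *
      Complex.exp (-Complex.I * (inner ℝ ξ (x - y) : ℝ)) := by
    rw [← Complex.exp_add]
    congr 1
    rw [inner_sub_right]
    push_cast
    ring
  rw [modulate_apply, modulate_apply, this]
  ring

theorem toDistribution_apply (f ψ : GelfandShilov d) : f.toDistribution ψ = ∫ x, f x * ψ x := rfl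

/-- At a fixed frequency the transform is itself a convolution, so the algebra of convolution in
`Σ₁` applies to it. -/
theorem wval_toDistribution (θ f : GelfandShilov d) (z : Rd d × Rd d) :
    GSDistribution.wval θ f.toDistribution z = conv (modulate f z.2) (involution θ) z.1 := by
  rw [GSDistribution.wval, toDistribution_apply, conv_apply]
  congr 1
  funext y
  rw [window_apply, modulate_apply, involution_apply, neg_sub]
  ring

theorem wval_toDistribution_eq_conj_coef (θ f : GelfandShilov d) (z : Rd d × Rd d) :
    GSDistribution.wval θ f.toDistribution z = (starRingEnd ℂ) (coef θ (conj f) z) := by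
  rw [GSDistribution.wval, toDistribution_apply, coef, ← integral_conj]
  congr 1
  funext y
  rw [window_apply, map_mul, conj_apply, atom_apply, map_mul, ← Complex.exp_conj, Complex.conj_conj]
  simp

theorem norm_wval_toDistribution_le (θ f : GelfandShilov d) {a : ℝ} (ha : 0 < a) :
    ∃ C : ℝ, 0 ≤ C ∧ ∀ z, ‖GSDistribution.wval θ f.toDistribution z‖ ≤
      C * Real.exp (-(a * ‖z‖)) := by
  obtain ⟨h, C, hC, H⟩ := norm_coef_le θ ha
  refine ⟨C * gsSeminorm d h (conj f), by positivity, fun z => ?_⟩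
  rw [wval_toDistribution_eq_conj_coef, RCLike.norm_conj]
  exact H _ z

end GelfandShilov

namespace GSDistribution
open GelfandShilov
variable {d : ℕ}

/-- The convolution, in the first variable, of the short-time Fourier transforms of `f` and `g` with
windows `φ` and `conj φ(-·)`. -/
noncomputable def stftConv (φ : GelfandShilov d) (f g : GSDistribution d) (z : Rd d × Rd d) : ℂ :=
  ∫ y, wval φ f (y, z.2) * wval (involution φ) g (z.1 - y, z.2)

/-- Both sides are convolutions of the same four functions, the modulations of `f` and `g` together
with `φ` and its involution, in different orders. Modulation distributes over convolution, and
associativity and commutativity do the rest. -/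
theorem stftConv_toDistribution (φ f g : GelfandShilov d) (z : Rd d × Rd d) :
    stftConv φ f.toDistribution g.toDistribution z =
      wval (conv φ (involution φ)) (conv f g).toDistribution z := by
  simp only [stftConv, wval_toDistribution]
  rw [← conv_apply, involution_involution, modulate_conv, involution_conv, involution_involution]
  rw [conv_assoc, conv_assoc, ← conv_assoc (involution φ), conv_comm (involution φ), conv_assoc]

/-! ### Synthesis -/

theorem enorm_wval_le_of_eq_integral (Θ θ : GelfandShilov d) {a : ℝ} (ha : 0 < a) :
    ∃ C : ℝ≥0, ∀ (H : Rd d × Rd d → ℂ) (f : GSDistribution d),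
      (∀ ψ, f ψ = ∫ z, H z * coef Θ ψ z) →
      ∀ w, ‖wval θ f w‖ₑ ≤ C * ∫⁻ z, ‖H z‖ₑ * expw (-a) (z - w) := by
  obtain ⟨C, hC, hcoef⟩ := norm_coef_window_le Θ θ ha
  refine ⟨C.toNNReal, fun H f hf w => ?_⟩
  rw [wval, hf, ← lintegral_const_mul' _ _ ENNReal.coe_ne_top]
  refine (enorm_integral_le_lintegral_enorm _).trans (lintegral_mono fun z => ?_)
  rw [enorm_mul, mul_left_comm]
  refine mul_le_mul' le_rfl ?_
  rw [← ofReal_norm]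
  change _ ≤ ENNReal.ofReal C * _
  rw [expw, ← ENNReal.ofReal_mul hC]
  refine ENNReal.ofReal_le_ofReal ?_
  simpa [neg_mul] using hcoef z w

/-- The kernel is used at the rate `r + s + 1`: the part `r` absorbs the variation of `W`, the part
`s` that of `N`, and the last unit is integrable. A slowly varying bound on the coefficients is
therefore inherited by the transform of the synthesized distribution, in any window and with a
uniform constant, although `H` need not be a transform. -/
theorem exists_synthesis (Θ θ : GelfandShilov d) {r s : ℝ} (hr : 0 < r) (hs : 0 < s) :
    ∃ K : ℝ≥0, ∀ (H : Rd d × Rd d → ℂ) (W N : Rd d × Rd d → ℝ≥0∞), AEStronglyMeasurable H →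
      SlowlyVarying r W → SlowlyVarying s N → (∀ z, W z ≠ 0) → (∀ z, W z ≠ ∞) → (∀ z, N z ≠ ∞) →
      (∀ z, ‖H z‖ₑ * W z ≤ N z) →
      (∀ ψ, Integrable (fun z => H z * coef Θ ψ z)) ∧
      ∃ f : GSDistribution d, (∀ ψ, f ψ = ∫ z, H z * coef Θ ψ z) ∧
        ∀ z, ‖wval θ f z‖ₑ * W z ≤ K * N z := by
  obtain ⟨C, hC⟩ := enorm_wval_le_of_eq_integral Θ θ (a := r + s + 1) (by positivity)
  have hIt := lintegral_expw_neg_ne_top (E := Rd d × Rd d) one_pos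
  refine ⟨C * (∫⁻ z : Rd d × Rd d, expw (-1) z).toNNReal,
    fun H W N hHm hW hN hW0 hWt hNt hHN => ?_⟩
  -- Comparison of `W` and `N` with their values at the origin bounds the growth of `H`, so that the
  -- synthesis integral converges absolutely.
  have hgrow : ∀ z, ‖H z‖ₑ ≤ N 0 / W 0 * expw (r + s) z := by
    intro z
    have h1 : ‖H z‖ₑ * W 0 ≤ N 0 * expw (r + s) z := by
      calc ‖H z‖ₑ * W 0 ≤ ‖H z‖ₑ * (expw r z * W z) := by
            refine mul_le_mul' le_rfl ?_
            simpa [expw_neg_right] using hW z (-z)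
        _ = expw r z * (‖H z‖ₑ * W z) := by ring
        _ ≤ expw r z * (expw s z * N 0) := by
            refine mul_le_mul' le_rfl ((hHN z).trans ?_)
            simpa using hN 0 z
        _ = N 0 * (expw r z * expw s z) := by ring
        _ = _ := by rw [expw_mul_expw]
    rw [← ENNReal.mul_div_right_comm]
    exact (ENNReal.le_div_iff_mul_le (Or.inl (hW0 0)) (Or.inl (hWt 0))).2 h1
  have hD : N 0 / W 0 ≠ ∞ := ENNReal.div_ne_top (hNt 0) (hW0 0)
  have hi : Integrable (fun z => ‖H z‖ * Real.exp (-((r + s + 1) * ‖z‖))) := by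
    refine ((integrable_exp_neg_mul_norm (volume : Measure (Rd d × Rd d)) one_pos).const_mul
      (N 0 / W 0).toReal).mono' (hHm.norm.mul
        (by fun_prop : Continuous fun z : Rd d × Rd d =>
          Real.exp (-((r + s + 1) * ‖z‖))).aestronglyMeasurable)
      (Filter.Eventually.of_forall fun z => ?_)
    have h1 : ‖H z‖ ≤ (N 0 / W 0).toReal * Real.exp ((r + s) * ‖z‖) := by
      have := ENNReal.toReal_mono (ENNReal.mul_ne_top hD (expw_ne_top _ _)) (hgrow z)
      rwa [toReal_enorm, ENNReal.toReal_mul, expw, ENNReal.toReal_ofReal (Real.exp_pos _).le] at this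
    rw [Real.norm_of_nonneg (by positivity)]
    calc _ ≤ (N 0 / W 0).toReal * Real.exp ((r + s) * ‖z‖) * Real.exp (-((r + s + 1) * ‖z‖)) := by
          gcongr
      _ = (N 0 / W 0).toReal * Real.exp ((r + s) * ‖z‖ + -((r + s + 1) * ‖z‖)) := by
          rw [mul_assoc, ← Real.exp_add]
      _ = _ := by congr 2; ring
  obtain ⟨hint, f, hf⟩ := exists_eq_integral_coef Θ (by positivity) hHm hi
  refine ⟨hint, f, hf, fun w => ?_⟩
  calc ‖wval θ f w‖ₑ * W w
      ≤ C * (∫⁻ z, ‖H z‖ₑ * expw (-(r + s + 1)) (z - w)) * W w := mul_le_mul' (hC H f hf w) le_rfl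
    _ = C * ∫⁻ z, ‖H z‖ₑ * expw (-(r + s + 1)) (z - w) * W w := by
        rw [mul_assoc, lintegral_mul_const' _ _ (hWt w)]
    _ ≤ C * ∫⁻ z, expw (-1) (z - w) * N w := by
        refine mul_le_mul' le_rfl (lintegral_mono fun z => ?_)
        calc _ ≤ ‖H z‖ₑ * expw (-(r + s + 1)) (z - w) * (expw r (z - w) * W z) := by
              refine mul_le_mul' le_rfl ?_
              rw [expw_sub_comm]; exact hW.le_mul w z
          _ = (‖H z‖ₑ * W z) * (expw (-(r + s + 1)) (z - w) * expw r (z - w)) := by ring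
          _ ≤ (expw s (z - w) * N w) * (expw (-(r + s + 1)) (z - w) * expw r (z - w)) :=
              mul_le_mul' ((hHN z).trans (hN.le_mul z w)) le_rfl
          _ = (expw (-(r + s + 1)) (z - w) * expw r (z - w) * expw s (z - w)) * N w := by ring
          _ = _ := by rw [expw_mul_expw, expw_mul_expw]; ring_nf
    _ = _ := by
        rw [lintegral_mul_const' _ _ (hNt w),
          lintegral_sub_right_eq_self (fun z : Rd d × Rd d => expw (-1) z) w,
          ENNReal.coe_mul, ENNReal.coe_toNNReal hIt, mul_assoc]

end GSDistribution


namespace GSDistribution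
open GelfandShilov
variable {d : ℕ}

/-! ### The convolution estimate -/

theorem aestronglyMeasurable_stftConv (φ : GelfandShilov d) (f g : GSDistribution d) :
    AEStronglyMeasurable (stftConv φ f g) := by
  have hc : Continuous (fun p : (Rd d × Rd d) × Rd d =>
      wval φ f (p.2, p.1.2) * wval (involution φ) g (p.1.1 - p.2, p.1.2)) :=
    ((continuous_wval φ f).comp (f := fun p : (Rd d × Rd d) × Rd d => (p.2, p.1.2))
      (by fun_prop)).mul ((continuous_wval (involution φ) g).comp
      (f := fun p : (Rd d × Rd d) × Rd d => (p.1.1 - p.2, p.1.2)) (by fun_prop))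
  exact (hc.stronglyMeasurable.integral_prod_right' (ν := volume)).aestronglyMeasurable

/-- Both transforms are replaced by weighted maximal functions `N₁`, `N₂`, and `J` is their
convolution in position. It dominates the weighted integral of absolute values that defines
`stftConv`. Its mixed quasi-norm is bounded by the estimate for slowly varying functions, so `J`,
being slowly varying, is finite at every point; this gives the absolute convergence on which
bilinearity rests. Synthesis then transfers the bound to the distribution. -/
theorem exists_stftConv_estimate {φ₀ φ₁ φ₂ : GelfandShilov d} (hφ₁ : φ₁ ≠ 0) (hφ₂ : φ₂ ≠ 0)
    {p₀ p₁ p₂ q₀ q₁ q₂ : ℝ} (hp₀ : 0 < p₀) (hp₁ : 0 < p₁) (hp₂ : 0 < p₂)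
    (hq₀ : 0 < q₀) (hq₁ : 0 < q₁) (hq₂ : 0 < q₂)
    (hp : 1 / p₀ ≤ 1 / p₁ + 1 / p₂ - max 1 (max (1 / p₁) (1 / p₂)))
    (hq : 1 / q₀ ≤ 1 / q₁ + 1 / q₂)
    {W₀ W₁ W₂ : Rd d × Rd d → ℝ≥0∞} {r : ℝ} (hr : 0 < r) (hW₀ : SlowlyVarying r W₀)
    (hW₁ : SlowlyVarying r W₁) (hW₂ : SlowlyVarying r W₂) (hz₀ : ∀ z, W₀ z ≠ 0)
    (ht₀ : ∀ z, W₀ z ≠ ∞) (ht₁ : ∀ z, W₁ z ≠ ∞) (ht₂ : ∀ z, W₂ z ≠ ∞) {C : ℝ≥0}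
    (hW : ∀ x₁ x₂ ξ, W₀ (x₁ + x₂, ξ) ≤ C * (W₁ (x₁, ξ) * W₂ (x₂, ξ))) :
    ∃ K : ℝ≥0, ∀ f₁ f₂ : GSDistribution d,
      mix p₁ q₁ (fun z => ‖wval φ₁ f₁ z‖ₑ * W₁ z) ≠ ∞ →
      mix p₂ q₂ (fun z => ‖wval φ₂ f₂ z‖ₑ * W₂ z) ≠ ∞ →
      (∀ z : Rd d × Rd d, Integrable (fun y =>
        wval φ₁ f₁ (y, z.2) * wval (involution φ₁) f₂ (z.1 - y, z.2))) ∧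
      (∀ ψ, Integrable (fun z =>
        stftConv φ₁ f₁ f₂ z * coef (conv φ₁ (involution φ₁)) ψ z)) ∧
      ∃ f : GSDistribution d,
        (∀ ψ, f ψ = ∫ z, stftConv φ₁ f₁ f₂ z * coef (conv φ₁ (involution φ₁)) ψ z) ∧
        mix p₀ q₀ (fun z => ‖wval φ₀ f z‖ₑ * W₀ z) ≤
          K * (mix p₁ q₁ (fun z => ‖wval φ₁ f₁ z‖ₑ * W₁ z) *
            mix p₂ q₂ (fun z => ‖wval φ₂ f₂ z‖ₑ * W₂ z)) := by
  -- The rate of the maximal functions has to exceed the rate `r` of the weights.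
  set a := r + 1 with ha
  have ha0 : 0 < a := by positivity
  set χ := involution φ₁ with hχ
  set b := a + r with hb
  have hb0 : 0 < b := by positivity
  obtain ⟨K₁, hK₁⟩ := exists_mix_peetre_le hφ₁ (a := a) hr.le (by linarith) hp₁ hq₁ hW₁ ht₁
  obtain ⟨K₂, hK₂⟩ := exists_mix_peetre_le hφ₂ (a := a) hr.le (by linarith) hp₂ hq₂ hW₂ ht₂
  -- The transform of `f₂` enters with the window `χ`, whereas its quasi-norm is computed with `φ₂`.
  obtain ⟨Kχ, hKχ⟩ := exists_enorm_wval_le_peetre hφ₂ χ ha0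
  obtain ⟨K₃, hK₃⟩ := SlowlyVarying.exists_mix_convolution_le (d := d) hb0.le hp₀ hp₁ hp₂ hp hq₀ hq₁
    hq₂ hq
  obtain ⟨K₄, hK₄⟩ := exists_synthesis (conv φ₁ χ) φ₀ hr (s := b + b) (by positivity)
  obtain ⟨K₅, hK₅⟩ := SlowlyVarying.exists_le_mix (d := d) (a := b + b) (by positivity) hp₀ hq₀
  refine ⟨K₄ * (C * Kχ * (K₃ * (K₁ * K₂))), fun f₁ f₂ hf₁ hf₂ => ?_⟩
  set N₁ : Rd d × Rd d → ℝ≥0∞ := fun z => peetre a (fun w => ‖wval φ₁ f₁ w‖ₑ) z * W₁ z with hN₁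
  set N₂ : Rd d × Rd d → ℝ≥0∞ := fun z => peetre a (fun w => ‖wval φ₂ f₂ w‖ₑ) z * W₂ z with hN₂
  have hs₁ : SlowlyVarying b N₁ := (slowlyVarying_peetre ha0.le).mul hW₁
  have hs₂ : SlowlyVarying b N₂ := (slowlyVarying_peetre ha0.le).mul hW₂
  set J : Rd d × Rd d → ℝ≥0∞ := fun z => ∫⁻ y, N₁ (y, z.2) * N₂ (z.1 - y, z.2) with hJ
  have hJs : SlowlyVarying (b + b) J := SlowlyVarying.partialConvolution hb0.le hs₁ hs₂
  have hJmix : mix p₀ q₀ J ≤ K₃ * (K₁ * K₂) *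
      (mix p₁ q₁ (fun z => ‖wval φ₁ f₁ z‖ₑ * W₁ z) *
        mix p₂ q₂ (fun z => ‖wval φ₂ f₂ z‖ₑ * W₂ z)) := by
    calc mix p₀ q₀ J ≤ K₃ * (mix p₁ q₁ N₁ * mix p₂ q₂ N₂) := hK₃ _ _ hs₁ hs₂
      _ ≤ K₃ * ((K₁ * mix p₁ q₁ (fun z => ‖wval φ₁ f₁ z‖ₑ * W₁ z)) *
            (K₂ * mix p₂ q₂ (fun z => ‖wval φ₂ f₂ z‖ₑ * W₂ z))) :=
          mul_le_mul' le_rfl (mul_le_mul' (hK₁ f₁) (hK₂ f₂))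
      _ = _ := by ring
  have hJt : ∀ z, J z ≠ ∞ := fun z => ne_top_of_le_ne_top
    (ENNReal.mul_ne_top ENNReal.coe_ne_top (ne_top_of_le_ne_top (ENNReal.mul_ne_top
      (by exact_mod_cast ENNReal.coe_ne_top) (ENNReal.mul_ne_top hf₁ hf₂)) hJmix)) (hK₅ J hJs z)
  set N : Rd d × Rd d → ℝ≥0∞ := fun z => (C * Kχ) * J z with hN
  have hNt : ∀ z, N z ≠ ∞ := fun z => ENNReal.mul_ne_top (by exact_mod_cast ENNReal.coe_ne_top) (hJt z)
  have hpt : ∀ z : Rd d × Rd d,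
      (∫⁻ y, ‖wval φ₁ f₁ (y, z.2) * wval χ f₂ (z.1 - y, z.2)‖ₑ) * W₀ z ≤ N z := by
    intro z
    rw [← lintegral_mul_const' _ _ (ht₀ z), hN]
    simp only
    rw [hJ, ← lintegral_const_mul' _ _ (by exact_mod_cast ENNReal.coe_ne_top)]
    refine lintegral_mono fun y => ?_
    rw [enorm_mul]
    have h0 : W₀ z ≤ C * (W₁ (y, z.2) * W₂ (z.1 - y, z.2)) := by
      have := hW y (z.1 - y) z.2
      rwa [add_sub_cancel] at this
    calc _ ≤ peetre a (fun w => ‖wval φ₁ f₁ w‖ₑ) (y, z.2) *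
          (Kχ * peetre a (fun w => ‖wval φ₂ f₂ w‖ₑ) (z.1 - y, z.2)) *
          (C * (W₁ (y, z.2) * W₂ (z.1 - y, z.2))) :=
          mul_le_mul' (mul_le_mul' (le_peetre (F := fun w => ‖wval φ₁ f₁ w‖ₑ) _) (hKχ f₂ _)) h0
      _ = _ := by simp only [hN₁, hN₂]; ring
  have hHN : ∀ z, ‖stftConv φ₁ f₁ f₂ z‖ₑ * W₀ z ≤ N z := fun z =>
    (mul_le_mul' (enorm_integral_le_lintegral_enorm _) le_rfl).trans (hpt z)
  obtain ⟨hint, f, hf, hfN⟩ := hK₄ (stftConv φ₁ f₁ f₂) W₀ N (aestronglyMeasurable_stftConv φ₁ f₁ f₂)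
    hW₀ (hJs.const_mul _) hz₀ ht₀ hNt hHN
  refine ⟨fun z => ⟨?_, ?_⟩, hint, f, hf, ?_⟩
  · exact (((continuous_wval φ₁ f₁).comp (f := fun y : Rd d => (y, z.2)) (by fun_prop)).mul
      ((continuous_wval χ f₂).comp (f := fun y : Rd d => (z.1 - y, z.2))
        (by fun_prop))).aestronglyMeasurable
  · refine lt_top_iff_ne_top.2 fun htop => hNt z ?_
    have h1 := hpt z
    rwa [htop, ENNReal.top_mul (hz₀ z), top_le_iff] at h1
  · calc _ ≤ mix p₀ q₀ (fun z => K₄ * N z) := mix_mono hp₀ hq₀ hfN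
      _ = K₄ * ((C * Kχ) * mix p₀ q₀ J) := by
          rw [mix_const_mul hp₀ hq₀ ENNReal.coe_ne_top,
            mix_const_mul hp₀ hq₀ (by exact_mod_cast ENNReal.coe_ne_top)]
      _ ≤ K₄ * ((C * Kχ) * _) := mul_le_mul' le_rfl (mul_le_mul' le_rfl hJmix)
      _ = _ := by push_cast; ring

theorem stftConv_add_smul_left {φ : GelfandShilov d} {f f' g : GSDistribution d} {z : Rd d × Rd d}
    (h : Integrable (fun y => wval φ f (y, z.2) * wval (involution φ) g (z.1 - y, z.2)))
    (h' : Integrable (fun y => wval φ f' (y, z.2) * wval (involution φ) g (z.1 - y, z.2)))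
    (a b : ℂ) : stftConv φ (a • f + b • f') g z =
      a * stftConv φ f g z + b * stftConv φ f' g z := by
  simp only [stftConv]
  rw [← integral_const_mul, ← integral_const_mul, ← integral_add (h.const_mul a) (h'.const_mul b)]
  congr 1
  funext y
  change (a * wval φ f _ + b * wval φ f' _) * _ = _
  ring

theorem stftConv_add_smul_right {φ : GelfandShilov d} {f g g' : GSDistribution d} {z : Rd d × Rd d}
    (h : Integrable (fun y => wval φ f (y, z.2) * wval (involution φ) g (z.1 - y, z.2)))
    (h' : Integrable (fun y => wval φ f (y, z.2) * wval (involution φ) g' (z.1 - y, z.2)))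
    (a b : ℂ) : stftConv φ f (a • g + b • g') z =
      a * stftConv φ f g z + b * stftConv φ f g' z := by
  simp only [stftConv]
  rw [← integral_const_mul, ← integral_const_mul, ← integral_add (h.const_mul a) (h'.const_mul b)]
  congr 1
  funext y
  change _ * (a * wval _ g _ + b * wval _ g' _) = _
  ring

/-! ### Elements of `Σ₁` in modulation spaces -/

theorem mix_expw_ne_top {p q : ℝ} (hp : 0 < p) (hq : 0 < q) :
    mix p q (fun z : Rd d × Rd d => expw (-1) z) ≠ ∞ := by
  have h : ∀ {t : ℝ}, 0 < t → lpn t (fun x : Rd d => expw (-(1 / 2)) x) ≠ ∞ := by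
    intro t ht
    refine ENNReal.rpow_ne_top_of_nonneg (by positivity) ?_
    simp only [expw_rpow, neg_mul]
    exact lintegral_expw_neg_ne_top (by positivity)
  refine ne_top_of_le_ne_top (ENNReal.mul_ne_top (h hp) (h hq)) ?_
  calc _ ≤ mix p q (fun z : Rd d × Rd d => expw (-(1 / 2)) z.1 * expw (-(1 / 2)) z.2) :=
        mix_mono hp hq fun z => expw_neg_prod_le one_pos.le _ _
    _ = _ := by
        have h1 : ∀ ξ : Rd d, lpn p (fun x : Rd d => expw (-(1 / 2)) x * expw (-(1 / 2)) ξ) =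
            lpn p (fun x : Rd d => expw (-(1 / 2)) x) * expw (-(1 / 2)) ξ := fun ξ => by
          rw [mul_comm, ← lpn_const_mul hp (expw_ne_top _ _)]
          simp only [mul_comm]
        simp only [mix, h1, lpn_const_mul hq (h hp)]

theorem mix_toDistribution_ne_top (θ f : GelfandShilov d) {p q : ℝ} (hp : 0 < p) (hq : 0 < q)
    {W : Rd d × Rd d → ℝ≥0∞} {r : ℝ} (hr : 0 < r) (hW : SlowlyVarying r W) (ht : W 0 ≠ ∞) :
    mix p q (fun z => ‖wval θ f.toDistribution z‖ₑ * W z) ≠ ∞ := by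
  obtain ⟨C, hC, h⟩ := norm_wval_toDistribution_le θ f (a := r + 1) (by positivity)
  refine ne_top_of_le_ne_top (ENNReal.mul_ne_top (ENNReal.mul_ne_top (ENNReal.ofReal_ne_top (r := C))
    ht) (mix_expw_ne_top (d := d) hp hq)) ?_
  rw [← mix_const_mul hp hq (ENNReal.mul_ne_top ENNReal.ofReal_ne_top ht)]
  refine mix_mono hp hq fun z => ?_
  calc _ ≤ (ENNReal.ofReal C * expw (-(r + 1)) z) * (expw r z * W 0) := by
        refine mul_le_mul' ?_ (by simpa using hW 0 z)
        rw [expw, ← ENNReal.ofReal_mul hC, ← ofReal_norm]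
        refine ENNReal.ofReal_le_ofReal ?_
        rw [neg_mul]; exact h z
    _ = ENNReal.ofReal C * W 0 * (expw (-(r + 1)) z * expw r z) := by ring
    _ = _ := by rw [expw_mul_expw]; ring_nf

end GSDistribution


namespace GSDistribution
open GelfandShilov
variable {d : ℕ}

/-! ### Density of `Σ₁` -/

/-- A superposition of atoms over a compact set lies in `Σ₁` whatever the growth of the continuous
density: these are the truncations of the inversion integral. -/
theorem exists_toDistribution_eq_setIntegral (φ : GelfandShilov d) {H : Rd d × Rd d → ℂ}
    (hH : Continuous H) {K : Set (Rd d × Rd d)} (hK : IsCompact K) :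
    ∃ g : GelfandShilov d, ∀ ψ : GelfandShilov d,
      g.toDistribution ψ = ∫ z in K, H z * coef φ ψ z := by
  obtain ⟨g, hg, -⟩ := exists_eq_integral (μ := volume.restrict K) (H := H) (Φ := atom φ)
    (fun n x => by
      have h1 : Continuous (fun z : Rd d × Rd d => iteratedFDeriv ℝ n (atom φ z) x) :=
        (continuous_iteratedFDeriv_window (conj φ) n x).comp
          (f := fun z : Rd d × Rd d => (z.1, -z.2)) (by fun_prop)
      exact (hH.smul h1).aestronglyMeasurable) (fun h => by
      refine ⟨fun z => ‖H z‖ * (gsSeminorm d h (conj φ) *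
        Real.exp (2 / h.1 * ‖((z.1, -z.2) : Rd d × Rd d)‖)), ?_, fun z => ?_⟩
      · exact (ContinuousOn.integrableOn_compact hK
          (Continuous.continuousOn (by fun_prop)))
      · exact mul_le_mul_of_nonneg_left (gsSeminorm_window_le_exp h (conj φ) (z.1, -z.2))
          (norm_nonneg _))
  refine ⟨g, fun ψ => ?_⟩
  have hHi : Integrable H (volume.restrict K) := hH.continuousOn.integrableOn_compact hK
  have hint : Integrable (Function.uncurry fun (y : Rd d) (z : Rd d × Rd d) =>
      H z * atom φ z y * ψ y) (volume.prod (volume.restrict K)) := by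
    have h1 := (ψ.integrable.mul_prod hHi).mul_bdd (c := gsSeminorm d ⟨1, one_pos⟩ (conj φ))
      (f := fun p : Rd d × (Rd d × Rd d) => ψ p.1 * H p.2)
      (g := fun p : Rd d × (Rd d × Rd d) => atom φ p.2 p.1)
      ((continuous_atom_apply φ).comp (f := fun p : Rd d × (Rd d × Rd d) => (p.2, p.1))
        (by fun_prop)).aestronglyMeasurable
      (Filter.Eventually.of_forall fun p => norm_atom_apply_le φ _ _)
    refine h1.congr (Filter.Eventually.of_forall fun p => ?_)
    simp only [Function.uncurry]
    ring
  rw [toDistribution_apply]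
  calc ∫ y, g y * ψ y = ∫ y, ∫ z in K, H z * atom φ z y * ψ y := by
        refine integral_congr_ae (Filter.Eventually.of_forall fun y => ?_)
        simp only [hg, integral_mul_const]
    _ = ∫ z in K, ∫ y, H z * atom φ z y * ψ y := integral_integral_swap hint
    _ = _ := by
        refine integral_congr_ae (Filter.Eventually.of_forall fun z => ?_)
        simp only [coef, ← integral_const_mul]
        refine integral_congr_ae (Filter.Eventually.of_forall fun y => ?_)
        simp only
        ring

/-- The inversion integral is truncated to balls. The error is synthesized from the coefficients
outside the ball; its transform tends to `0` pointwise and is dominated by a multiple of the maximal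
function of `f`, whose weighted mixed quasi-norm is finite. -/
theorem exists_tendsto_toDistribution {φ : GelfandShilov d} (hφ : φ ≠ 0) {p q r : ℝ} (hp : 0 < p)
    (hq : 0 < q) (hr : 0 < r) {W : Rd d × Rd d → ℝ≥0∞} (hW : SlowlyVarying r W)
    (hz : ∀ z, W z ≠ 0) (ht : ∀ z, W z ≠ ∞) {f : GSDistribution d}
    (hf : mix p q (fun z => ‖wval φ f z‖ₑ * W z) ≠ ∞) :
    ∃ g : ℕ → GelfandShilov d, Filter.Tendsto (fun n =>
      mix p q (fun z => ‖wval φ (f - (g n).toDistribution) z‖ₑ * W z)) Filter.atTop (nhds 0) := by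
  obtain ⟨c, hc, hinv⟩ := inversion hφ
  set a := r + 1 with ha
  have ha0 : 0 < a := by positivity
  -- As before, `a` goes into the maximal function and the extra `1` makes the remaining kernel
  -- integrable.
  obtain ⟨C, hC⟩ := enorm_wval_le_of_eq_integral φ φ (a := a + 1) (by positivity)
  obtain ⟨K₁, hK₁⟩ := exists_mix_peetre_le hφ (a := a) hr.le (by linarith) hp hq hW ht
  obtain ⟨K₂, hK₂⟩ := SlowlyVarying.exists_le_mix (d := d) (a := a + r) (by positivity) hp hq
  set H : Rd d × Rd d → ℂ := fun z => c * wval φ f z with hH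
  have hHc : Continuous H := continuous_const.mul (continuous_wval φ f)
  have hHi : ∀ ψ, Integrable (fun z => H z * coef φ ψ z) := fun ψ => by
    simpa only [hH, mul_assoc] using (integrable_wval_mul_coef φ φ f ψ).const_mul (c : ℂ)
  have hfH : ∀ ψ, f ψ = ∫ z, H z * coef φ ψ z := fun ψ => by
    rw [hinv, ← integral_const_mul]
    simp only [hH, mul_assoc]
  set B : ℕ → Set (Rd d × Rd d) := fun n => Metric.closedBall 0 (n : ℝ) with hB
  have hBm : ∀ n, MeasurableSet (B n) := fun n => measurableSet_closedBall
  choose g hg using fun n : ℕ => exists_toDistribution_eq_setIntegral φ hHc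
    (isCompact_closedBall (0 : Rd d × Rd d) (n : ℝ))
  refine ⟨g, ?_⟩
  have hdiff : ∀ n ψ, (f - (g n).toDistribution) ψ =
      ∫ z, (B n)ᶜ.indicator H z * coef φ ψ z := by
    intro n ψ
    change f ψ - (g n).toDistribution ψ = _
    rw [hfH, hg, ← integral_add_compl (hBm n) (hHi ψ), add_sub_cancel_left,
      ← integral_indicator (hBm n).compl]
    congr 1
    funext z
    exact Set.indicator_mul_left _ _ _
  set P : Rd d × Rd d → ℝ≥0∞ := peetre a (fun w => ‖wval φ f w‖ₑ) with hP
  have hPs : SlowlyVarying a P := slowlyVarying_peetre ha0.le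
  have hN : mix p q (fun z => P z * W z) ≠ ∞ :=
    ne_top_of_le_ne_top (ENNReal.mul_ne_top ENNReal.coe_ne_top hf) (hK₁ f)
  have hPt : ∀ z, P z ≠ ∞ := fun z htop => by
    have h1 := hK₂ _ (hPs.mul hW) z
    rw [htop, ENNReal.top_mul (hz z), top_le_iff] at h1
    exact ENNReal.mul_ne_top ENNReal.coe_ne_top hN h1
  set I := ∫⁻ z : Rd d × Rd d, expw (-1) z with hI
  have hIt : I ≠ ∞ := lintegral_expw_neg_ne_top one_pos
  have hle : ∀ w z, ‖H z‖ₑ * expw (-(a + 1)) (z - w) ≤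
      (ENNReal.ofReal c * P w) * expw (-1) (z - w) := by
    intro w z
    have h1 : ‖H z‖ₑ = ENNReal.ofReal c * ‖wval φ f z‖ₑ := by
      rw [hH]
      simp only
      rw [enorm_mul, ← ofReal_norm, Complex.norm_real, Real.norm_of_nonneg hc.le]
    have h2 : expw (-(a + 1)) (z - w) = expw (-a) (w - z) * expw (-1) (z - w) := by
      rw [expw_sub_comm (-a), expw_mul_expw]; ring_nf
    rw [h1, h2, ← mul_assoc]
    refine mul_le_mul' ?_ le_rfl
    rw [mul_assoc]
    exact mul_le_mul' le_rfl (le_iSup (fun z => ‖wval φ f z‖ₑ * expw (-a) (w - z)) z)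
  have hlint : ∀ w, ∫⁻ z, (ENNReal.ofReal c * P w) * expw (-1) (z - w) =
      (ENNReal.ofReal c * P w) * I := fun w => by
    rw [lintegral_const_mul' _ _ (ENNReal.mul_ne_top ENNReal.ofReal_ne_top (hPt w)),
      lintegral_sub_right_eq_self (fun z : Rd d × Rd d => expw (-1) z) w]
  have hind : ∀ n z, ‖(B n)ᶜ.indicator H z‖ₑ ≤ ‖H z‖ₑ := fun n z => by
    by_cases hz : z ∈ (B n)ᶜ
    · rw [Set.indicator_of_mem hz]
    · rw [Set.indicator_of_notMem hz, enorm_zero]; exact zero_le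
  refine tendsto_mix_zero hp hq (M := fun z => (C * (ENNReal.ofReal c * I)) * (P z * W z))
    (fun n => (continuous_wval φ _).enorm.measurable.mul hW.measurable)
    ((hPs.mul hW).measurable.const_mul _) (fun n w => ?_) ?_ (fun w => ?_)
  · calc _ ≤ C * (∫⁻ z, ‖(B n)ᶜ.indicator H z‖ₑ * expw (-(a + 1)) (z - w)) * W w :=
          mul_le_mul' (hC _ _ (hdiff n) w) le_rfl
      _ ≤ C * ((ENNReal.ofReal c * P w) * I) * W w := by
          refine mul_le_mul' (mul_le_mul' le_rfl ?_) le_rfl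
          rw [← hlint]
          exact lintegral_mono fun z => (mul_le_mul' (hind n z) le_rfl).trans (hle w z)
      _ = _ := by ring
  · have hk : (C * (ENNReal.ofReal c * I)) ≠ ∞ :=
      ENNReal.mul_ne_top ENNReal.coe_ne_top (ENNReal.mul_ne_top ENNReal.ofReal_ne_top hIt)
    rw [mix_const_mul hp hq hk]
    exact ENNReal.mul_ne_top hk hN
  · have hlim : Filter.Tendsto (fun n => ∫⁻ z, ‖(B n)ᶜ.indicator H z‖ₑ * expw (-(a + 1)) (z - w))
        Filter.atTop (nhds (∫⁻ _ : Rd d × Rd d, 0)) := by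
      refine tendsto_lintegral_of_dominated_convergence
        (fun z => (ENNReal.ofReal c * P w) * expw (-1) (z - w)) (fun n => ?_)
        (fun n => Filter.Eventually.of_forall fun z =>
          (mul_le_mul' (hind n z) le_rfl).trans (hle w z)) ?_
        (Filter.Eventually.of_forall fun z => ?_)
      · exact (hHc.measurable.indicator (hBm n).compl).enorm.mul
          ((continuous_expw _).comp (f := fun z : Rd d × Rd d => z - w) (by fun_prop)).measurable
      · rw [hlint]
        exact ENNReal.mul_ne_top (ENNReal.mul_ne_top ENNReal.ofReal_ne_top (hPt w)) hIt
      · refine tendsto_const_nhds.congr' ?_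
        obtain ⟨m, hm⟩ := exists_nat_ge ‖z‖
        filter_upwards [Filter.eventually_ge_atTop m] with n hn
        have hzB : z ∉ (B n)ᶜ := by
          rw [Set.notMem_compl_iff, hB, mem_closedBall_zero_iff]
          exact hm.trans (by exact_mod_cast hn)
        rw [Set.indicator_of_notMem hzB, enorm_zero, zero_mul]
    rw [lintegral_zero] at hlim
    have h2 : Filter.Tendsto (fun n =>
        C * (∫⁻ z, ‖(B n)ᶜ.indicator H z‖ₑ * expw (-(a + 1)) (z - w)) * W w)
        Filter.atTop (nhds (C * 0 * W w)) :=
      ENNReal.Tendsto.mul_const (ENNReal.Tendsto.const_mul hlim (Or.inr ENNReal.coe_ne_top))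
        (Or.inr (ht w))
    rw [mul_zero, zero_mul] at h2
    exact tendsto_of_tendsto_of_tendsto_of_le_of_le tendsto_const_nhds h2 (fun _ => zero_le)
      (fun n => mul_le_mul' (hC _ _ (hdiff n) w) le_rfl)

end GSDistribution


/-! ### The quasi-normed space `M^{p,q}_{(ω)}` -/

namespace GSDistribution
variable {d : ℕ}

theorem neg_one_smul_eq (f : GSDistribution d) : (-1 : ℂ) • f = -f :=
  ContinuousLinearMap.ext fun ψ => neg_one_mul (f ψ)

theorem smul_zero_eq (c : ℂ) : c • (0 : GSDistribution d) = 0 :=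
  ContinuousLinearMap.ext fun _ => mul_zero c

end GSDistribution

section ModulationSpace
open GSDistribution GelfandShilov
variable {d : ℕ} {φ : GelfandShilov d} {p q : ℝ} {ω : Rd d × Rd d → ℝ}

theorem ofReal_weight_ne_zero (hω : IsModerateWeight ω) {W : Rd d × Rd d → ℝ≥0∞}
    {z : Rd d × Rd d} (h : ENNReal.ofReal (ω z) ≤ W z) : W z ≠ 0 :=
  ((ENNReal.ofReal_pos.2 (hω.1.1 z)).trans_le h).ne'

theorem exists_modNorm_smul_add_smul_le (hp : 0 < p) (hq : 0 < q) (hω : IsModerateWeight ω) :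
    ∃ κ : ℝ≥0, ∀ (a b : ℂ) (f g : GSDistribution d), modNorm φ p q ω (a • f + b • g) ≤
      κ * (‖a‖ₑ * modNorm φ p q ω f + ‖b‖ₑ * modNorm φ p q ω g) := by
  obtain ⟨W, r, C, hr, hW, ht, hωW⟩ := hω.exists_slowlyVarying
  obtain ⟨A, hA⟩ := exists_modNorm_equiv (φ := φ) hp hq (fun z => (hω.1.1 z).le) hωW
  obtain ⟨κ, hκ⟩ := mix_add_le (d := d) hp hq
  refine ⟨A * κ * A, fun a b f g => ?_⟩
  have hm : ∀ h : GSDistribution d, Measurable fun z => ‖wval φ h z‖ₑ * W z := fun h =>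
    (continuous_wval φ h).enorm.measurable.mul hW.measurable
  calc modNorm φ p q ω (a • f + b • g)
      ≤ A * mix p q (fun z => ‖wval φ (a • f + b • g) z‖ₑ * W z) := (hA _).1
    _ ≤ A * mix p q (fun z => ‖a‖ₑ * (‖wval φ f z‖ₑ * W z) + ‖b‖ₑ * (‖wval φ g z‖ₑ * W z)) := by
        refine mul_le_mul' le_rfl (mix_mono hp hq fun z => ?_)
        rw [← mul_assoc, ← mul_assoc, ← add_mul, ← enorm_mul, ← enorm_mul]
        exact mul_le_mul' (enorm_add_le (a * wval φ f z) (b * wval φ g z)) le_rfl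
    _ ≤ A * (κ * (‖a‖ₑ * mix p q (fun z => ‖wval φ f z‖ₑ * W z) +
          ‖b‖ₑ * mix p q (fun z => ‖wval φ g z‖ₑ * W z))) := by
        refine mul_le_mul' le_rfl ((hκ _ _ ((hm f).const_mul _)).trans (le_of_eq ?_))
        rw [mix_const_mul hp hq enorm_ne_top, mix_const_mul hp hq enorm_ne_top]
    _ ≤ A * (κ * (‖a‖ₑ * (A * modNorm φ p q ω f) + ‖b‖ₑ * (A * modNorm φ p q ω g))) := by
        refine mul_le_mul' le_rfl (mul_le_mul' le_rfl (add_le_add ?_ ?_))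
        · exact mul_le_mul' le_rfl (hA f).2
        · exact mul_le_mul' le_rfl (hA g).2
    _ = _ := by push_cast; ring

/-- A slowly varying function is bounded pointwise by its mixed quasi-norm. Applied to the weighted
maximal function, this makes the transform vanish everywhere, and inversion gives `f = 0`. -/
theorem eq_zero_of_modNorm_eq_zero (hφ : φ ≠ 0) (hp : 0 < p) (hq : 0 < q)
    (hω : IsModerateWeight ω) {f : GSDistribution d} (hf : modNorm φ p q ω f = 0) : f = 0 := by
  obtain ⟨W, r, C, hr, hW, ht, hωW⟩ := hω.exists_slowlyVarying
  obtain ⟨A, hA⟩ := exists_modNorm_equiv (φ := φ) hp hq (fun z => (hω.1.1 z).le) hωW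
  obtain ⟨K₁, hK₁⟩ := exists_mix_peetre_le hφ (a := r + 1) hr.le (by linarith) hp hq hW ht
  obtain ⟨K₂, hK₂⟩ := SlowlyVarying.exists_le_mix (d := d) (a := r + 1 + r) (by positivity) hp hq
  obtain ⟨c, hc, hinv⟩ := GSDistribution.inversion hφ
  have h0 : mix p q (fun z => ‖wval φ f z‖ₑ * W z) = 0 := by simpa [hf] using (hA f).2
  have h1 : mix p q (fun z => peetre (r + 1) (fun w => ‖wval φ f w‖ₑ) z * W z) = 0 := by
    simpa [h0] using hK₁ f
  have hval : ∀ z, wval φ f z = 0 := by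
    intro z
    have h2 := hK₂ _ ((slowlyVarying_peetre (F := fun w => ‖wval φ f w‖ₑ) (a := r + 1)
      (by positivity)).mul hW) z
    rw [h1, mul_zero, nonpos_iff_eq_zero, mul_eq_zero] at h2
    have h3 := h2.resolve_right (ofReal_weight_ne_zero hω (hωW z).1)
    have h4 := (le_peetre (F := fun w => ‖wval φ f w‖ₑ) (a := r + 1) z).trans h3.le
    simpa using h4
  ext ψ
  rw [hinv]
  simp [hval]

theorem modNorm_toDistribution_lt_top (θ f : GelfandShilov d) (hp : 0 < p) (hq : 0 < q)
    (hω : IsModerateWeight ω) : modNorm θ p q ω f.toDistribution < ∞ := by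
  obtain ⟨W, r, C, hr, hW, ht, hωW⟩ := hω.exists_slowlyVarying
  obtain ⟨A, hA⟩ := exists_modNorm_equiv (φ := θ) hp hq (fun z => (hω.1.1 z).le) hωW
  exact (hA _).1.trans_lt (ENNReal.mul_lt_top ENNReal.coe_lt_top
    (mix_toDistribution_ne_top θ f hp hq hr hW (ht 0)).lt_top)

theorem exists_tendsto_modNorm_sub_toDistribution (hφ : φ ≠ 0) (hp : 0 < p) (hq : 0 < q)
    (hω : IsModerateWeight ω) {f : GSDistribution d} (hf : modNorm φ p q ω f < ∞) :
    ∃ g : ℕ → GelfandShilov d, Filter.Tendsto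
      (fun n => modNorm φ p q ω ((g n).toDistribution - f)) Filter.atTop (nhds 0) := by
  obtain ⟨W, r, C, hr, hW, ht, hωW⟩ := hω.exists_slowlyVarying
  obtain ⟨A, hA⟩ := exists_modNorm_equiv (φ := φ) hp hq (fun z => (hω.1.1 z).le) hωW
  obtain ⟨g, hg⟩ := exists_tendsto_toDistribution hφ hp hq hr hW
    (fun z => ofReal_weight_ne_zero hω (hωW z).1) ht
    (ne_top_of_le_ne_top (ENNReal.mul_ne_top ENNReal.coe_ne_top hf.ne) (hA f).2)
  refine ⟨g, ?_⟩
  have h1 := ENNReal.Tendsto.const_mul hg (Or.inr (ENNReal.coe_ne_top (r := A)))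
  rw [mul_zero] at h1
  refine tendsto_of_tendsto_of_tendsto_of_le_of_le tendsto_const_nhds h1 (fun _ => zero_le)
    fun n => ?_
  refine (hA _).1.trans (le_of_eq ?_)
  congr 2
  funext z
  have : wval φ ((g n).toDistribution - f) z = -wval φ (f - (g n).toDistribution) z := by
    simp only [wval, sub_apply, neg_sub]
  rw [this, enorm_neg]

namespace ModulationSpace

@[ext] theorem ext {f g : ModulationSpace φ p q ω} (h : f.toGS = g.toGS) : f = g := by
  cases f; cases g; cases h; rfl

theorem exists_pos_forall_lt (κ : ℝ≥0) {ε : ℝ≥0∞} (hε : 0 < ε) :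
    ∃ δ : ℝ≥0∞, 0 < δ ∧ ∀ x y, x < δ → y < δ → κ * (x + y) < ε := by
  have h1 : Filter.Tendsto (fun x : ℝ≥0∞ => κ * (x + x)) (nhds 0) (nhds 0) := by
    have : Continuous (fun x : ℝ≥0∞ => κ * (x + x)) :=
      (ENNReal.continuous_const_mul ENNReal.coe_ne_top).comp (continuous_id.add continuous_id)
    simpa using this.tendsto 0
  obtain ⟨δ, hδ, h⟩ := (ENNReal.nhds_zero_basis.tendsto_iff ENNReal.nhds_zero_basis).1 h1 ε hε
  refine ⟨δ, hδ, fun x y hx hy => lt_of_le_of_lt ?_ (h (max x y) (max_lt hx hy))⟩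
  exact mul_le_mul' le_rfl (add_le_add (le_max_left _ _) (le_max_right _ _))

theorem exists_modNorm_sub_le (hp : 0 < p) (hq : 0 < q) (hω : IsModerateWeight ω) :
    ∃ κ : ℝ≥0, ∀ f g h : GSDistribution d, modNorm φ p q ω (f - g) ≤
      κ * (modNorm φ p q ω (f - h) + modNorm φ p q ω (h - g)) ∧ modNorm φ p q ω (f - g) ≤
      κ * (modNorm φ p q ω (h - f) + modNorm φ p q ω (h - g)) := by
  obtain ⟨κ, hκ⟩ := exists_modNorm_smul_add_smul_le (φ := φ) hp hq hω
  refine ⟨κ, fun f g h => ⟨?_, ?_⟩⟩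
  · have := hκ 1 1 (f - h) (h - g)
    simpa using this
  · have := hκ (-1) 1 (h - f) (h - g)
    rw [neg_one_smul_eq, neg_sub, one_smul, sub_add_sub_cancel] at this
    simpa using this

theorem nhds_hasBasis (hp : 0 < p) (hq : 0 < q) (hω : IsModerateWeight ω)
    (f : ModulationSpace φ p q ω) : (nhds f).HasBasis (fun ε : ℝ≥0∞ => 0 < ε)
      fun ε => {g | modNorm φ p q ω (g.toGS - f.toGS) < ε} := by
  obtain ⟨κ, hκ⟩ := exists_modNorm_sub_le (φ := φ) hp hq hω
  have hzero : ∀ g : ModulationSpace φ p q ω, modNorm φ p q ω (g.toGS - g.toGS) = 0 := fun g => by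
    obtain ⟨κ, hκ⟩ := exists_modNorm_smul_add_smul_le (φ := φ) hp hq hω
    have := hκ 0 0 0 0
    rw [smul_zero_eq, add_zero] at this
    simpa using this
  refine ⟨fun U => ⟨fun hU => ?_, ?_⟩⟩
  · obtain ⟨V, hVU, hV, hf⟩ := mem_nhds_iff.1 hU
    obtain ⟨ε, hε, h⟩ := hV f hf
    exact ⟨ε, hε, fun g hg => hVU (h g hg)⟩
  · rintro ⟨ε, hε, hU⟩
    -- A ball of a quasi-norm need not be open. The set of all points with some ball inside `U` is
    -- open, by the quasi-triangle inequality.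
    refine mem_nhds_iff.2 ⟨{g | ∃ δ : ℝ≥0∞, 0 < δ ∧ ∀ k : ModulationSpace φ p q ω,
      modNorm φ p q ω (k.toGS - g.toGS) < δ → k ∈ U}, ?_, ?_, ε, hε, fun k hk => hU hk⟩
    · rintro g ⟨δ, hδ, h⟩
      exact h g (by rw [hzero]; exact hδ)
    · rintro g ⟨δ, hδ, h⟩
      obtain ⟨η, hη, hlt⟩ := exists_pos_forall_lt κ hδ
      refine ⟨η, hη, fun k hk => ⟨η, hη, fun l hl => h l ?_⟩⟩
      exact ((hκ l.toGS g.toGS k.toGS).1).trans_lt (hlt _ _ hl hk)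

theorem tendsto_nhds_iff (hp : 0 < p) (hq : 0 < q) (hω : IsModerateWeight ω) {ι : Type*}
    {l : Filter ι} {u : ι → ModulationSpace φ p q ω} {f : ModulationSpace φ p q ω} :
    Filter.Tendsto u l (nhds f) ↔
      Filter.Tendsto (fun i => modNorm φ p q ω ((u i).toGS - f.toGS)) l (nhds 0) := by
  rw [(nhds_hasBasis hp hq hω f).tendsto_right_iff, ENNReal.nhds_zero_basis.tendsto_right_iff]
  rfl

theorem t2Space (hφ : φ ≠ 0) (hp : 0 < p) (hq : 0 < q) (hω : IsModerateWeight ω) :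
    T2Space (ModulationSpace φ p q ω) := by
  obtain ⟨κ, hκ⟩ := exists_modNorm_sub_le (φ := φ) hp hq hω
  refine t2_iff_nhds.2 fun {f g} hne => ?_
  by_contra hfg
  have hpos : 0 < modNorm φ p q ω (f.toGS - g.toGS) := pos_iff_ne_zero.2 fun h =>
    hfg (ext (sub_eq_zero.1 (eq_zero_of_modNorm_eq_zero hφ hp hq hω h)))
  obtain ⟨η, hη, hlt⟩ := exists_pos_forall_lt κ hpos
  obtain ⟨k, hk₁, hk₂⟩ := (Filter.nonempty_of_mem
    (Filter.inter_mem (Filter.mem_inf_of_left ((nhds_hasBasis hp hq hω f).mem_of_mem hη))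
      (Filter.mem_inf_of_right ((nhds_hasBasis hp hq hω g).mem_of_mem hη))) :
      Set.Nonempty (_ ∩ _ : Set (ModulationSpace φ p q ω)))
  exact lt_irrefl _ (((hκ f.toGS g.toGS k.toGS).2).trans_lt (hlt _ _ hk₁ hk₂))

theorem dense_toDistribution (hφ : φ ≠ 0) (hp : 0 < p) (hq : 0 < q) (hω : IsModerateWeight ω) :
    Dense {F : ModulationSpace φ p q ω | ∃ f : GelfandShilov d, F.toGS = f.toDistribution} := by
  intro F
  obtain ⟨g, hg⟩ := exists_tendsto_modNorm_sub_toDistribution hφ hp hq hω F.finite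
  exact mem_closure_of_tendsto ((tendsto_nhds_iff hp hq hω
    (u := fun n => ⟨(g n).toDistribution, modNorm_toDistribution_lt_top φ (g n) hp hq hω⟩)).2 hg)
    (Filter.Eventually.of_forall fun n => ⟨g n, rfl⟩)

end ModulationSpace

theorem modNorm_smul_add_smul_lt_top (hp : 0 < p) (hq : 0 < q) (hω : IsModerateWeight ω) (a b : ℂ)
    {f g : GSDistribution d} (hf : modNorm φ p q ω f < ∞) (hg : modNorm φ p q ω g < ∞) :
    modNorm φ p q ω (a • f + b • g) < ∞ := by
  obtain ⟨κ, hκ⟩ := exists_modNorm_smul_add_smul_le (φ := φ) hp hq hω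
  exact (hκ a b f g).trans_lt (ENNReal.mul_lt_top ENNReal.coe_lt_top (ENNReal.add_lt_top.2
    ⟨ENNReal.mul_lt_top enorm_lt_top hf, ENNReal.mul_lt_top enorm_lt_top hg⟩))

end ModulationSpace

/-! ### Continuity of bounded bilinear maps and uniqueness of the extension -/

section BilinearMaps
open GSDistribution GelfandShilov
variable {d : ℕ} {φ₀ φ₁ φ₂ : GelfandShilov d} {p₀ q₀ p₁ q₁ p₂ q₂ : ℝ}
  {ω₀ ω₁ ω₂ : Rd d × Rd d → ℝ}

theorem IsBilinearOnModulation.continuous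
    {T : ModulationSpace φ₁ p₁ q₁ ω₁ × ModulationSpace φ₂ p₂ q₂ ω₂ → ModulationSpace φ₀ p₀ q₀ ω₀}
    (hT : IsBilinearOnModulation T) (hp₀ : 0 < p₀) (hp₁ : 0 < p₁) (hp₂ : 0 < p₂)
    (hq₀ : 0 < q₀) (hq₁ : 0 < q₁) (hq₂ : 0 < q₂) (hω₀ : IsModerateWeight ω₀)
    (hω₁ : IsModerateWeight ω₁) (hω₂ : IsModerateWeight ω₂) {C : ℝ≥0}
    (hC : ∀ f₁ f₂, modNorm φ₀ p₀ q₀ ω₀ (T (f₁, f₂)).toGS ≤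
      C * modNorm φ₁ p₁ q₁ ω₁ f₁.toGS * modNorm φ₂ p₂ q₂ ω₂ f₂.toGS) : Continuous T := by
  obtain ⟨κ, hκ⟩ := exists_modNorm_smul_add_smul_le (φ := φ₀) hp₀ hq₀ hω₀
  have hκ' : ∀ u v : GSDistribution d, modNorm φ₀ p₀ q₀ ω₀ (u + v) ≤
      κ * (modNorm φ₀ p₀ q₀ ω₀ u + modNorm φ₀ p₀ q₀ ω₀ v) := fun u v => by
    simpa using hκ 1 1 u v
  refine continuous_iff_continuousAt.2 fun ⟨f₁, f₂⟩ => ?_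
  refine (ModulationSpace.tendsto_nhds_iff hp₀ hq₀ hω₀).2 ?_
  have h₁ : Filter.Tendsto (fun g : ModulationSpace φ₁ p₁ q₁ ω₁ × ModulationSpace φ₂ p₂ q₂ ω₂ =>
      modNorm φ₁ p₁ q₁ ω₁ (g.1.toGS - f₁.toGS)) (nhds (f₁, f₂)) (nhds 0) :=
    (ModulationSpace.tendsto_nhds_iff hp₁ hq₁ hω₁).1 (continuous_fst.tendsto (f₁, f₂))
  have h₂ : Filter.Tendsto (fun g : ModulationSpace φ₁ p₁ q₁ ω₁ × ModulationSpace φ₂ p₂ q₂ ω₂ =>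
      modNorm φ₂ p₂ q₂ ω₂ (g.2.toGS - f₂.toGS)) (nhds (f₁, f₂)) (nhds 0) :=
    (ModulationSpace.tendsto_nhds_iff hp₂ hq₂ hω₂).1 (continuous_snd.tendsto (f₁, f₂))
  have hlim := ENNReal.Tendsto.const_mul (a := (κ : ℝ≥0∞)) ((ENNReal.Tendsto.mul_const
    (b := modNorm φ₂ p₂ q₂ ω₂ f₂.toGS) (ENNReal.Tendsto.const_mul (a := (C : ℝ≥0∞)) h₁
    (Or.inr ENNReal.coe_ne_top)) (Or.inr f₂.finite.ne)).add (ENNReal.Tendsto.const_mul (a := (κ : ℝ≥0∞))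
    ((ENNReal.Tendsto.const_mul (a := (C : ℝ≥0∞) * modNorm φ₁ p₁ q₁ ω₁ f₁.toGS) h₂
      (Or.inr (ENNReal.mul_ne_top ENNReal.coe_ne_top f₁.finite.ne))).add
    (ENNReal.Tendsto.mul (ENNReal.Tendsto.const_mul (a := (C : ℝ≥0∞)) h₁
      (Or.inr ENNReal.coe_ne_top)) (by simp) h₂ (by simp))) (Or.inr ENNReal.coe_ne_top)))
    (Or.inr ENNReal.coe_ne_top)
  simp only [mul_zero, zero_mul, add_zero] at hlim
  refine tendsto_of_tendsto_of_tendsto_of_le_of_le tendsto_const_nhds hlim (fun _ => zero_le) ?_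
  rintro ⟨g₁, g₂⟩
  obtain ⟨D₁, hD₁, e₁⟩ := hT.1 1 (-1) g₁ f₁ f₂
  obtain ⟨D₁', hD₁', e₁'⟩ := hT.1 1 (-1) g₁ f₁ g₂
  obtain ⟨D₂, hD₂, e₂⟩ := hT.2 1 (-1) f₁ g₂ f₂
  obtain ⟨D₂', hD₂', e₂'⟩ := hT.2 1 (-1) D₁ g₂ f₂
  -- Bilinearity provides the difference `g₁ - f₁` separately for each second argument, and likewise
  -- `g₂ - f₂`; equality of the underlying distributions identifies the copies.
  obtain rfl : D₁' = D₁ := ModulationSpace.ext (hD₁'.trans hD₁.symm)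
  obtain rfl : D₂' = D₂ := ModulationSpace.ext (hD₂'.trans hD₂.symm)
  have hd₁ : D₁'.toGS = g₁.toGS - f₁.toGS := by rw [hD₁, one_smul, neg_one_smul_eq, sub_eq_add_neg]
  have hd₂ : D₂'.toGS = g₂.toGS - f₂.toGS := by rw [hD₂, one_smul, neg_one_smul_eq, sub_eq_add_neg]
  -- The increment is split into two terms linear in the differences and one quadratic term, each
  -- small by the bound on `T`.
  have hsum : (T (g₁, g₂)).toGS - (T (f₁, f₂)).toGS =
      (T (D₁', f₂)).toGS + ((T (f₁, D₂')).toGS + (T (D₁', D₂')).toGS) := by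
    rw [e₂', e₁', e₁, e₂]
    simp only [one_smul, neg_one_smul_eq]
    abel
  simp only
  rw [hsum, ← hd₁, ← hd₂]
  refine (hκ' _ _).trans (mul_le_mul' le_rfl (add_le_add (hC _ _) ((hκ' _ _).trans ?_)))
  exact mul_le_mul' le_rfl (add_le_add (hC _ _) (hC _ _))

theorem ExtendsConvolution.eq_of_continuous (hφ₀ : φ₀ ≠ 0) (hφ₁ : φ₁ ≠ 0) (hφ₂ : φ₂ ≠ 0)
    (hp₀ : 0 < p₀) (hp₁ : 0 < p₁) (hp₂ : 0 < p₂) (hq₀ : 0 < q₀) (hq₁ : 0 < q₁) (hq₂ : 0 < q₂)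
    (hω₀ : IsModerateWeight ω₀) (hω₁ : IsModerateWeight ω₁) (hω₂ : IsModerateWeight ω₂)
    {S T : ModulationSpace φ₁ p₁ q₁ ω₁ × ModulationSpace φ₂ p₂ q₂ ω₂ → ModulationSpace φ₀ p₀ q₀ ω₀}
    (hS : ExtendsConvolution S) (hSc : Continuous S) (hT : ExtendsConvolution T)
    (hTc : Continuous T) : S = T := by
  have := ModulationSpace.t2Space hφ₀ hp₀ hq₀ hω₀
  refine Continuous.ext_on ((ModulationSpace.dense_toDistribution hφ₁ hp₁ hq₁ hω₁).prod
    (ModulationSpace.dense_toDistribution hφ₂ hp₂ hq₂ hω₂)) hSc hTc ?_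
  rintro ⟨F, G⟩ ⟨⟨f, hf⟩, ⟨g, hg⟩⟩
  obtain ⟨F₁, G₁, k₁, hF₁, hG₁, hk₁, h₁⟩ := hS f g
  obtain ⟨F₂, G₂, k₂, hF₂, hG₂, hk₂, h₂⟩ := hT f g
  obtain rfl : F₁ = F := ModulationSpace.ext (hF₁.trans hf.symm)
  obtain rfl : F₂ = F₁ := ModulationSpace.ext (hF₂.trans hf.symm)
  obtain rfl : G₁ = G := ModulationSpace.ext (hG₁.trans hg.symm)
  obtain rfl : G₂ = G₁ := ModulationSpace.ext (hG₂.trans hg.symm)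
  obtain rfl : k₁ = k₂ := GelfandShilov.ext fun x => (hk₁ x).trans (hk₂ x).symm
  exact ModulationSpace.ext (h₁.trans h₂.symm)

end BilinearMaps

/-! ### The extension of the convolution -/

open GSDistribution GelfandShilov in
theorem mainTheorem1 (d : ℕ) (p q : Fin 3 → ℝ) (ω : Fin 3 → Rd d × Rd d → ℝ)
    (φ : Fin 3 → GelfandShilov d)
    (hp : ∀ j, 0 < p j) (hq : ∀ j, 0 < q j)
    (hω : ∀ j, IsModerateWeight (ω j)) (hφ : ∀ j, φ j ≠ 0)
    (hYoung : 1 / p 0 ≤ 1 / p 1 + 1 / p 2 - max 1 (max (1 / p 1) (1 / p 2)))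
    (hHolder : 1 / q 0 ≤ 1 / q 1 + 1 / q 2)
    (hweight : ∀ x₁ x₂ ξ : Rd d, ω 0 (x₁ + x₂, ξ) ≤ ω 1 (x₁, ξ) * ω 2 (x₂, ξ)) :
    ∃ T : ModulationSpace (φ 1) (p 1) (q 1) (ω 1) × ModulationSpace (φ 2) (p 2) (q 2) (ω 2) →
        ModulationSpace (φ 0) (p 0) (q 0) (ω 0),
      ExtendsConvolution T ∧ Continuous T ∧ IsBilinearOnModulation T ∧
      (∃ C : ℝ≥0, ∀ f₁ f₂,
        modNorm (φ 0) (p 0) (q 0) (ω 0) (T (f₁, f₂)).toGS ≤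
          C * modNorm (φ 1) (p 1) (q 1) (ω 1) f₁.toGS *
            modNorm (φ 2) (p 2) (q 2) (ω 2) f₂.toGS) ∧
      ∀ S : ModulationSpace (φ 1) (p 1) (q 1) (ω 1) × ModulationSpace (φ 2) (p 2) (q 2) (ω 2) →
          ModulationSpace (φ 0) (p 0) (q 0) (ω 0),
        ExtendsConvolution S → Continuous S → S = T := by
  choose W r B hr hW ht hωW using fun j => (hω j).exists_slowlyVarying
  choose A hA using fun j =>
    exists_modNorm_equiv (φ := φ j) (hp j) (hq j) (fun z => ((hω j).1.1 z).le) (hωW j)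
  -- The sum is a common rate of variation for the three weights.
  have hrs : ∀ j, r j ≤ ∑ i, r i := fun j =>
    Finset.single_le_sum (fun i _ => (hr i).le) (Finset.mem_univ j)
  have hWC : ∀ x₁ x₂ ξ, W 0 (x₁ + x₂, ξ) ≤ B 0 * (W 1 (x₁, ξ) * W 2 (x₂, ξ)) := by
    intro x₁ x₂ ξ
    calc W 0 (x₁ + x₂, ξ) ≤ B 0 * ENNReal.ofReal (ω 0 (x₁ + x₂, ξ)) := (hωW 0 _).2
      _ ≤ B 0 * (ENNReal.ofReal (ω 1 (x₁, ξ)) * ENNReal.ofReal (ω 2 (x₂, ξ))) := by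
          rw [← ENNReal.ofReal_mul ((hω 1).1.1 _).le]
          exact mul_le_mul' le_rfl (ENNReal.ofReal_le_ofReal (hweight x₁ x₂ ξ))
      _ ≤ _ := mul_le_mul' le_rfl (mul_le_mul' (hωW 1 _).1 (hωW 2 _).1)
  obtain ⟨K, hK⟩ := exists_stftConv_estimate (φ₀ := φ 0) (hφ 1) (hφ 2) (hp 0) (hp 1) (hp 2)
    (hq 0) (hq 1) (hq 2) hYoung hHolder ((hr 0).trans_le (hrs 0)) ((hW 0).mono (hrs 0))
    ((hW 1).mono (hrs 1)) ((hW 2).mono (hrs 2))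
    (fun z => ofReal_weight_ne_zero (hω 0) (hωW 0 z).1) (ht 0) (ht 1) (ht 2) hWC
  set Θ := conv (φ 1) (involution (φ 1)) with hΘ
  obtain ⟨c, hc, hinv⟩ := GSDistribution.inversion (conv_involution_ne_zero (hφ 1))
  have hfin : ∀ j (f : ModulationSpace (φ j) (p j) (q j) (ω j)),
      mix (p j) (q j) (fun z => ‖wval (φ j) f.toGS z‖ₑ * W j z) ≠ ∞ := fun j f =>
    ne_top_of_le_ne_top (ENNReal.mul_ne_top ENNReal.coe_ne_top f.finite.ne) (hA j f.toGS).2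
  -- The product is prescribed by the inversion formula for the window `Θ`, with `stftConv` in the
  -- place of the transform.
  have hex : ∀ (f₁ : ModulationSpace (φ 1) (p 1) (q 1) (ω 1))
      (f₂ : ModulationSpace (φ 2) (p 2) (q 2) (ω 2)), ∃ f : GSDistribution d,
        (∀ ψ, f ψ = c * ∫ z, stftConv (φ 1) f₁.toGS f₂.toGS z * coef Θ ψ z) ∧
        modNorm (φ 0) (p 0) (q 0) (ω 0) f ≤ (A 0 * ‖c‖₊ * K * A 1 * A 2 : ℝ≥0) *
          modNorm (φ 1) (p 1) (q 1) (ω 1) f₁.toGS * modNorm (φ 2) (p 2) (q 2) (ω 2) f₂.toGS := by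
    intro f₁ f₂
    obtain ⟨-, -, f, hf, hle⟩ := hK f₁.toGS f₂.toGS (hfin 1 f₁) (hfin 2 f₂)
    refine ⟨(c : ℂ) • f, fun ψ => by rw [← hf]; rfl, ?_⟩
    calc _ ≤ A 0 * mix (p 0) (q 0) (fun z => ‖wval (φ 0) ((c : ℂ) • f) z‖ₑ * W 0 z) := (hA 0 _).1
      _ = A 0 * (‖c‖₊ * mix (p 0) (q 0) (fun z => ‖wval (φ 0) f z‖ₑ * W 0 z)) := by
          rw [← mix_const_mul (hp 0) (hq 0) (c := ‖c‖₊) ENNReal.coe_ne_top]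
          congr 2
          funext z
          rw [← mul_assoc]
          congr 1
          change ‖(c : ℂ) * wval (φ 0) f z‖ₑ = _
          rw [enorm_mul]
          congr 1
          rw [← ofReal_norm, Complex.norm_real, ofReal_norm]
          rfl
      _ ≤ A 0 * (‖c‖₊ * (K * ((A 1 * modNorm (φ 1) (p 1) (q 1) (ω 1) f₁.toGS) *
            (A 2 * modNorm (φ 2) (p 2) (q 2) (ω 2) f₂.toGS)))) := by
          refine mul_le_mul' le_rfl (mul_le_mul' le_rfl (hle.trans (mul_le_mul' le_rfl ?_)))
          exact mul_le_mul' (hA 1 _).2 (hA 2 _).2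
      _ = _ := by push_cast; ring
  choose f hf hle using hex
  set T : ModulationSpace (φ 1) (p 1) (q 1) (ω 1) × ModulationSpace (φ 2) (p 2) (q 2) (ω 2) →
      ModulationSpace (φ 0) (p 0) (q 0) (ω 0) := fun F =>
    ⟨f F.1 F.2, (hle F.1 F.2).trans_lt (ENNReal.mul_lt_top (ENNReal.mul_lt_top ENNReal.coe_lt_top
      F.1.finite) F.2.finite)⟩ with hTdef
  have hTf : ∀ f₁ f₂ ψ, (T (f₁, f₂)).toGS ψ =
      c * ∫ z, stftConv (φ 1) f₁.toGS f₂.toGS z * coef Θ ψ z := hf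
  -- For `f, g` in `Σ₁` the integrand is the transform of `f * g` with window `Θ`, so inversion
  -- returns `f * g`.
  have hext : ExtendsConvolution T := fun f g =>
    ⟨⟨f.toDistribution, modNorm_toDistribution_lt_top _ f (hp 1) (hq 1) (hω 1)⟩,
      ⟨g.toDistribution, modNorm_toDistribution_lt_top _ g (hp 2) (hq 2) (hω 2)⟩, conv f g, rfl, rfl,
      conv_apply f g, by
        ext ψ
        rw [hTf, hinv]
        simp only [stftConv_toDistribution]
        rfl⟩
  have hlin : ∀ {H H₁ H₂ : Rd d × Rd d → ℂ} {ψ : GelfandShilov d} (a b : ℂ),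
      Integrable (fun z => H₁ z * coef Θ ψ z) → Integrable (fun z => H₂ z * coef Θ ψ z) →
      (∀ z, H z = a * H₁ z + b * H₂ z) → (c : ℂ) * ∫ z, H z * coef Θ ψ z =
        a * (c * ∫ z, H₁ z * coef Θ ψ z) + b * (c * ∫ z, H₂ z * coef Θ ψ z) := by
    intro H H₁ H₂ ψ a b h₁ h₂ hH
    have : ∫ z, H z * coef Θ ψ z =
        a * (∫ z, H₁ z * coef Θ ψ z) + b * ∫ z, H₂ z * coef Θ ψ z := by
      rw [← integral_const_mul, ← integral_const_mul,
        ← integral_add (h₁.const_mul a) (h₂.const_mul b)]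
      congr 1
      funext z
      rw [hH]; ring
    rw [this]; ring
  have hbil : IsBilinearOnModulation T := by
    refine ⟨fun a b f f' g => ⟨⟨a • f.toGS + b • f'.toGS, modNorm_smul_add_smul_lt_top (hp 1) (hq 1)
      (hω 1) a b f.finite f'.finite⟩, rfl, ?_⟩, fun a b f g g' => ⟨⟨a • g.toGS + b • g'.toGS,
      modNorm_smul_add_smul_lt_top (hp 2) (hq 2) (hω 2) a b g.finite g'.finite⟩, rfl, ?_⟩⟩
    · obtain ⟨h₁, h₂, -⟩ := hK f.toGS g.toGS (hfin 1 f) (hfin 2 g)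
      obtain ⟨h₁', h₂', -⟩ := hK f'.toGS g.toGS (hfin 1 f') (hfin 2 g)
      ext ψ
      change _ = a * (T (f, g)).toGS ψ + b * (T (f', g)).toGS ψ
      rw [hTf, hTf, hTf]
      exact hlin a b (h₂ ψ) (h₂' ψ) fun z => stftConv_add_smul_left (h₁ z) (h₁' z) a b
    · obtain ⟨h₁, h₂, -⟩ := hK f.toGS g.toGS (hfin 1 f) (hfin 2 g)
      obtain ⟨h₁', h₂', -⟩ := hK f.toGS g'.toGS (hfin 1 f) (hfin 2 g')
      ext ψ
      change _ = a * (T (f, g)).toGS ψ + b * (T (f, g')).toGS ψ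
      rw [hTf, hTf, hTf]
      exact hlin a b (h₂ ψ) (h₂' ψ) fun z => stftConv_add_smul_right (h₁ z) (h₁' z) a b
  have hcont : Continuous T := hbil.continuous (hp 0) (hp 1) (hp 2) (hq 0) (hq 1) (hq 2)
    (hω 0) (hω 1) (hω 2) hle
  exact ⟨T, hext, hcont, hbil, ⟨_, hle⟩, fun S hS hSc => hS.eq_of_continuous (hφ 0) (hφ 1) (hφ 2)
    (hp 0) (hp 1) (hp 2) (hq 0) (hq 1) (hq 2) (hω 0) (hω 1) (hω 2) hSc hext hcont⟩
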